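/- Let $\Gamma$ be a finite group acting by algebra automorphisms on a unital complex algebra $A$, let $I\subset A$ be a $\Gamma$-invariant two-sided ideal, let $A\rtimes\Gamma$ be the crossed product (with $a\gamma\cdot b\gamma'=a\,\gamma(b)\,\gamma\gamma'$) and put $J:=I\rtimes\Gamma=\{\sum_\gamma a_\gamma\gamma : a_\gamma\in I\}$, $\widehat A:=\varprojlim_j A/I^j$. Definitions. For a unital complex algebra $R$ with an endomorphism $g$ let $\mathcal B_q(R)=R\otimes(R/\mathbb C1)^{\otimes q}$, with the operators $$b_g(a_0\otimes\dots\otimes a_n)=a_0g(a_1)\otimes a_2\otimes\dots\otimes a_n+\sum_{i=1}^{n-1}(-1)^i a_0\otimes\dots\otimes a_ia_{i+1}\otimes\dots\otimes a_n+(-1)^na_na_0\otimes a_1\otimes\dots\otimes a_{n-1},$$ $$B_g(a_0\otimes\dots\otimes a_n)=\sum_{k=0}^n(-1)^{nk}\,1\otimes a_{n-k+1}\otimes\dots\otimes a_n\otimes a_0\otimes g(a_1)\otimes\dots\otimes g(a_{n-k}).$$ If $K\subset R$ is a two-sided ideal with $g(K)\subset K$, let $\widehat{\mathcal B}_q(\widehat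 R)=\varprojlim_j\mathcal B_q(R/K^j)$, with the induced operators $b_g$, $B_g$, and let $X_q$ be the quotient of $\widehat{\mathcal B}_q(\widehat R)$ by the image of $g-1$, where $g$ acts diagonally. The topological twisted groups are: $\mathrm{HH}^{top}_q(\widehat R,g)$, the homology of $(\widehat{\mathcal B}_*(\widehat R),b_g)$; $\mathrm{HC}^{top}_q(\widehat R,g)$, the homology of the complex $\big(\bigoplus_{k\ge0}X_{q-2k},\,b_g+B_g\big)$; and $\mathrm{HP}^{top}_q(\widehat R,g)$, $q\in\mathbb Z/2$, the homology of the $2$-periodic complex $\big(\prod_{m\equiv q\ (2)}X_m,\,b_g+B_g\big)$. For $\gamma\in\Gamma$ the $\gamma$-components $\mathrm{HH}^{top}_q(\widehat A\rtimes\Gamma)_\gamma$, $\mathrm{HC}^{top}_q(\widehat A\rtimes\Gamma)_\gamma$, $\mathrm{HP}^{top}_q(\widehat A\rtimes\Gamma)_\gamma$ are obtained in the same way (with $R=A\rtimes\Gamma$, $K=J$, $g=1$) from the subcomplex, stable under $b$ and $B$, of the elements of $\varprojlim_j\mathcal B_q((A\rtimes\Gamma)/J^j)$ whose image for each $j$ lies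 in the span of the tensors $a_0\gamma_0\otimes\dots\otimes a_q\gamma_q$ with $\gamma_0\gamma_1\cdots\gamma_q$ conjugate to $\gamma$. Let $C_\gamma$ be the centralizer of $\gamma$ in $\Gamma$; it acts diagonally on the $\gamma$-twisted groups of $\widehat A$. Proposition. (1) There is an isomorphism of algebras $\widehat A\rtimes\Gamma\simeq\varprojlim_j(A\rtimes\Gamma)/J^j$, namely the natural one: it sends $x\gamma$, with $x=(a_j \bmod I^j)_j\in\widehat A$ and $\gamma\in\Gamma$, to $(a_j\gamma \bmod J^j)_j$. (2) For every $\gamma\in\Gamma$ and all $q$ there are linear isomorphisms $$\mathrm{HH}^{top}_q(\widehat A\rtimes\Gamma)_\gamma\simeq \mathrm{HH}^{top}_q(\widehat A,\gamma)^{C_\gamma},\quad \mathrm{HC}^{top}_q(\widehat A\rtimes\Gamma)_\gamma\simeq \mathrm{HC}^{top}_q(\widehat A,\gamma)^{C_\gamma},\quad \mathrm{HP}^{top}_q(\widehat A\rtimes\Gamma)_\gamma\simeq \mathrm{HP}^{top}_q(\widehat A,\gamma)^{C_\gamma},$$ natural in $(A,I)$ with respect to $\Gamma$-equivariant unital algebra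 homomorphisms $f:A\to A'$ with $f(I)\subset I'$. -/

import Mathlib

noncomputable section

namespace CrossedHomology

/-! ### Graded vector spaces with operators `b` and `B`, and their homology -/

/-- A graded complex vector space `X_n`, `n ≥ 0`, with operators `b` of degree `-1` and `B` of
degree `+1`. It is a mixed complex if `b² = 0`, `B² = 0` and `bB + Bb = 0`. -/
structure Mixed.{u} where
  X : ℕ → Type u
  [grp : ∀ n, AddCommGroup (X n)]
  [mod : ∀ n, Module ℂ (X n)]
  b : ∀ n, X (n + 1) →ₗ[ℂ] X n
  B : ∀ n, X n →ₗ[ℂ] X (n + 1)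

attribute [instance] Mixed.grp Mixed.mod

namespace Mixed

universe u v w

/-- Degreewise linear maps commuting with `b` and `B`. -/
structure Hom (M : Mixed.{u}) (N : Mixed.{v}) where
  f : ∀ n, M.X n →ₗ[ℂ] N.X n
  comm_b : ∀ n x, f n (M.b n x) = N.b n (f (n + 1) x)
  comm_B : ∀ n x, f (n + 1) (M.B n x) = N.B n (f n x)

/-- The subquotient `Z / (Z ∩ D)` of a vector space; it is `Z / D` whenever `D ≤ Z`. -/
abbrev Subquot {V : Type u} [AddCommGroup V] [Module ℂ V] (Z D : Submodule ℂ V) : Type u :=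
  Z ⧸ D.submoduleOf Z

/-- The map of subquotients induced by a linear map. -/
def subquotMap {V : Type u} [AddCommGroup V] [Module ℂ V] {W : Type v} [AddCommGroup W]
    [Module ℂ W] (f : V →ₗ[ℂ] W) {Z D : Submodule ℂ V} {Z' D' : Submodule ℂ W}
    (hZ : ∀ x ∈ Z, f x ∈ Z') (hD : ∀ x ∈ D, f x ∈ D') : Subquot Z D →ₗ[ℂ] Subquot Z' D' :=
  Submodule.mapQ _ _ (f.restrict hZ) (fun x hx => hD x hx)

/-- Hochschild cycles: the kernel of `b : X_q → X_{q-1}`, where `X_{-1} = 0`. -/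
def hhCycles (M : Mixed.{u}) : (q : ℕ) → Submodule ℂ (M.X q)
  | 0 => ⊤
  | n + 1 => LinearMap.ker (M.b n)

/-- The homology of `(X_*, b)` in degree `q`. -/
abbrev HH (M : Mixed.{u}) (q : ℕ) : Type u :=
  Subquot (M.hhCycles q) (LinearMap.range (M.b q))

/-- The operator `b + B` on `∏ X_m`. -/
def tot (M : Mixed.{u}) : (∀ m, M.X m) →ₗ[ℂ] (∀ m, M.X m) :=
  LinearMap.pi fun m => match m with
    | 0 => M.b 0 ∘ₗ LinearMap.proj 1
    | m + 1 => M.b (m + 1) ∘ₗ LinearMap.proj (m + 2) + M.B m ∘ₗ LinearMap.proj m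

/-- The projection of `∏ X_m` to its components of degree `< n`. -/
def trunc (M : Mixed.{u}) (n : ℕ) : (∀ m, M.X m) →ₗ[ℂ] (∀ m, M.X m) :=
  LinearMap.pi fun m => if m < n then LinearMap.proj m else 0

/-- The cyclic chains `⨁_{q ≥ 0} X_{n-2q}`, as the elements of `∏ X_m` supported in the degrees
`n, n - 2, n - 4, …`. -/
def cyclicChains (M : Mixed.{u}) (n : ℕ) : Submodule ℂ (∀ m, M.X m) where
  carrier := {x | ∀ m, ¬ (m ≤ n ∧ m % 2 = n % 2) → x m = 0}
  add_mem' := fun hx hy m hm => by simp [hx m hm, hy m hm]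
  zero_mem' := fun _ _ => rfl
  smul_mem' := fun c x hx m hm => by simp [hx m hm]

/-- The differential `b + B` of the cyclic complex on chains of degree `n`, where the component in
degree `n + 1` is dropped. -/
def cyclicD (M : Mixed.{u}) (n : ℕ) : (∀ m, M.X m) →ₗ[ℂ] (∀ m, M.X m) := M.trunc n ∘ₗ M.tot

/-- Cyclic homology: the homology of `(⨁_{q ≥ 0} X_{n-2q}, b + B)`. -/
abbrev HC (M : Mixed.{u}) (n : ℕ) : Type u :=
  Subquot (M.cyclicChains n ⊓ LinearMap.ker (M.cyclicD n))
    ((M.cyclicChains (n + 1)).map (M.cyclicD (n + 1)))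

/-- The periodic chains `∏_{m ≡ i mod 2} X_m`. -/
def periodicChains (M : Mixed.{u}) (i : ZMod 2) : Submodule ℂ (∀ m, M.X m) where
  carrier := {x | ∀ m : ℕ, (m : ZMod 2) ≠ i → x m = 0}
  add_mem' := fun hx hy m hm => by simp [hx m hm, hy m hm]
  zero_mem' := fun _ _ => rfl
  smul_mem' := fun c x hx m hm => by simp [hx m hm]

/-- Periodic cyclic homology: the homology of the 2-periodic complex
`(∏_{m ≡ i mod 2} X_m, b + B)`. -/
abbrev HP (M : Mixed.{u}) (i : ZMod 2) : Type u :=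
  Subquot (M.periodicChains i ⊓ LinearMap.ker M.tot) ((M.periodicChains (i + 1)).map M.tot)

namespace Hom

variable {M : Mixed.{u}} {N : Mixed.{v}} (F : Hom M N)

/-- The induced map of products. -/
def prod : (∀ m, M.X m) →ₗ[ℂ] (∀ m, N.X m) := LinearMap.pi fun m => F.f m ∘ₗ LinearMap.proj m

theorem prod_apply (x : ∀ m, M.X m) (m : ℕ) : F.prod x m = F.f m (x m) := rfl

theorem prod_tot (x : ∀ m, M.X m) : F.prod (M.tot x) = N.tot (F.prod x) := by
  funext m
  cases m with
  | zero => exact F.comm_b 0 (x 1)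
  | succ m =>
    change F.f (m + 1) (M.b (m + 1) (x (m + 2)) + M.B m (x m)) = _
    rw [map_add, F.comm_b, F.comm_B]
    rfl

theorem prod_trunc (n : ℕ) (x : ∀ m, M.X m) : F.prod (M.trunc n x) = N.trunc n (F.prod x) := by
  funext m
  by_cases h : m < n <;> simp [trunc, prod, h]

theorem prod_cyclicD (n : ℕ) (x : ∀ m, M.X m) :
    F.prod (M.cyclicD n x) = N.cyclicD n (F.prod x) := by
  simp [cyclicD, prod_trunc, prod_tot]

theorem prod_mem_cyclicChains {n : ℕ} {x : ∀ m, M.X m} (hx : x ∈ M.cyclicChains n) :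
    F.prod x ∈ N.cyclicChains n := fun m hm => by rw [prod_apply, hx m hm, map_zero]

theorem prod_mem_periodicChains {i : ZMod 2} {x : ∀ m, M.X m} (hx : x ∈ M.periodicChains i) :
    F.prod x ∈ N.periodicChains i := fun m hm => by rw [prod_apply, hx m hm, map_zero]

/-- The map induced on `HH`. -/
def mapHH (q : ℕ) : HH M q →ₗ[ℂ] HH N q :=
  subquotMap (F.f q)
    (by
      cases q with
      | zero => intro x _; trivial
      | succ q =>
        intro x hx
        have hx' : M.b q x = 0 := hx
        change N.b q (F.f (q + 1) x) = 0
        rw [← F.comm_b, hx', map_zero])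
    (by rintro _ ⟨y, rfl⟩; exact ⟨F.f (q + 1) y, (F.comm_b q y).symm⟩)

/-- The map induced on `HC`. -/
def mapHC (n : ℕ) : HC M n →ₗ[ℂ] HC N n :=
  subquotMap F.prod
    (by
      rintro x ⟨hx, hx'⟩
      refine ⟨F.prod_mem_cyclicChains hx, ?_⟩
      have hx'' : M.cyclicD n x = 0 := hx'
      change N.cyclicD n (F.prod x) = 0
      rw [← F.prod_cyclicD, hx'', map_zero])
    (by
      rintro _ ⟨y, hy, rfl⟩
      exact ⟨F.prod y, F.prod_mem_cyclicChains hy, (F.prod_cyclicD _ y).symm⟩)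

/-- The map induced on `HP`. -/
def mapHP (i : ZMod 2) : HP M i →ₗ[ℂ] HP N i :=
  subquotMap F.prod
    (by
      rintro x ⟨hx, hx'⟩
      refine ⟨F.prod_mem_periodicChains hx, ?_⟩
      have hx'' : M.tot x = 0 := hx'
      change N.tot (F.prod x) = 0
      rw [← F.prod_tot, hx'', map_zero])
    (by
      rintro _ ⟨y, hy, rfl⟩
      exact ⟨F.prod y, F.prod_mem_periodicChains hy, (F.prod_tot y).symm⟩)

end Hom

/-! Inverse limits, subobjects and quotients. -/

/-- The inverse limit of a sequence `… → L 2 → L 1 → L 0`. -/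
def lim (L : ℕ → Mixed.{u}) (p : ∀ j, Hom (L (j + 1)) (L j)) : Mixed.{u} where
  X n := ({ carrier := {x | ∀ j, (p j).f n (x (j + 1)) = x j}
            add_mem' := fun hx hy j => by simp [hx j, hy j]
            zero_mem' := fun j => by simp
            smul_mem' := fun c x hx j => by simp [hx j] } : Submodule ℂ (∀ j, (L j).X n))
  b n := (LinearMap.pi fun j => (L j).b n ∘ₗ LinearMap.proj j).restrict
    (fun x hx j => ((p j).comm_b n (x (j + 1))).trans (congrArg _ (hx j)))
  B n := (LinearMap.pi fun j => (L j).B n ∘ₗ LinearMap.proj j).restrict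
    (fun x hx j => ((p j).comm_B n (x (j + 1))).trans (congrArg _ (hx j)))

/-- The map of inverse limits induced by a morphism of sequences. -/
def limMap {L : ℕ → Mixed.{u}} {p : ∀ j, Hom (L (j + 1)) (L j)} {L' : ℕ → Mixed.{v}}
    {p' : ∀ j, Hom (L' (j + 1)) (L' j)} (F : ∀ j, Hom (L j) (L' j))
    (hF : ∀ j n x, (F j).f n ((p j).f n x) = (p' j).f n ((F (j + 1)).f n x)) :
    Hom (lim L p) (lim L' p') where
  f n := (LinearMap.pi fun j => (F j).f n ∘ₗ LinearMap.proj j).restrict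
    (fun x hx j => (hF j n (x (j + 1))).symm.trans (congrArg _ (hx j)))
  comm_b n x := Subtype.ext (funext fun j => (F j).comm_b n (x.1 j))
  comm_B n x := Subtype.ext (funext fun j => (F j).comm_B n (x.1 j))

/-- The restriction of `b` and `B` to subspaces that they preserve. -/
def sub (M : Mixed.{u}) (S : ∀ n, Submodule ℂ (M.X n)) (hb : ∀ n, ∀ x ∈ S (n + 1), M.b n x ∈ S n)
    (hB : ∀ n, ∀ x ∈ S n, M.B n x ∈ S (n + 1)) : Mixed.{u} where
  X n := S n
  b n := (M.b n).restrict (hb n)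
  B n := (M.B n).restrict (hB n)

/-- The restriction of a morphism to subobjects. -/
def subMap {M : Mixed.{u}} {N : Mixed.{v}} {S : ∀ n, Submodule ℂ (M.X n)} {hb hB}
    {S' : ∀ n, Submodule ℂ (N.X n)} {hb' hB'} (F : Hom M N) (hF : ∀ n, ∀ x ∈ S n, F.f n x ∈ S' n) :
    Hom (M.sub S hb hB) (N.sub S' hb' hB') where
  f n := (F.f n).restrict (hF n)
  comm_b n x := Subtype.ext (F.comm_b n x.1)
  comm_B n x := Subtype.ext (F.comm_B n x.1)

/-- The quotient of `M` by the image of `G - 1`, for an endomorphism `G` of `M`. -/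
def coinv (M : Mixed.{u}) (G : Hom M M) : Mixed.{u} where
  X n := M.X n ⧸ LinearMap.range (G.f n - LinearMap.id)
  b n := Submodule.mapQ _ _ (M.b n) (by
    rintro _ ⟨y, rfl⟩
    exact ⟨M.b n y, by simp [G.comm_b]⟩)
  B n := Submodule.mapQ _ _ (M.B n) (by
    rintro _ ⟨y, rfl⟩
    exact ⟨M.B n y, by simp [G.comm_B]⟩)

/-- The map of quotients induced by a morphism that intertwines the endomorphisms. -/
def coinvMap {M : Mixed.{u}} {N : Mixed.{v}} {G : Hom M M} {G' : Hom N N} (F : Hom M N)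
    (hF : ∀ n x, F.f n (G.f n x) = G'.f n (F.f n x)) : Hom (M.coinv G) (N.coinv G') where
  f n := Submodule.mapQ _ _ (F.f n) (by
    rintro _ ⟨y, rfl⟩
    exact ⟨F.f n y, by simp [hF]⟩)
  comm_b n x := by
    obtain ⟨y, rfl⟩ := Submodule.Quotient.mk_surjective _ x
    exact congrArg _ (F.comm_b n y)
  comm_B n x := by
    obtain ⟨y, rfl⟩ := Submodule.Quotient.mk_surjective _ x
    exact congrArg _ (F.comm_B n y)

end Mixed

end CrossedHomology
namespace CrossedHomology

universe u v w

/-! ### The twisted Hochschild complex of an algebra -/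

section Faces

variable {n : ℕ}

/-- The `i`-th twisted face of `(a_0, …, a_{n+1})`: it multiplies `a_i` and `a_{i+1}`
(`a_0 g(a_1)` for `i = 0`) if `i ≤ n`, and it is `(a_{n+1} a_0, a_1, …, a_n)` if `i = n + 1`. -/
def face {A : Type u} [Mul A] (g : A → A) (i : Fin (n + 2)) (a : Fin (n + 2) → A)
    (j : Fin (n + 1)) : A :=
  if (i : ℕ) = n + 1 then
    if j = 0 then a (Fin.last (n + 1)) * a 0 else a j.castSucc
  else if (j : ℕ) < i then a j.castSucc
  else if (j : ℕ) = i then a j.castSucc * (if i = 0 then g (a j.succ) else a j.succ)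
  else a j.succ

/-- The tuple `(1, a_{n-k+1}, …, a_n, a_0, g(a_1), …, g(a_{n-k}))`. Here `p - k` is computed
modulo `n + 1`. -/
def rot {A : Type u} [One A] (g : A → A) (k : Fin (n + 1)) (a : Fin (n + 1) → A) :
    Fin (n + 2) → A :=
  Fin.cons 1 fun p => if k < p then g (a (p - k)) else a (p - k)

theorem map_face {A : Type u} {A' : Type v} [Mul A] [Mul A'] {g : A → A} {g' : A' → A'}
    (f : A → A') (hm : ∀ x y, f (x * y) = f x * f y) (hg : ∀ x, f (g x) = g' (f x))
    (i : Fin (n + 2)) (a : Fin (n + 2) → A) (j : Fin (n + 1)) :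
    f (face g i a j) = face g' i (fun k => f (a k)) j := by
  unfold face
  split_ifs <;> simp [hm, hg]

theorem map_rot {A : Type u} {A' : Type v} [One A] [One A'] {g : A → A} {g' : A' → A'}
    (f : A → A') (h1 : f 1 = 1) (hg : ∀ x, f (g x) = g' (f x))
    (k : Fin (n + 1)) (a : Fin (n + 1) → A) (j : Fin (n + 2)) :
    f (rot g k a j) = rot g' k (fun l => f (a l)) j := by
  unfold rot
  refine Fin.cases ?_ (fun p => ?_) j
  · simp [h1]
  · simp only [Fin.cons_succ]
    split_ifs <;> simp [hg]

end Faces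

section Slot

variable {A : Type u} [Ring A] [Algebra ℂ A] {m n : ℕ}

/-- Changing one entry of `a` changes one entry of `φ a`, linearly. -/
def SlotLinear (φ : (Fin m → A) → (Fin n → A)) : Prop :=
  ∀ a k, ∃ (j : Fin n) (L : A →ₗ[ℂ] A), ∀ x,
    φ (Function.update a k x) = Function.update (φ a) j (L x)

/-- The linear map `a_1 ⊗ … ⊗ a_m ↦ φ(a)_1 ⊗ … ⊗ φ(a)_n`. -/
def slotMap (φ : (Fin m → A) → (Fin n → A)) (h : SlotLinear φ) :
    PiTensorProduct ℂ (fun _ : Fin m => A) →ₗ[ℂ] PiTensorProduct ℂ (fun _ : Fin n => A) :=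
  PiTensorProduct.lift
    { toFun := fun a => PiTensorProduct.tprod ℂ (φ a)
      map_update_add' := by
        intro inst a k x y
        obtain rfl : inst = instDecidableEqFin m := Subsingleton.elim _ _
        obtain ⟨j, L, hL⟩ := h a k
        simp only [hL, map_add, MultilinearMap.map_update_add]
      map_update_smul' := by
        intro inst a k c x
        obtain rfl : inst = instDecidableEqFin m := Subsingleton.elim _ _
        obtain ⟨j, L, hL⟩ := h a k
        simp only [hL, map_smul, MultilinearMap.map_update_smul] }

theorem slotMap_tprod (φ : (Fin m → A) → (Fin n → A)) (h : SlotLinear φ) (a : Fin m → A) :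
    slotMap φ h (PiTensorProduct.tprod ℂ a) = PiTensorProduct.tprod ℂ (φ a) :=
  PiTensorProduct.lift.tprod a

theorem slotLinear_face (g : A →ₐ[ℂ] A) (i : Fin (n + 2)) :
    SlotLinear (face (n := n) g i) := by
  intro a k
  by_cases hi : (i : ℕ) = n + 1
  · by_cases hk : k = Fin.last (n + 1)
    · refine ⟨0, LinearMap.mulRight ℂ (a 0), fun x => funext fun j => ?_⟩
      subst hk
      by_cases hj : j = 0
      · subst hj
        simp [face, hi, Fin.ext_iff]
      · have : (j : ℕ) ≠ n + 1 := by omega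
        simp [face, hi, hj, Fin.ext_iff, this]
    · by_cases hk0 : k = 0
      · subst hk0
        refine ⟨0, LinearMap.mulLeft ℂ (a (Fin.last (n + 1))), fun x => funext fun j => ?_⟩
        by_cases hj : j = 0
        · subst hj
          simp [face, hi, Fin.ext_iff]
        · have : (j : ℕ) ≠ 0 := fun h => hj (Fin.ext h)
          simp [face, hi, hj, Fin.ext_iff, this]
      · have hkn : (k : ℕ) < n + 1 := by
          have := k.2
          have : (k : ℕ) ≠ n + 1 := fun h => hk (Fin.ext h)
          omega
        refine ⟨⟨k, hkn⟩, LinearMap.id, fun x => funext fun j => ?_⟩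
        have hk0' : (k : ℕ) ≠ 0 := fun h => hk0 (Fin.ext h)
        by_cases hj : j = 0
        · subst hj
          simp [face, hi, Fin.ext_iff, hk0'.symm, hkn.ne']
        · simp [face, hi, hj, Function.update_apply, Fin.ext_iff]
  · have hin : (i : ℕ) < n + 1 := by omega
    rcases lt_trichotomy (k : ℕ) i with hk | hk | hk
    · refine ⟨⟨k, by omega⟩, LinearMap.id, fun x => funext fun j => ?_⟩
      simp only [face, hi, if_false, Function.update_apply, Fin.ext_iff, LinearMap.id_apply,
        Fin.val_castSucc, Fin.val_succ]
      split_ifs <;> first | rfl | omega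
    · refine ⟨⟨i, hin⟩, LinearMap.mulRight ℂ (if i = 0 then g (a (Fin.succ ⟨i, hin⟩))
        else a (Fin.succ ⟨i, hin⟩)), fun x => funext fun j => ?_⟩
      by_cases hj : (j : ℕ) = i
      · obtain rfl : j = ⟨i, hin⟩ := Fin.ext hj
        obtain rfl : k = Fin.castSucc ⟨i, hin⟩ := Fin.ext hk
        have : Fin.succ ⟨i, hin⟩ ≠ Fin.castSucc (⟨i, hin⟩ : Fin (n + 1)) := fun h => by
          simpa using congrArg Fin.val h
        simp only [face, hi, if_false, lt_irrefl, if_true, Function.update_self,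
          Function.update_of_ne this, LinearMap.mulRight_apply]
      · simp only [face, hi, hj, if_false, Function.update_apply, Fin.ext_iff,
          Fin.val_castSucc, Fin.val_succ]
        split_ifs <;> first | rfl | omega
    · by_cases hk' : (k : ℕ) = i + 1
      · refine ⟨⟨i, hin⟩, LinearMap.mulLeft ℂ (a (Fin.castSucc ⟨i, hin⟩)) ∘ₗ
          (if i = 0 then g.toLinearMap else LinearMap.id), fun x => funext fun j => ?_⟩
        by_cases hj : (j : ℕ) = i
        · obtain rfl : j = ⟨i, hin⟩ := Fin.ext hj
          obtain rfl : k = Fin.succ ⟨i, hin⟩ := Fin.ext hk'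
          have : Fin.castSucc (⟨i, hin⟩ : Fin (n + 1)) ≠ Fin.succ ⟨i, hin⟩ := fun h => by
            simpa using congrArg Fin.val h
          simp only [face, hi, if_false, lt_irrefl, if_true, Function.update_self,
            Function.update_of_ne this, LinearMap.comp_apply, LinearMap.mulLeft_apply]
          split_ifs <;> rfl
        · simp only [face, hi, hj, if_false, Function.update_apply, Fin.ext_iff,
            Fin.val_castSucc, Fin.val_succ]
          split_ifs <;> first | rfl | omega
      · refine ⟨⟨k - 1, by omega⟩, LinearMap.id, fun x => funext fun j => ?_⟩
        simp only [face, hi, if_false, Function.update_apply, Fin.ext_iff, LinearMap.id_apply,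
          Fin.val_castSucc, Fin.val_succ, Fin.val_zero]
        split_ifs <;> first | rfl | omega

theorem slotLinear_rot (g : A →ₐ[ℂ] A) (k : Fin (n + 1)) :
    SlotLinear (rot (n := n) g k) := by
  intro a l
  refine ⟨(l + k).succ, if k < l + k then g.toLinearMap else LinearMap.id,
    fun x => funext fun j => ?_⟩
  refine Fin.cases ?_ (fun p => ?_) j
  · rw [Function.update_of_ne (Fin.succ_ne_zero _).symm]
    simp [rot]
  · by_cases hp : p = l + k
    · subst hp
      by_cases h : k < l + k <;> simp [rot, h]
    · have h1 : p - k ≠ l := fun h => hp (by rw [← h]; simp)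
      have h2 : p.succ ≠ (l + k).succ := fun h => hp (Fin.succ_injective _ h)
      rw [Function.update_of_ne h2]
      simp [rot, Function.update_of_ne h1]

end Slot

section Chains

variable (A : Type u) [Ring A] [Algebra ℂ A]

/-- The kernel of `A ⊗ A^{⊗ q} → A ⊗ (A / ℂ1)^{⊗ q}`: the span of the tensors
`a_0 ⊗ … ⊗ a_q` with `a_i = 1` for some `i ≥ 1`. -/
def degen (q : ℕ) : Submodule ℂ (PiTensorProduct ℂ (fun _ : Fin (q + 1) => A)) :=
  Submodule.span ℂ {x | ∃ a : Fin (q + 1) → A, (∃ i, i ≠ 0 ∧ a i = 1) ∧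
    x = PiTensorProduct.tprod ℂ a}

/-- The normalized Hochschild chains `A ⊗ (A / ℂ1)^{⊗ q}`. -/
abbrev Chains (q : ℕ) : Type u := PiTensorProduct ℂ (fun _ : Fin (q + 1) => A) ⧸ degen A q

variable {A}

/-- The class of `a_0 ⊗ … ⊗ a_q`. -/
def chain {q : ℕ} (a : Fin (q + 1) → A) : Chains A q :=
  Submodule.Quotient.mk (PiTensorProduct.tprod ℂ a)

theorem chain_eq_zero {q : ℕ} {a : Fin (q + 1) → A} {i : Fin (q + 1)} (hi : i ≠ 0)
    (ha : a i = 1) : chain a = 0 :=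
  (Submodule.Quotient.mk_eq_zero _).2 (Submodule.subset_span ⟨a, ⟨i, hi, ha⟩, rfl⟩)

theorem chains_hom_ext {q : ℕ} {V : Type v} [AddCommGroup V] [Module ℂ V]
    {F G : Chains A q →ₗ[ℂ] V} (h : ∀ a, F (chain a) = G (chain a)) : F = G := by
  refine Submodule.linearMap_qext _ (PiTensorProduct.ext (MultilinearMap.ext fun a => ?_))
  exact h a

/-- `b_g` on unnormalized chains. -/
def bPre (g : A →ₐ[ℂ] A) (n : ℕ) : PiTensorProduct ℂ (fun _ : Fin (n + 2) => A) →ₗ[ℂ]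
    PiTensorProduct ℂ (fun _ : Fin (n + 1) => A) :=
  ∑ i : Fin (n + 2), (-1 : ℂ) ^ (i : ℕ) • slotMap (face g i) (slotLinear_face g i)

/-- `B_g` on unnormalized chains. -/
def BPre (g : A →ₐ[ℂ] A) (n : ℕ) : PiTensorProduct ℂ (fun _ : Fin (n + 1) => A) →ₗ[ℂ]
    PiTensorProduct ℂ (fun _ : Fin (n + 2) => A) :=
  ∑ k : Fin (n + 1), (-1 : ℂ) ^ (n * k) • slotMap (rot g k) (slotLinear_rot g k)

theorem mk_bPre (g : A →ₐ[ℂ] A) (n : ℕ) (a : Fin (n + 2) → A) :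
    (Submodule.Quotient.mk (bPre g n (PiTensorProduct.tprod ℂ a)) : Chains A n) =
      ∑ i : Fin (n + 2), (-1 : ℂ) ^ (i : ℕ) • chain (face g i a) := by
  simp only [bPre, LinearMap.sum_apply, LinearMap.smul_apply, slotMap_tprod, chain]
  rw [← Submodule.mkQ_apply, map_sum]
  simp

theorem mk_BPre (g : A →ₐ[ℂ] A) (n : ℕ) (a : Fin (n + 1) → A) :
    (Submodule.Quotient.mk (BPre g n (PiTensorProduct.tprod ℂ a)) : Chains A (n + 1)) =
      ∑ k : Fin (n + 1), (-1 : ℂ) ^ (n * k : ℕ) • chain (rot g k a) := by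
  simp only [BPre, LinearMap.sum_apply, LinearMap.smul_apply, slotMap_tprod, chain]
  rw [← Submodule.mkQ_apply, map_sum]
  simp

theorem bPre_degen (g : A →ₐ[ℂ] A) (n : ℕ) :
    degen A (n + 1) ≤ (degen A n).comap (bPre g n) := by
  refine Submodule.span_le.2 ?_
  rintro _ ⟨a, ⟨i, hi, ha⟩, rfl⟩
  have hi0 : (i : ℕ) ≠ 0 := fun h => hi (Fin.ext h)
  change bPre g n _ ∈ degen A n
  rw [← Submodule.Quotient.mk_eq_zero, mk_bPre]
  obtain ⟨i', hi'⟩ : ∃ i' : Fin (n + 2), (i' : ℕ) + 1 = i := ⟨⟨i - 1, by omega⟩, by simp; omega⟩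
  have hne : i' ≠ i := fun h => by subst h; omega
  have hin : (i' : ℕ) ≠ n + 1 := by omega
  rw [Finset.sum_eq_add i' i hne]
  · have : face g i' a = face g i a := by
      funext j
      have e1 : ∀ l : Fin (n + 2), (l : ℕ) = i → a l = 1 := fun l hl => by
        rw [show l = i from Fin.ext hl, ha]
      unfold face
      rw [if_neg hin]
      by_cases hlast : (i : ℕ) = n + 1
      · rw [if_pos hlast, e1 (Fin.last _) (by simp; omega)]
        by_cases hj : (j : ℕ) = i'
        · rw [if_neg (by omega), if_pos hj, e1 j.succ (by simp; omega), map_one, ite_self, mul_one]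
          split_ifs with h
          · subst h; simp
          · rfl
        · have := j.2
          rw [if_pos (by omega)]
          split_ifs with h
          · subst h; simp
          · rfl
      · rw [if_neg hlast, if_neg hi]
        rcases lt_trichotomy (j : ℕ) i' with hj | hj | hj
        · rw [if_pos hj, if_pos (by omega)]
        · have h1 : (j : ℕ) < i := by omega
          rw [if_neg (by omega), if_pos hj, if_pos h1, e1 j.succ (by simp; omega),
            map_one, ite_self, mul_one]
        · rw [if_neg (by omega), if_neg (by omega), if_neg (by omega)]
          by_cases hj' : (j : ℕ) = i
          · rw [if_pos hj', e1 j.castSucc (by simp; omega), one_mul]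
          · rw [if_neg hj']
    rw [this, ← add_smul, ← hi', pow_succ]
    simp
  · intro c _ hc
    have hc1 : (c : ℕ) ≠ i' := fun h => hc.1 (Fin.ext h)
    have hc2 : (c : ℕ) ≠ i := fun h => hc.2 (Fin.ext h)
    suffices h : chain (face g c a) = 0 by rw [h, smul_zero]
    by_cases hcl : (c : ℕ) = n + 1
    · refine chain_eq_zero (i := ⟨i, by omega⟩) (fun h => hi0 (congrArg Fin.val h)) ?_
      unfold face
      rw [if_pos hcl, if_neg (fun h => hi0 (congrArg Fin.val h))]
      exact ha
    · rcases lt_or_gt_of_ne hc2 with h | h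
      · refine chain_eq_zero (i := ⟨i - 1, by omega⟩) (fun h => ?_) ?_
        · have := congrArg Fin.val h
          simp at this
          omega
        · unfold face
          rw [if_neg hcl, if_neg (by simp; omega), if_neg (by simp; omega), ← ha]
          congr 1
          ext
          simp
          omega
      · refine chain_eq_zero (i := ⟨i, by omega⟩) (fun h => hi0 (congrArg Fin.val h)) ?_
        unfold face
        rw [if_neg hcl, if_pos (by simpa using h)]
        exact ha
  · simp
  · simp

theorem BPre_degen (g : A →ₐ[ℂ] A) (n : ℕ) :
    degen A n ≤ (degen A (n + 1)).comap (BPre g n) := by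
  refine Submodule.span_le.2 ?_
  rintro _ ⟨a, ⟨i, hi, ha⟩, rfl⟩
  change BPre g n _ ∈ degen A (n + 1)
  rw [← Submodule.Quotient.mk_eq_zero, mk_BPre]
  refine Finset.sum_eq_zero fun k _ => ?_
  rw [chain_eq_zero (i := (i + k).succ) (Fin.succ_ne_zero _), smul_zero]
  simp [rot, ha]

/-- The operator `b_g (a_0 ⊗ … ⊗ a_n) = a_0 g(a_1) ⊗ a_2 ⊗ … ⊗ a_n + ∑_{0<i<n} (-1)^i … ⊗ a_i a_{i+1} ⊗ …
+ (-1)^n a_n a_0 ⊗ a_1 ⊗ … ⊗ a_{n-1}`. -/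
def chainsb (g : A →ₐ[ℂ] A) (n : ℕ) : Chains A (n + 1) →ₗ[ℂ] Chains A n :=
  Submodule.mapQ _ _ (bPre g n) (bPre_degen g n)

/-- The operator `B_g (a_0 ⊗ … ⊗ a_n) =
∑_{k=0}^n (-1)^{nk} 1 ⊗ a_{n-k+1} ⊗ … ⊗ a_n ⊗ a_0 ⊗ g(a_1) ⊗ … ⊗ g(a_{n-k})`. For `g = 1` this is
Connes' operator; modulo the image of `g - 1` it satisfies `b_g B_g + B_g b_g = 0` and
`B_g² = 0`. -/
def chainsB (g : A →ₐ[ℂ] A) (n : ℕ) : Chains A n →ₗ[ℂ] Chains A (n + 1) :=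
  Submodule.mapQ _ _ (BPre g n) (BPre_degen g n)

/-- The normalized `g`-twisted Hochschild chains of `A`, with `b_g` and `B_g`. -/
def hochschild (g : A →ₐ[ℂ] A) : Mixed.{u} where
  X q := Chains A q
  b n := chainsb g n
  B n := chainsB g n

theorem chainsb_chain (g : A →ₐ[ℂ] A) (n : ℕ) (a : Fin (n + 2) → A) :
    chainsb g n (chain a) = ∑ i : Fin (n + 2), (-1 : ℂ) ^ (i : ℕ) • chain (face g i a) :=
  mk_bPre g n a

theorem chainsB_chain (g : A →ₐ[ℂ] A) (n : ℕ) (a : Fin (n + 1) → A) :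
    chainsB g n (chain a) = ∑ k : Fin (n + 1), (-1 : ℂ) ^ (n * k : ℕ) • chain (rot g k a) :=
  mk_BPre g n a

variable {A' : Type v} [Ring A'] [Algebra ℂ A']

/-- The map `a_0 ⊗ … ⊗ a_q ↦ f(a_0) ⊗ … ⊗ f(a_q)`. -/
def chainsMap (f : A →ₐ[ℂ] A') (q : ℕ) : Chains A q →ₗ[ℂ] Chains A' q :=
  Submodule.mapQ _ _ (PiTensorProduct.map fun _ => f.toLinearMap) (by
    refine Submodule.span_le.2 ?_
    rintro _ ⟨a, ⟨i, hi, ha⟩, rfl⟩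
    refine Submodule.subset_span ⟨fun i => f (a i), ⟨i, hi, by simp [ha]⟩, ?_⟩
    simp)

theorem chainsMap_chain (f : A →ₐ[ℂ] A') {q : ℕ} (a : Fin (q + 1) → A) :
    chainsMap f q (chain a) = chain fun i => f (a i) := by
  refine (Submodule.mapQ_apply _ _ _ _).trans ?_
  rw [PiTensorProduct.map_tprod]
  rfl

/-- The morphism induced by an algebra homomorphism that intertwines the twists. -/
def hochschildMap {g : A →ₐ[ℂ] A} {g' : A' →ₐ[ℂ] A'} (f : A →ₐ[ℂ] A')
    (hf : ∀ x, f (g x) = g' (f x)) : Mixed.Hom (hochschild g) (hochschild g') where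
  f q := chainsMap f q
  comm_b n x := by
    refine LinearMap.congr_fun (f := chainsMap f n ∘ₗ chainsb g n)
      (g := chainsb g' n ∘ₗ chainsMap f (n + 1)) (chains_hom_ext fun a => ?_) x
    rw [LinearMap.comp_apply, LinearMap.comp_apply, chainsMap_chain, chainsb_chain, chainsb_chain,
      map_sum]
    refine Finset.sum_congr rfl fun i _ => ?_
    rw [map_smul, chainsMap_chain]
    congr 2
    funext j
    exact map_face f (map_mul f) hf i a j
  comm_B n x := by
    refine LinearMap.congr_fun (f := chainsMap f (n + 1) ∘ₗ chainsB g n)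
      (g := chainsB g' n ∘ₗ chainsMap f n) (chains_hom_ext fun a => ?_) x
    rw [LinearMap.comp_apply, LinearMap.comp_apply, chainsMap_chain, chainsB_chain, chainsB_chain,
      map_sum]
    refine Finset.sum_congr rfl fun i _ => ?_
    rw [map_smul, chainsMap_chain]
    congr 2
    funext j
    exact map_rot f (map_one f) hf i a j

theorem hochschildMap_chain {g : A →ₐ[ℂ] A} {g' : A' →ₐ[ℂ] A'} (f : A →ₐ[ℂ] A')
    (hf : ∀ x, f (g x) = g' (f x)) {q : ℕ} (a : Fin (q + 1) → A) :
    (hochschildMap f hf).f q (chain a) = chain fun i => f (a i) := chainsMap_chain f a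

end Chains

end CrossedHomology
namespace CrossedHomology

universe u v w

/-! ### Adic completions -/

theorem le_comap_pow {R : Type u} [Ring R] [Algebra ℂ R] {R' : Type v} [Ring R'] [Algebra ℂ R']
    {I : Ideal R} {I' : Ideal R'} (f : R →ₐ[ℂ] R') (h : ∀ x ∈ I, f x ∈ I') (j : ℕ) :
    I ^ j ≤ (I' ^ j).comap f := by
  induction j with
  | zero => intro x _; simp [Submodule.pow_zero, Ideal.one_eq_top]
  | succ j ih =>
    rw [Submodule.pow_succ, Submodule.pow_succ]
    refine Ideal.mul_le.2 fun x hx y hy => ?_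
    rw [Ideal.mem_comap, map_mul]
    exact Ideal.mul_mem_mul (ih hx) (h y hy)

/-- The projection `R / I^{j+1} → R / I^j`. -/
def powProj {R : Type u} [Ring R] [Algebra ℂ R] (I : Ideal R) [I.IsTwoSided] (j : ℕ) :
    R ⧸ I ^ (j + 1) →ₐ[ℂ] R ⧸ I ^ j :=
  Ideal.Quotient.factorₐ ℂ (Ideal.pow_le_pow_right (Nat.le_succ j))

/-- The `I`-adic completion `lim R / I^j`. -/
def completion {R : Type u} [Ring R] [Algebra ℂ R] (I : Ideal R) [I.IsTwoSided] :
    Subalgebra ℂ (∀ j : ℕ, R ⧸ I ^ j) where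
  carrier := {x | ∀ j, powProj I j (x (j + 1)) = x j}
  mul_mem' := fun hx hy j => by simp [hx j, hy j]
  add_mem' := fun hx hy j => by simp [hx j, hy j]
  algebraMap_mem' := fun c j => by simp

/-- A unital complex algebra `R` with a two-sided ideal `I`, regarded with the `I`-adic filtration,
and an endomorphism `g` of `R` which preserves `I`. -/
structure AdicAlg where
  R : Type u
  [ring : Ring R]
  [alg : Algebra ℂ R]
  I : Ideal R
  [twoSided : I.IsTwoSided]
  g : R →ₐ[ℂ] R
  g_mem : ∀ x ∈ I, g x ∈ I

attribute [instance] AdicAlg.ring AdicAlg.alg AdicAlg.twoSided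

namespace AdicAlg

/-- Algebra homomorphisms that respect the ideals and intertwine the endomorphisms. -/
structure Hom (T : AdicAlg.{u}) (T' : AdicAlg.{v}) where
  f : T.R →ₐ[ℂ] T'.R
  mem : ∀ x ∈ T.I, f x ∈ T'.I
  comm : ∀ x, f (T.g x) = T'.g (f x)

/-- The induced map `R / I^j → R' / I'^j`. -/
def Hom.level {T : AdicAlg.{u}} {T' : AdicAlg.{v}} (F : Hom T T') (j : ℕ) :
    T.R ⧸ T.I ^ j →ₐ[ℂ] T'.R ⧸ T'.I ^ j :=
  Ideal.quotientMapₐ (T'.I ^ j) F.f (le_comap_pow F.f F.mem j)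

/-- The endomorphism `g`, as a morphism. -/
def twist (T : AdicAlg.{u}) : Hom T T := ⟨T.g, T.g_mem, fun _ => rfl⟩

/-- The topological twisted Hochschild complex with its operators `b_g` and `B_g`: the completion
`lim_j (R / I^j) ⊗ ((R / I^j) / ℂ1)^{⊗ q}` of the normalized Hochschild complex of `R`. -/
def topHochschild (T : AdicAlg.{u}) : Mixed.{u} :=
  Mixed.lim (fun j => hochschild (T.twist.level j)) fun j =>
    hochschildMap (powProj T.I j) (by
      intro x
      obtain ⟨y, rfl⟩ := Ideal.Quotient.mk_surjective x
      rfl)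

/-- The induced morphism of topological twisted Hochschild complexes. -/
def topMap {T : AdicAlg.{u}} {T' : AdicAlg.{v}} (F : Hom T T') :
    Mixed.Hom T.topHochschild T'.topHochschild :=
  Mixed.limMap
    (fun j => hochschildMap (F.level j) (by
      intro x
      obtain ⟨y, rfl⟩ := Ideal.Quotient.mk_surjective x
      exact congrArg (Ideal.Quotient.mk (T'.I ^ j)) (F.comm y)))
    (by
      intro j n x
      refine LinearMap.congr_fun (f := chainsMap (F.level j) n ∘ₗ chainsMap (powProj T.I j) n)
        (g := chainsMap (powProj T'.I j) n ∘ₗ chainsMap (F.level (j + 1)) n)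
        (chains_hom_ext fun a => ?_) x
      simp only [LinearMap.comp_apply, chainsMap_chain]
      congr 1
      funext i
      obtain ⟨y, hy⟩ := Ideal.Quotient.mk_surjective (a i)
      rw [← hy]
      rfl)

/-- The quotient of the topological twisted Hochschild complex by the image of `g - 1`, from which
the twisted cyclic and periodic cyclic homology are computed. -/
def topCyclic (T : AdicAlg.{u}) : Mixed.{u} := T.topHochschild.coinv (topMap T.twist)

/-- The induced morphism on the quotients by the images of `g - 1`. -/
def topCyclicMap {T : AdicAlg.{u}} {T' : AdicAlg.{v}} (F : Hom T T') :
    Mixed.Hom T.topCyclic T'.topCyclic :=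
  Mixed.coinvMap (topMap F) (by
    intro n x
    refine Subtype.ext (funext fun j => ?_)
    refine LinearMap.congr_fun (f := chainsMap (F.level j) n ∘ₗ chainsMap (T.twist.level j) n)
      (g := chainsMap (T'.twist.level j) n ∘ₗ chainsMap (F.level j) n)
      (chains_hom_ext fun a => ?_) (x.1 j)
    simp only [LinearMap.comp_apply, chainsMap_chain]
    congr 1
    funext i
    obtain ⟨y, hy⟩ := Ideal.Quotient.mk_surjective (a i)
    rw [← hy]
    exact congrArg (Ideal.Quotient.mk (T'.I ^ j)) (F.comm y))

end AdicAlg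

/-! ### Group actions and crossed products -/

/-- A unital complex algebra `A` with an action of `Γ` by algebra automorphisms and a two-sided
ideal `I` which is invariant under `Γ`. -/
structure GAlg (Γ : Type v) [Group Γ] where
  A : Type u
  [ring : Ring A]
  [alg : Algebra ℂ A]
  [act : MulSemiringAction Γ A]
  [comm : SMulCommClass Γ ℂ A]
  I : Ideal A
  [twoSided : I.IsTwoSided]
  smul_mem : ∀ (g : Γ), ∀ a ∈ I, g • a ∈ I

attribute [instance] GAlg.ring GAlg.alg GAlg.act GAlg.comm GAlg.twoSided

namespace GAlg

variable {Γ : Type v} [Group Γ]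

/-- Equivariant algebra homomorphisms that map the ideal into the ideal. -/
structure Hom (P : GAlg.{u} Γ) (Q : GAlg.{w} Γ) where
  f : P.A →ₐ[ℂ] Q.A
  smul : ∀ (g : Γ) a, f (g • a) = g • f a
  mem : ∀ a ∈ P.I, f a ∈ Q.I

/-- The algebra `A` with the ideal `I` and the automorphism given by `γ`. -/
abbrev twisted (P : GAlg.{u} Γ) (γ : Γ) : AdicAlg.{u} where
  R := P.A
  I := P.I
  g := MulSemiringAction.toAlgHom ℂ P.A γ
  g_mem := P.smul_mem γ

/-- An equivariant homomorphism intertwines the actions of `γ`. -/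
def twistedMap {P : GAlg.{u} Γ} {Q : GAlg.{w} Γ} (F : Hom P Q) (γ : Γ) :
    AdicAlg.Hom (P.twisted γ) (Q.twisted γ) := ⟨F.f, F.mem, F.smul γ⟩

/-- The action of an element `h` of the centralizer of `γ`. -/
def centralizerMap (P : GAlg.{u} Γ) (γ : Γ) (h : Subgroup.centralizer {γ}) :
    AdicAlg.Hom (P.twisted γ) (P.twisted γ) where
  f := MulSemiringAction.toAlgHom ℂ P.A (h : Γ)
  mem := P.smul_mem h
  comm := fun a => by
    change (h : Γ) • γ • (show P.A from a) = γ • (h : Γ) • (show P.A from a)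
    rw [smul_smul, smul_smul, Subgroup.mem_centralizer_singleton_iff.1 h.2]

/-- The induced action of `Γ` on the completion of `A`. -/
instance completionAction (P : GAlg.{u} Γ) : MulSemiringAction Γ (completion P.I) where
  smul g x := ⟨fun j => (P.twisted g).twist.level j (x.1 j), fun j => by
    refine Eq.trans ?_ (congrArg ((P.twisted g).twist.level j) (x.2 j))
    dsimp only
    obtain ⟨y, hy⟩ := Ideal.Quotient.mk_surjective (x.1 (j + 1))
    rw [← hy]
    rfl⟩
  one_smul x := Subtype.ext (funext fun j => by
    obtain ⟨y, hy⟩ := Ideal.Quotient.mk_surjective (x.1 j)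
    change (P.twisted (1 : Γ)).twist.level j (x.1 j) = x.1 j
    rw [← hy]
    exact congrArg (Ideal.Quotient.mk (P.I ^ j)) (one_smul Γ (y : P.A)))
  mul_smul g h x := Subtype.ext (funext fun j => by
    obtain ⟨y, hy⟩ := Ideal.Quotient.mk_surjective (x.1 j)
    change (P.twisted (g * h)).twist.level j (x.1 j) =
      (P.twisted g).twist.level j ((P.twisted h).twist.level j (x.1 j))
    rw [← hy]
    exact congrArg (Ideal.Quotient.mk (P.I ^ j)) (mul_smul g h (y : P.A)))
  smul_zero g := Subtype.ext (funext fun j => map_zero ((P.twisted g).twist.level j))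
  smul_add g x y := Subtype.ext (funext fun j => map_add ((P.twisted g).twist.level j) _ _)
  smul_one g := Subtype.ext (funext fun j => map_one ((P.twisted g).twist.level j))
  smul_mul g x y := Subtype.ext (funext fun j => map_mul ((P.twisted g).twist.level j) _ _)

instance completionComm (P : GAlg.{u} Γ) : SMulCommClass Γ ℂ (completion P.I) where
  smul_comm g c x := Subtype.ext (funext fun j =>
    map_smul ((P.twisted g).twist.level j) c (x.1 j))

/-- The ideal `I ⋊ Γ` of `A ⋊ Γ`. -/
def crossedIdeal (P : GAlg.{u} Γ) : Ideal (SkewMonoidAlgebra P.A Γ) where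
  carrier := {x | ∀ g, x.coeff g ∈ P.I}
  add_mem' := fun hx hy g => by
    rw [SkewMonoidAlgebra.coeff_add]
    exact P.I.add_mem (hx g) (hy g)
  zero_mem' := fun g => by simp
  smul_mem' := fun y x hx g => by
    classical
    rw [smul_eq_mul, SkewMonoidAlgebra.coeff_mul]
    refine Submodule.sum_mem _ fun h _ => Submodule.sum_mem _ fun k _ => ?_
    dsimp only
    split_ifs
    · exact P.I.mul_mem_left _ (P.smul_mem _ _ (hx _))
    · exact P.I.zero_mem

instance (P : GAlg.{u} Γ) : P.crossedIdeal.IsTwoSided where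
  mul_mem_of_left := fun {x} y hx g => by
    classical
    rw [SkewMonoidAlgebra.coeff_mul]
    refine Submodule.sum_mem _ fun h _ => Submodule.sum_mem _ fun k _ => ?_
    dsimp only
    split_ifs
    · exact P.I.mul_mem_right _ (hx _)
    · exact P.I.zero_mem

/-- The crossed product `A ⋊ Γ` with the ideal `I ⋊ Γ` and the identity endomorphism. -/
abbrev crossed (P : GAlg.{u} Γ) : AdicAlg.{max u v} where
  R := SkewMonoidAlgebra P.A Γ
  I := P.crossedIdeal
  g := AlgHom.id ℂ _
  g_mem := fun _ hx => hx

/-- The homomorphism `A ⋊ Γ → A' ⋊ Γ`, `a γ ↦ f(a) γ`. -/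
def crossedAlgHom {P : GAlg.{u} Γ} {Q : GAlg.{w} Γ} (F : Hom P Q) :
    SkewMonoidAlgebra P.A Γ →ₐ[ℂ] SkewMonoidAlgebra Q.A Γ :=
  SkewMonoidAlgebra.liftNCAlgHom
    (AlgHom.comp
      { (SkewMonoidAlgebra.singleOneRingHom : Q.A →+* SkewMonoidAlgebra Q.A Γ) with
        commutes' := fun _ => rfl } F.f)
    (SkewMonoidAlgebra.of Q.A Γ)
    (by
      intro a g
      change SkewMonoidAlgebra.single 1 (F.f (g • a)) * SkewMonoidAlgebra.single g 1 =
        SkewMonoidAlgebra.single g 1 * SkewMonoidAlgebra.single 1 (F.f a)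
      simp [SkewMonoidAlgebra.single_mul_single, F.smul])

theorem crossedAlgHom_single {P : GAlg.{u} Γ} {Q : GAlg.{w} Γ} (F : Hom P Q) (g : Γ) (a : P.A) :
    crossedAlgHom F (SkewMonoidAlgebra.single g a) = SkewMonoidAlgebra.single g (F.f a) := by
  refine (SkewMonoidAlgebra.liftNC_single _ _ _ _).trans ?_
  change SkewMonoidAlgebra.single 1 (F.f a) * SkewMonoidAlgebra.single g 1 = _
  simp [SkewMonoidAlgebra.single_mul_single]

theorem crossedAlgHom_mem {P : GAlg.{u} Γ} {Q : GAlg.{w} Γ} (F : Hom P Q)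
    (x : SkewMonoidAlgebra P.A Γ) (hx : x ∈ P.crossedIdeal) :
    crossedAlgHom F x ∈ Q.crossedIdeal := by
  classical
  rw [← SkewMonoidAlgebra.sum_single x, SkewMonoidAlgebra.sum_def', map_sum]
  refine Submodule.sum_mem _ fun g _ => ?_
  rw [crossedAlgHom_single]
  intro h
  rw [SkewMonoidAlgebra.coeff_single_apply]
  split_ifs
  · exact F.mem _ (hx g)
  · exact Q.I.zero_mem

/-- The morphism of crossed products induced by an equivariant homomorphism. -/
def crossedMap {P : GAlg.{u} Γ} {Q : GAlg.{w} Γ} (F : Hom P Q) :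
    AdicAlg.Hom P.crossed Q.crossed := ⟨crossedAlgHom F, crossedAlgHom_mem F, fun _ => rfl⟩

/-! The component of a conjugacy class. -/

/-- `x` is the class of `a g` in `(A ⋊ Γ) / (I ⋊ Γ)^j`, for some `a` in `A`. -/
def Homog (P : GAlg.{u} Γ) (j : ℕ) (g : Γ) (x : P.crossed.R ⧸ P.crossed.I ^ j) : Prop :=
  ∃ a : P.A, x = Ideal.Quotient.mk (P.crossed.I ^ j) (SkewMonoidAlgebra.single g a)

theorem Homog.mul {P : GAlg.{u} Γ} {j : ℕ} {g h : Γ} {x y : P.crossed.R ⧸ P.crossed.I ^ j}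
    (hx : P.Homog j g x) (hy : P.Homog j h y) : P.Homog j (g * h) (x * y) := by
  obtain ⟨a, rfl⟩ := hx
  obtain ⟨b, rfl⟩ := hy
  exact ⟨a * g • b, congrArg (Ideal.Quotient.mk (P.crossed.I ^ j))
    (SkewMonoidAlgebra.single_mul_single (a₁ := g) (a₂ := h) (b₁ := a) (b₂ := b))⟩

theorem Homog.one {P : GAlg.{u} Γ} {j : ℕ} : P.Homog j 1 1 := ⟨1, (map_one _).symm⟩

theorem prod_face {n : ℕ} (i : Fin (n + 2)) (hi : (i : ℕ) ≠ n + 1) (g : Fin (n + 2) → Γ) :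
    (List.ofFn (face id i g)).prod = (List.ofFn g).prod := by
  induction n with
  | zero =>
    obtain rfl : i = 0 := Fin.ext (by simp; omega)
    simp [face, List.ofFn_succ]
  | succ n ih =>
    rw [List.ofFn_succ, List.ofFn_succ (f := g), List.prod_cons, List.prod_cons]
    by_cases h0 : i = 0
    · subst h0
      rw [List.ofFn_succ (f := fun i => g i.succ), List.prod_cons, ← mul_assoc]
      congr 1
    · obtain ⟨i, rfl⟩ := Fin.exists_succ_eq.2 h0
      have hi' : (i : ℕ) ≠ n + 1 := fun h => hi (by simp [h])
      rw [← ih i hi' fun l => g l.succ]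
      congr 2
      · simp [face, hi']
      · congr 1
        funext j
        simp [face, hi']

theorem prod_face_isConj {n : ℕ} (i : Fin (n + 2)) (g : Fin (n + 2) → Γ) :
    IsConj (List.ofFn g).prod (List.ofFn (face id i g)).prod := by
  by_cases hi : (i : ℕ) = n + 1
  · rw [List.ofFn_succ', List.concat_eq_append, List.prod_append, List.prod_singleton,
      List.ofFn_succ, List.ofFn_succ (f := face id i g), List.prod_cons, List.prod_cons]
    refine isConj_iff.2 ⟨g (Fin.last (n + 1)), ?_⟩
    simp [face, hi, mul_assoc]
  · rw [prod_face i hi]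

theorem prod_rot_isConj {n : ℕ} (k : Fin (n + 1)) (g : Fin (n + 1) → Γ) :
    IsConj (List.ofFn g).prod (List.ofFn (rot id k g)).prod := by
  have step : ∀ f : Fin (n + 1) → Γ,
      IsConj (List.ofFn f).prod (List.ofFn fun p => f (p - 1)).prod := by
    intro f
    rw [List.ofFn_succ', List.concat_eq_append, List.prod_append, List.prod_singleton,
      List.ofFn_succ, List.prod_cons]
    refine isConj_iff.2 ⟨f (Fin.last n), ?_⟩
    have h1 : (0 : Fin (n + 1)) - 1 = Fin.last n := by
      rw [sub_eq_iff_eq_add]; simp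
    have h2 : ∀ p : Fin n, p.succ - 1 = p.castSucc := fun p => by
      rw [sub_eq_iff_eq_add]; simp
    simp [h1, h2, mul_assoc]
  have key : ∀ m : ℕ, IsConj (List.ofFn g).prod
      (List.ofFn fun p : Fin (n + 1) => g (p - Fin.ofNat (n + 1) m)).prod := by
    intro m
    induction m with
    | zero =>
      have : Fin.ofNat (n + 1) 0 = 0 := rfl
      simp only [this, sub_zero]
      exact IsConj.refl _
    | succ m ih =>
      refine ih.trans ?_
      have e : ∀ p : Fin (n + 1), p - Fin.ofNat (n + 1) (m + 1) = p - 1 - Fin.ofNat (n + 1) m := by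
        intro p
        rw [sub_sub]
        congr 1
        ext
        simp [Fin.val_add, add_comm]
      simp only [e]
      exact step (fun p => g (p - Fin.ofNat (n + 1) m))
  have := key k
  rw [show Fin.ofNat (n + 1) (k : ℕ) = k from Fin.ext (Nat.mod_eq_of_lt k.2)] at this
  rw [List.ofFn_succ, List.prod_cons]
  simpa [rot] using this

theorem Homog.face {P : GAlg.{u} Γ} {j n : ℕ} {g : Fin (n + 2) → Γ}
    {x : Fin (n + 2) → P.crossed.R ⧸ P.crossed.I ^ j} (h : ∀ i, P.Homog j (g i) (x i))
    (i : Fin (n + 2)) (l : Fin (n + 1)) :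
    P.Homog j (CrossedHomology.face id i g l) (CrossedHomology.face id i x l) := by
  unfold CrossedHomology.face
  split_ifs <;> first | exact h _ | exact (h _).mul (h _)

theorem Homog.rot {P : GAlg.{u} Γ} {j n : ℕ} {g : Fin (n + 1) → Γ}
    {x : Fin (n + 1) → P.crossed.R ⧸ P.crossed.I ^ j} (h : ∀ i, P.Homog j (g i) (x i))
    (k : Fin (n + 1)) (l : Fin (n + 2)) :
    P.Homog j (CrossedHomology.rot id k g l) (CrossedHomology.rot id k x l) := by
  unfold CrossedHomology.rot
  refine Fin.cases ?_ (fun p => ?_) l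
  · simpa using Homog.one
  · simpa using h _

/-- The span, in the normalized Hochschild chains of `(A ⋊ Γ) / (I ⋊ Γ)^j`, of the tensors
`a_0 g_0 ⊗ … ⊗ a_q g_q` for which `g_0 ⋯ g_q` is conjugate to `γ`. -/
def levelComponent (P : GAlg.{u} Γ) (γ : Γ) (j q : ℕ) :
    Submodule ℂ (Chains (P.crossed.R ⧸ P.crossed.I ^ j) q) :=
  Submodule.span ℂ {c | ∃ (g : Fin (q + 1) → Γ) (x : Fin (q + 1) → P.crossed.R ⧸ P.crossed.I ^ j),
    (∀ i, P.Homog j (g i) (x i)) ∧ IsConj γ (List.ofFn g).prod ∧ c = chain x}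

theorem twist_level (P : GAlg.{u} Γ) (j : ℕ) :
    (P.crossed.twist.level j : P.crossed.R ⧸ P.crossed.I ^ j → _) = id := by
  funext x
  obtain ⟨y, rfl⟩ := Ideal.Quotient.mk_surjective x
  rfl

theorem levelComponent_b (P : GAlg.{u} Γ) (γ : Γ) (j q : ℕ) :
    P.levelComponent γ j (q + 1) ≤
      (P.levelComponent γ j q).comap (chainsb (P.crossed.twist.level j) q) := by
  refine Submodule.span_le.2 ?_
  rintro _ ⟨g, x, hx, hg, rfl⟩
  change chainsb (P.crossed.twist.level j) q (chain x) ∈ P.levelComponent γ j q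
  rw [chainsb_chain]
  refine Submodule.sum_mem _ fun i _ => Submodule.smul_mem _ _ (Submodule.subset_span ?_)
  refine ⟨face id i g, _, ?_, hg.trans (prod_face_isConj i g), rfl⟩
  rw [twist_level]
  exact Homog.face hx i

theorem levelComponent_B (P : GAlg.{u} Γ) (γ : Γ) (j q : ℕ) :
    P.levelComponent γ j q ≤
      (P.levelComponent γ j (q + 1)).comap (chainsB (P.crossed.twist.level j) q) := by
  refine Submodule.span_le.2 ?_
  rintro _ ⟨g, x, hx, hg, rfl⟩
  change chainsB (P.crossed.twist.level j) q (chain x) ∈ P.levelComponent γ j (q + 1)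
  rw [chainsB_chain]
  refine Submodule.sum_mem _ fun i _ => Submodule.smul_mem _ _ (Submodule.subset_span ?_)
  refine ⟨rot id i g, _, ?_, hg.trans (prod_rot_isConj i g), rfl⟩
  rw [twist_level]
  exact Homog.rot hx i

/-- The component of the conjugacy class of `γ` in the topological Hochschild complex of
`Â ⋊ Γ`, with the operators `b` and `B`: it consists of the elements all of whose images in the
complexes of `(A ⋊ Γ) / (I ⋊ Γ)^j` lie in the span of the tensors `a_0 g_0 ⊗ … ⊗ a_q g_q` with
`g_0 ⋯ g_q` conjugate to `γ`. -/
def component (P : GAlg.{u} Γ) (γ : Γ) : Mixed.{max u v} :=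
  P.crossed.topHochschild.sub
    (fun q => (Submodule.pi Set.univ fun j => P.levelComponent γ j q).submoduleOf _)
    (fun q _ hx j _ => P.levelComponent_b γ j q (hx j trivial))
    (fun q _ hx j _ => P.levelComponent_B γ j q (hx j trivial))

/-- The morphism of components induced by an equivariant homomorphism. -/
def componentMap {P : GAlg.{u} Γ} {Q : GAlg.{w} Γ} (F : Hom P Q) (γ : Γ) :
    Mixed.Hom (P.component γ) (Q.component γ) :=
  Mixed.subMap (AdicAlg.topMap (crossedMap F)) (by
    intro q x hx j _
    have key : P.levelComponent γ j q ≤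
        (Q.levelComponent γ j q).comap (chainsMap ((crossedMap F).level j) q) := by
      refine Submodule.span_le.2 ?_
      rintro _ ⟨g, y, hy, hg, rfl⟩
      change chainsMap ((crossedMap F).level j) q (chain y) ∈ Q.levelComponent γ j q
      rw [chainsMap_chain]
      refine Submodule.subset_span ⟨g, _, fun i => ?_, hg, rfl⟩
      obtain ⟨a, ha⟩ := hy i
      refine ⟨F.f a, ?_⟩
      rw [ha]
      exact congrArg (Ideal.Quotient.mk (Q.crossed.I ^ j)) (crossedAlgHom_single F (g i) a)
    exact key (hx j trivial))

/-! The homology groups of the completed algebras. -/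

/-- The classes that are fixed by the action of the centralizer of `γ` on the topological
`γ`-twisted Hochschild homology of the completion of `A`. -/
def invHH (P : GAlg.{u} Γ) (γ : Γ) (q : ℕ) : Submodule ℂ ((P.twisted γ).topHochschild.HH q) :=
  ⨅ h : Subgroup.centralizer {γ},
    LinearMap.eqLocus ((AdicAlg.topMap (P.centralizerMap γ h)).mapHH q) LinearMap.id

/-- The invariants of the centralizer of `γ` in the topological `γ`-twisted cyclic homology. -/
def invHC (P : GAlg.{u} Γ) (γ : Γ) (q : ℕ) : Submodule ℂ ((P.twisted γ).topCyclic.HC q) :=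
  ⨅ h : Subgroup.centralizer {γ},
    LinearMap.eqLocus ((AdicAlg.topCyclicMap (P.centralizerMap γ h)).mapHC q) LinearMap.id

/-- The invariants of the centralizer of `γ` in the topological `γ`-twisted periodic cyclic
homology. -/
def invHP (P : GAlg.{u} Γ) (γ : Γ) (q : ZMod 2) : Submodule ℂ ((P.twisted γ).topCyclic.HP q) :=
  ⨅ h : Subgroup.centralizer {γ},
    LinearMap.eqLocus ((AdicAlg.topCyclicMap (P.centralizerMap γ h)).mapHP q) LinearMap.id

end GAlg

end CrossedHomology

end

universe u v

noncomputable section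

namespace CrossedHomology

universe w

namespace Mixed

/-! ### Comparison of subquotients -/

section Subquotients

variable {V : Type u} [AddCommGroup V] [Module ℂ V] {W : Type v} [AddCommGroup W] [Module ℂ W]
  {Z D : Submodule ℂ V} {Z' D' : Submodule ℂ W}

/-! The quotient `(A ⋊ Γ) / J^j` is the crossed product of `A / I^j` by `Γ` (`levelData`), because
the coefficients of an element of `J^j` lie in `I^j`. Part (1) follows coefficient by coefficient,
`Γ` being finite. For part (2) everything is constructed for one abstract crossed product `R` of `D`
by `Γ` (`CrossedData`), by finite sums that are natural in the crossed product. The constructions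
therefore commute with the projections between the levels and with the maps induced by `f`, and
identities between them pass to the inverse limit at once. No exactness of limits is needed.

The regular representation embeds `R` in the matrices over `D` indexed by `Γ`, with entries `mat k l
x = k(coeff_{k⁻¹l} x)`. The map `toTwisted` is the corresponding generalized trace, twisted by `γ`:
it sums products of entries along closed cycles `k_0 → γ k_1`, `k_1 → k_2`, …, `k_n → k_0`. It
commutes with `b` (matrix multiplication) and, on normalized chains, with `B` (cyclic rotation). Its
image is fixed by the centralizer of `γ`, since the centralizer permutes the cycles.

In the other direction, `ofTwisted` puts `γ` behind `a_0`; it commutes with `b`. The composite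
`toTwisted ∘ ofTwisted` is the sum of the operators `h` of the centralizer (`toTwisted_ofTwisted`).
The composite in the other order is homotopic, on the component of `γ`, to multiplication by the
order `c` of the centralizer: the prism operators deform a cycle of matrix entries, conjugated back
by the `k_m`, into the section (`chainsb_homotopy`), and exactly `c` cycles contribute to a monomial
tensor whose group product is conjugate to `γ` (`sum_cycleN_matN`).

These data form a `Transfer`. Dividing by `c`, `toTwisted` becomes a split surjection from the
component onto the chains fixed by the centralizer, and its kernel is contractible for `b`. This
gives the statement for `HH`. Since the component is a mixed complex and the surjection commutes
with `B`, solving `(b + B) w = x` degree by degree in the kernel (`fill`) gives isomorphisms on `HC`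
and `HP` too. Averaging (`subquotMap_invariants`) identifies the homology of the fixed chains with
the invariant classes. For `HC` and `HP` the fixed chains are compared with the quotient by the
image of `γ - 1`; the norm factors through this quotient because its image is fixed by `γ`
(`norm_G`). -/

theorem subquotMap_mk (f : V →ₗ[ℂ] W) (hZ : ∀ x ∈ Z, f x ∈ Z') (hD : ∀ x ∈ D, f x ∈ D') (x : Z) :
    subquotMap f hZ hD (Submodule.Quotient.mk x) = Submodule.Quotient.mk ⟨f x, hZ x x.2⟩ := rfl

theorem subquotMap_injective (f : V →ₗ[ℂ] W) (hZ : ∀ x ∈ Z, f x ∈ Z') (hD : ∀ x ∈ D, f x ∈ D')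
    (h : ∀ x ∈ Z, f x ∈ D' → x ∈ D) : Function.Injective (subquotMap f hZ hD) := by
  rw [injective_iff_map_eq_zero]
  intro x hx
  obtain ⟨x, rfl⟩ := Submodule.Quotient.mk_surjective _ x
  rw [subquotMap_mk, Submodule.Quotient.mk_eq_zero] at hx
  exact (Submodule.Quotient.mk_eq_zero _).2 (h x x.2 hx)

theorem subquotMap_surjective (f : V →ₗ[ℂ] W) (hZ : ∀ x ∈ Z, f x ∈ Z') (hD : ∀ x ∈ D, f x ∈ D')
    (h : ∀ z ∈ Z', ∃ x ∈ Z, f x - z ∈ D') : Function.Surjective (subquotMap f hZ hD) := by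
  intro z
  obtain ⟨z, rfl⟩ := Submodule.Quotient.mk_surjective _ z
  obtain ⟨x, hx, hxz⟩ := h z z.2
  exact ⟨Submodule.Quotient.mk ⟨x, hx⟩, (Submodule.Quotient.eq _).2 hxz⟩

/-- If `i r` is the sum of a family of `c` operators that fix the image of `i`, and `r i = c`,
then `i` identifies the subquotient of `W` with the common fixed points in that of `V`. -/
theorem subquotMap_invariants {ι : Type w} [Fintype ι] [Nonempty ι] (i : W →ₗ[ℂ] V) (r : V →ₗ[ℂ] W)
    (t : ι → V →ₗ[ℂ] V)
    (hiZ : ∀ x ∈ Z', i x ∈ Z) (hiD : ∀ x ∈ D', i x ∈ D)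
    (hrZ : ∀ x ∈ Z, r x ∈ Z') (hrD : ∀ x ∈ D, r x ∈ D')
    (htZ : ∀ h, ∀ x ∈ Z, t h x ∈ Z) (htD : ∀ h, ∀ x ∈ D, t h x ∈ D)
    (hri : ∀ x, r (i x) = (Fintype.card ι : ℂ) • x) (hti : ∀ h x, t h (i x) = i x)
    (hir : ∀ x, i (r x) = ∑ h, t h x) :
    Function.Injective (subquotMap i hiZ hiD) ∧
      LinearMap.range (subquotMap i hiZ hiD) =
        ⨅ h, LinearMap.eqLocus (subquotMap (t h) (htZ h) (htD h)) LinearMap.id := by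
  have hc : (Fintype.card ι : ℂ) ≠ 0 := Nat.cast_ne_zero.2 Fintype.card_ne_zero
  refine ⟨subquotMap_injective _ _ _ fun x hx hxD => ?_, le_antisymm ?_ ?_⟩
  · have := D'.smul_mem (Fintype.card ι : ℂ)⁻¹ (hrD _ hxD)
    rwa [hri, smul_smul, inv_mul_cancel₀ hc, one_smul] at this
  · rintro _ ⟨x, rfl⟩
    obtain ⟨x, rfl⟩ := Submodule.Quotient.mk_surjective _ x
    refine (Submodule.mem_iInf _).2 fun h => ?_
    rw [LinearMap.mem_eqLocus]
    simp only [subquotMap_mk, hti, LinearMap.id_apply]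
  · intro z hz
    have hz' : ∀ h, subquotMap (t h) (htZ h) (htD h) z = z := fun h =>
      (Submodule.mem_iInf _).1 hz h
    -- Averaging: on an invariant class `i r` is the sum of the `t h`, each of which fixes the
    -- class, so the class comes from `r z` divided by the number of operators.
    have key : subquotMap i hiZ hiD (subquotMap r hrZ hrD z) = (Fintype.card ι : ℂ) • z := by
      have e : ∑ h, subquotMap (t h) (htZ h) (htD h) z = (Fintype.card ι : ℂ) • z := by
        simp [hz', Finset.card_univ, Nat.cast_smul_eq_nsmul]
      rw [← e]
      obtain ⟨z, rfl⟩ := Submodule.Quotient.mk_surjective _ z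
      simp only [subquotMap_mk]
      simp only [← Submodule.mkQ_apply]
      rw [← map_sum]
      congr 1
      ext
      simp [hir]
    refine ⟨(Fintype.card ι : ℂ)⁻¹ • subquotMap r hrZ hrD z, ?_⟩
    rw [map_smul, key, smul_smul, inv_mul_cancel₀ hc, one_smul]

end Subquotients

/-! ### Mixed complexes -/

/-- The relations `b² = 0`, `B² = 0` and `bB + Bb = 0`. -/
structure IsMixed (M : Mixed.{u}) : Prop where
  b_b : ∀ n x, M.b n (M.b (n + 1) x) = 0
  B_B : ∀ n x, M.B (n + 1) (M.B n x) = 0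
  b_B_zero : ∀ x, M.b 0 (M.B 0 x) = 0
  b_B : ∀ n x, M.b (n + 1) (M.B (n + 1) x) + M.B n (M.b n x) = 0

theorem tot_zero (M : Mixed.{u}) (x : ∀ m, M.X m) : M.tot x 0 = M.b 0 (x 1) := rfl

theorem tot_succ (M : Mixed.{u}) (x : ∀ m, M.X m) (m : ℕ) :
    M.tot x (m + 1) = M.b (m + 1) (x (m + 2)) + M.B m (x m) := rfl

theorem trunc_apply (M : Mixed.{u}) (n : ℕ) (x : ∀ m, M.X m) (m : ℕ) :
    M.trunc n x m = if m < n then x m else 0 := by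
  by_cases h : m < n <;> simp [trunc, h]

theorem cyclicD_apply (M : Mixed.{u}) (n : ℕ) (x : ∀ m, M.X m) (m : ℕ) :
    M.cyclicD n x m = if m < n then M.tot x m else 0 := trunc_apply M n _ m

/-- The component of `b + B` in degree `n` sees only the degrees `n + 1` and `n - 1`; hence
truncation above is harmless in low degrees. -/
theorem tot_congr (M : Mixed.{u}) {x y : ∀ m, M.X m} {n : ℕ} (h : ∀ m ≤ n + 1, x m = y m) :
    M.tot x n = M.tot y n := by
  cases n with
  | zero => rw [tot_zero, tot_zero, h 1 le_rfl]
  | succ n => rw [tot_succ, tot_succ, h (n + 2) le_rfl, h n (by omega)]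

theorem IsMixed.tot_tot {M : Mixed.{u}} (hM : M.IsMixed) (x : ∀ m, M.X m) :
    M.tot (M.tot x) = 0 := by
  funext m
  match m with
  | 0 =>
    rw [tot_zero, tot_succ, map_add, hM.b_b, hM.b_B_zero, add_zero]
    rfl
  | 1 =>
    rw [tot_succ, tot_succ, tot_zero, map_add, hM.b_b, add_assoc]
    exact (zero_add _).trans (hM.b_B 0 _)
  | m + 2 =>
    rw [tot_succ, tot_succ, tot_succ, map_add, map_add, hM.b_b, hM.B_B, zero_add, add_zero, hM.b_B]
    rfl

/-- In a degree below `n` the outer differential uses only degrees at most `n`, all of which survive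
the inner truncation, so the relation reduces to `(b + B)² = 0`. -/
theorem IsMixed.cyclicD_cyclicD {M : Mixed.{u}} (hM : M.IsMixed) (n : ℕ) (x : ∀ m, M.X m) :
    M.cyclicD n (M.cyclicD (n + 1) x) = 0 := by
  funext m
  rw [cyclicD_apply]
  split_ifs with h
  · refine (M.tot_congr fun l hl => ?_).trans (congrFun (hM.tot_tot x) m)
    rw [cyclicD_apply, if_pos (by omega)]
  · rfl

theorem cyclicD_mem (M : Mixed.{u}) {n : ℕ} {x : ∀ m, M.X m} (hx : x ∈ M.cyclicChains (n + 1)) :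
    M.cyclicD (n + 1) x ∈ M.cyclicChains n := by
  intro m hm
  rw [cyclicD_apply]
  split_ifs with h
  · have h' : m % 2 ≠ n % 2 := fun e => hm ⟨by omega, e⟩
    cases m with
    | zero => rw [tot_zero, hx 1 (fun h => by omega), map_zero]
    | succ m =>
      rw [tot_succ, hx (m + 2) (fun h => by omega), hx m (fun h => by omega), map_zero, map_zero,
        add_zero]
  · rfl

theorem tot_mem (M : Mixed.{u}) {i : ZMod 2} {x : ∀ m, M.X m} (hx : x ∈ M.periodicChains (i + 1)) :
    M.tot x ∈ M.periodicChains i := by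
  have h2 : (1 : ZMod 2) + 1 = 0 := rfl
  intro m hm
  have h1 : x (m + 1) = 0 := hx _ fun h => hm (by
    push_cast at h
    exact add_right_cancel h)
  cases m with
  | zero => rw [tot_zero, h1, map_zero]
  | succ m =>
    rw [tot_succ, h1, hx m, map_zero, map_zero, add_zero]
    intro h
    refine hm ?_
    push_cast
    rw [h, add_assoc, h2, add_zero]

/-! ### Split surjections with `b`-contractible kernel induce isomorphisms on `HC` and `HP` -/

section QuasiIso

variable {M : Mixed.{u}} {N : Mixed.{v}}

/-- The recursive solution `w` of `b w_{m+1} = x_m - B w_{m-1}`, with a given contraction `h`. -/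
def fill (M : Mixed.{u}) (h : ∀ m, M.X m →ₗ[ℂ] M.X (m + 1)) (x : ∀ m, M.X m) : ∀ m, M.X m
  | 0 => 0
  | 1 => h 0 (x 0)
  | m + 2 => h (m + 1) (x (m + 1) - M.B m (fill M h x m))

/-- `h` contracts the kernel of `T`, as a complex with differential `b`. -/
structure Contracts (T : Hom M N) (h : ∀ m, M.X m →ₗ[ℂ] M.X (m + 1)) : Prop where
  mem : ∀ m z, T.f m z = 0 → T.f (m + 1) (h m z) = 0
  b_h : ∀ m, ∀ z ∈ M.hhCycles m, T.f m z = 0 → M.b m (h m z) = z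

variable {T : Hom M N} {h : ∀ m, M.X m →ₗ[ℂ] M.X (m + 1)}

theorem Contracts.fill_mem (hh : Contracts T h) {x : ∀ m, M.X m} (hx : ∀ m, T.f m (x m) = 0)
    (m : ℕ) : T.f m (M.fill h x m) = 0 := by
  induction m using Nat.twoStepInduction with
  | zero => exact map_zero _
  | one => exact hh.mem 0 _ (hx 0)
  | more m ih _ =>
    refine hh.mem (m + 1) _ ?_
    rw [map_sub, hx, T.comm_B, ih, map_zero, sub_zero]

/-- The recursion can be continued because `x_{m+1} - B w_m` is a `b`-cycle: `-bB w_m = B b w_m`,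
and by induction `b w_m` is `x_{m-1}` up to a multiple of `B`, which `B² = 0` kills, so what is left
is the component of `(b + B) x` in degree `m`. Only components below `n` are assumed to vanish, so
that the result also serves the truncated cyclic complex. -/
theorem Contracts.tot_fill (hM : M.IsMixed) (hh : Contracts T h) {x : ∀ m, M.X m}
    (hx : ∀ m, T.f m (x m) = 0) (n : ℕ) (hn : ∀ m < n, M.tot x m = 0) (m : ℕ) (hm : m ≤ n) :
    M.tot (M.fill h x) m = x m := by
  induction m using Nat.strong_induction_on with
  | _ m ih =>
  cases m with
  | zero => exact hh.b_h 0 _ trivial (hx 0)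
  | succ m =>
    have hcyc : M.b m (x (m + 1) - M.B m (M.fill h x m)) = 0 := by
      cases m with
      | zero =>
        change M.b 0 (x 1 - M.B 0 0) = 0
        rw [map_zero, sub_zero, ← tot_zero, hn 0 hm]
      | succ m =>
        have ih := ih m (by omega) (by omega)
        have hB : M.B m (M.b m (M.fill h x (m + 1))) = M.B m (x m) := by
          rw [← ih]
          cases m with
          | zero => rfl
          | succ m => rw [tot_succ, map_add, hM.B_B, add_zero]
        rw [map_sub, eq_neg_of_add_eq_zero_left (hM.b_B m (M.fill h x (m + 1))), sub_neg_eq_add, hB,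
          ← tot_succ, hn _ hm]
    have := hh.b_h (m + 1) _ hcyc (by rw [map_sub, hx, T.comm_B, hh.fill_mem hx, map_zero, sub_zero])
    rw [tot_succ]
    change M.b (m + 1) (h (m + 1) _) + _ = _
    rw [this, sub_add_cancel]

/-- The recursion for `w` steps by two degrees, so `w` lives in the parity opposite to that of `x`.
The predicate `p` covers both ways in which parity is expressed, by remainders and in `ZMod 2`. -/
theorem fill_eq_zero {p : ℕ → Prop} (hp : ∀ m, p (m + 2) ↔ p m) {x : ∀ m, M.X m}
    (hx : ∀ m, ¬ p m → x m = 0) (m : ℕ) (hm : ¬ p (m + 1)) : M.fill h x m = 0 := by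
  induction m using Nat.twoStepInduction with
  | zero => rfl
  | one =>
    change h 0 (x 0) = 0
    rw [hx 0 (by rwa [hp] at hm), map_zero]
  | more m ih _ =>
    have hm' : ¬ p (m + 1) := by rwa [hp] at hm
    change h (m + 1) (x (m + 1) - M.B m (M.fill h x m)) = 0
    rw [hx _ hm', ih hm', map_zero, sub_zero, map_zero]

/-- This is the acyclicity of the kernel of `T` in the cyclic complex, with the primitive again in
the kernel. -/
theorem Contracts.exists_cyclicD_eq (hM : M.IsMixed) (hh : Contracts T h) {n : ℕ} {x : ∀ m, M.X m}
    (hxn : x ∈ M.cyclicChains n) (hxD : M.cyclicD n x = 0) (hxT : T.prod x = 0) :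
    ∃ w ∈ M.cyclicChains (n + 1), M.cyclicD (n + 1) w = x ∧ T.prod w = 0 := by
  have hx : ∀ m, T.f m (x m) = 0 := fun m => congrFun hxT m
  -- The bound `n + 2` keeps the degrees up to `n + 1`, which are those of a cyclic chain of degree
  -- `n + 1` and all that its differential needs in degrees up to `n`.
  refine ⟨M.trunc (n + 2) (M.fill h x), fun m hm => ?_, funext fun m => ?_, funext fun m => ?_⟩
  · rw [trunc_apply]
    split_ifs with h1
    · refine fill_eq_zero (p := fun l => l % 2 = n % 2) (fun l => by simp)
        (fun l hl => hxn l fun h => hl h.2) m fun h2 => hm ⟨by omega, by omega⟩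
    · rfl
  · rw [cyclicD_apply]
    split_ifs with h1
    · rw [M.tot_congr (y := M.fill h x) fun l hl => by rw [trunc_apply, if_pos (by omega)]]
      refine hh.tot_fill hM hx n (fun l hl => ?_) m (by omega)
      have := congrFun hxD l
      rwa [cyclicD_apply, if_pos hl] at this
    · exact (hxn m fun h2 => h1 (by omega)).symm
  · rw [Hom.prod_apply, trunc_apply]
    split_ifs
    · exact hh.fill_mem hx m
    · exact map_zero _

theorem Contracts.exists_tot_eq (hM : M.IsMixed) (hh : Contracts T h) {i : ZMod 2}
    {x : ∀ m, M.X m} (hxi : x ∈ M.periodicChains i) (hxD : M.tot x = 0) (hxT : T.prod x = 0) :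
    ∃ w ∈ M.periodicChains (i + 1), M.tot w = x ∧ T.prod w = 0 := by
  have hx : ∀ m, T.f m (x m) = 0 := fun m => congrFun hxT m
  have h2 : (2 : ZMod 2) = 0 := rfl
  refine ⟨M.fill h x, fun m hm => ?_, funext fun m => ?_, funext fun m => hh.fill_mem hx m⟩
  · refine fill_eq_zero (p := fun l => (l : ZMod 2) = i) (fun l => by simp [h2]) hxi m fun h => ?_
    refine hm ?_
    rw [← h, Nat.cast_add, Nat.cast_one, add_assoc, one_add_one_eq_two, h2, add_zero]
  · exact hh.tot_fill hM hx m (fun l _ => congrFun hxD l) m le_rfl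

theorem cyclicChains_lift (s : ∀ n, N.X n →ₗ[ℂ] M.X n) (hs : ∀ n x, T.f n (s n x) = x) {n : ℕ}
    {y : ∀ m, N.X m} (hy : y ∈ N.cyclicChains n) : ∃ x ∈ M.cyclicChains n, T.prod x = y :=
  ⟨fun m => s m (y m), fun m hm => (congrArg (s m) (hy m hm)).trans (map_zero _), funext fun m => hs m _⟩

theorem periodicChains_lift (s : ∀ n, N.X n →ₗ[ℂ] M.X n) (hs : ∀ n x, T.f n (s n x) = x)
    {i : ZMod 2} {y : ∀ m, N.X m} (hy : y ∈ N.periodicChains i) :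
    ∃ x ∈ M.periodicChains i, T.prod x = y :=
  ⟨fun m => s m (y m), fun m hm => (congrArg (s m) (hy m hm)).trans (map_zero _), funext fun m => hs m _⟩

/-- A surjection of complexes with acyclic kernel is bijective on homology: boundaries and cycles
are lifted through the section and corrected by chains in the kernel. Only the source has to be a
mixed complex. -/
theorem Contracts.mapHC_bijective (hM : M.IsMixed) (hh : Contracts T h)
    (s : ∀ n, N.X n →ₗ[ℂ] M.X n) (hs : ∀ n x, T.f n (s n x) = x) (n : ℕ) :
    Function.Bijective (T.mapHC n) := by
  constructor
  · refine subquotMap_injective _ _ _ ?_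
    rintro x ⟨hx, hx'⟩ ⟨y', hy', e⟩
    obtain ⟨y, hy, rfl⟩ := cyclicChains_lift s hs hy'
    obtain ⟨w, hw, hwx, -⟩ := hh.exists_cyclicD_eq hM (x := x - M.cyclicD (n + 1) y)
      (Submodule.sub_mem _ hx (M.cyclicD_mem hy))
      (by rw [map_sub, hM.cyclicD_cyclicD, sub_zero]; exact hx')
      (by rw [map_sub, T.prod_cyclicD, e, sub_self])
    exact ⟨w + y, Submodule.add_mem _ hw hy, by rw [map_add, hwx, sub_add_cancel]⟩
  · refine subquotMap_surjective _ _ _ ?_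
    rintro z' ⟨hz', hz''⟩
    obtain ⟨z, hz, rfl⟩ := cyclicChains_lift s hs hz'
    cases n with
    -- In degree `0` every chain is a cycle, and the lift needs no correction.
    | zero =>
      refine ⟨z, ⟨hz, ?_⟩, by simp⟩
      change M.cyclicD 0 z = 0
      funext m
      rw [cyclicD_apply]
      rfl
    | succ n =>
      obtain ⟨w, hw, hwz, hwT⟩ := hh.exists_cyclicD_eq hM (x := M.cyclicD (n + 1) z)
        (M.cyclicD_mem hz) (hM.cyclicD_cyclicD n z) (by rw [T.prod_cyclicD]; exact hz'')
      refine ⟨z - w, ⟨Submodule.sub_mem _ hz hw, ?_⟩, ?_⟩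
      · change M.cyclicD (n + 1) (z - w) = 0
        rw [map_sub, hwz, sub_self]
      · rw [map_sub, hwT, sub_zero, sub_self]
        exact Submodule.zero_mem _

theorem Contracts.mapHP_bijective (hM : M.IsMixed) (hh : Contracts T h)
    (s : ∀ n, N.X n →ₗ[ℂ] M.X n) (hs : ∀ n x, T.f n (s n x) = x) (i : ZMod 2) :
    Function.Bijective (T.mapHP i) := by
  have hi : i + 1 + 1 = i := by rw [add_assoc, show (1 : ZMod 2) + 1 = 0 from rfl, add_zero]
  constructor
  · refine subquotMap_injective _ _ _ ?_
    rintro x ⟨hx, hx'⟩ ⟨y', hy', e⟩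
    obtain ⟨y, hy, rfl⟩ := periodicChains_lift s hs hy'
    obtain ⟨w, hw, hwx, -⟩ := hh.exists_tot_eq hM (x := x - M.tot y)
      (Submodule.sub_mem _ hx (M.tot_mem hy))
      (by rw [map_sub, hM.tot_tot, sub_zero]; exact hx')
      (by rw [map_sub, T.prod_tot, e, sub_self])
    exact ⟨w + y, Submodule.add_mem _ hw hy, by rw [map_add, hwx, sub_add_cancel]⟩
  · refine subquotMap_surjective _ _ _ ?_
    rintro z' ⟨hz', hz''⟩
    obtain ⟨z, hz, rfl⟩ := periodicChains_lift s hs hz'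
    obtain ⟨w, hw, hwz, hwT⟩ := hh.exists_tot_eq hM (x := M.tot z)
      (M.tot_mem (i := i + 1) (by rwa [hi])) (hM.tot_tot z) (by rw [T.prod_tot]; exact hz'')
    rw [hi] at hw
    refine ⟨z - w, ⟨Submodule.sub_mem _ hz hw, ?_⟩, ?_⟩
    · change M.tot (z - w) = 0
      rw [map_sub, hwz, sub_self]
    · rw [map_sub, hwT, sub_zero, sub_self]
      exact Submodule.zero_mem _

end QuasiIso

/-! ### Transfer to invariants -/

/-- A morphism `T : M → E` with a `b`-linear map `S` in the other direction, such that `T S` is the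
sum of finitely many operators `t` which fix the image of `T`, and such that `S T` is homotopic to
multiplication by the number of these operators. -/
structure Transfer (M : Mixed.{u}) (E : Mixed.{v}) (ι : Type w) [Fintype ι] where
  T : Hom M E
  t : ι → Hom E E
  S : ∀ n, E.X n →ₗ[ℂ] M.X n
  H : ∀ n, M.X n →ₗ[ℂ] M.X (n + 1)
  S_b : ∀ n x, S n (E.b n x) = M.b n (S (n + 1) x)
  T_S : ∀ n x, T.f n (S n x) = ∑ h, (t h).f n x
  t_T : ∀ h n x, (t h).f n (T.f n x) = T.f n x
  b_H_zero : ∀ x, M.b 0 (H 0 x) = (Fintype.card ι : ℂ) • x - S 0 (T.f 0 x)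
  b_H : ∀ n x, M.b (n + 1) (H (n + 1) x) + H n (M.b n x) =
    (Fintype.card ι : ℂ) • x - S (n + 1) (T.f (n + 1) x)

namespace Transfer

variable {M : Mixed.{u}} {E : Mixed.{v}} {ι : Type w} [Fintype ι] (D : Transfer M E ι)

/-- The common fixed points of the operators `t`. -/
def inv : Mixed.{v} :=
  E.sub (fun n => ⨅ h, LinearMap.eqLocus ((D.t h).f n) LinearMap.id)
    (fun n x hx => (Submodule.mem_iInf _).2 fun h => by
      rw [LinearMap.mem_eqLocus, (D.t h).comm_b]
      exact congrArg (E.b n) ((Submodule.mem_iInf _).1 hx h))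
    (fun n x hx => (Submodule.mem_iInf _).2 fun h => by
      rw [LinearMap.mem_eqLocus, (D.t h).comm_B]
      exact congrArg (E.B n) ((Submodule.mem_iInf _).1 hx h))

theorem t_inv (h : ι) (n : ℕ) (x : D.inv.X n) : (D.t h).f n x.1 = x.1 :=
  (Submodule.mem_iInf _).1 x.2 h

/-- `T`, as a morphism to the fixed points. -/
def toInv : Hom M D.inv where
  f n := (D.T.f n).codRestrict _ fun x => (Submodule.mem_iInf _).2 fun h => D.t_T h n x
  comm_b n x := Subtype.ext (D.T.comm_b n x)
  comm_B n x := Subtype.ext (D.T.comm_B n x)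

/-- The inclusion of the fixed points. -/
def incl : Hom D.inv E where
  f _ := Submodule.subtype _
  comm_b _ _ := rfl
  comm_B _ _ := rfl

/-- The sum of the operators `t`, as a morphism to the fixed points. -/
def norm : Hom E D.inv where
  f n := LinearMap.codRestrict _ (∑ h, (D.t h).f n) fun x => (Submodule.mem_iInf _).2 fun h => by
    rw [LinearMap.sum_apply, ← D.T_S]
    exact D.t_T h n _
  comm_b n x := Subtype.ext (by
    change (∑ h, (D.t h).f n) (E.b n x) = E.b n ((∑ h, (D.t h).f (n + 1)) x)
    simp only [LinearMap.sum_apply, map_sum, Hom.comm_b])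
  comm_B n x := Subtype.ext (by
    change (∑ h, (D.t h).f (n + 1)) (E.B n x) = E.B n ((∑ h, (D.t h).f n) x)
    simp only [LinearMap.sum_apply, map_sum, Hom.comm_B])

theorem incl_norm (n : ℕ) (x : E.X n) : D.incl.f n (D.norm.f n x) = ∑ h, (D.t h).f n x :=
  LinearMap.sum_apply _ _ _

theorem norm_incl (n : ℕ) (x : D.inv.X n) :
    D.norm.f n (D.incl.f n x) = (Fintype.card ι : ℂ) • x := by
  refine Subtype.ext ((D.incl_norm n _).trans ?_)
  have e : ∀ h, (D.t h).f n (D.incl.f n x) = x.1 := fun h => D.t_inv h n x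
  rw [Finset.sum_congr rfl fun h _ => e h, Finset.sum_const, Finset.card_univ,
    ← Nat.cast_smul_eq_nsmul ℂ]
  rfl

theorem toInv_S (n : ℕ) (x : D.inv.X n) :
    D.toInv.f n (D.S n x.1) = (Fintype.card ι : ℂ) • x := by
  rw [← norm_incl]
  exact Subtype.ext ((D.T_S n x.1).trans (D.incl_norm n _).symm)

theorem card_ne_zero [Nonempty ι] : (Fintype.card ι : ℂ) ≠ 0 := Nat.cast_ne_zero.2 Fintype.card_ne_zero

/-- With `c` the number of operators, `c⁻¹ H` satisfies the equation `b h z = z` on cycles in the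
kernel, but it need not preserve the kernel. Subtracting `c⁻¹ S T` of it makes `T` vanish, as `T S =
c` on fixed points, and costs nothing under `b`, since `b S T H z = S T b H z = c S T z = 0`. -/
theorem contracts [Nonempty ι] : Contracts D.toInv fun n => (Fintype.card ι : ℂ)⁻¹ •
    (D.H n - (Fintype.card ι : ℂ)⁻¹ • (D.S (n + 1) ∘ₗ D.T.f (n + 1) ∘ₗ D.H n)) where
  mem n z _ := by
    have e : ∀ y : M.X (n + 1), D.toInv.f (n + 1) (D.S (n + 1) (D.T.f (n + 1) y)) =
        (Fintype.card ι : ℂ) • D.toInv.f (n + 1) y := fun y => D.toInv_S (n + 1) (D.toInv.f (n + 1) y)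
    simp [e, smul_smul]
  b_h n z hz hT := by
    have hT' : D.T.f n z = 0 := congrArg Subtype.val hT
    have hb : M.b n (D.H n z) = (Fintype.card ι : ℂ) • z := by
      cases n with
      | zero => rw [D.b_H_zero, hT', map_zero, sub_zero]
      | succ n =>
        have hz' : M.b n z = 0 := hz
        have := D.b_H n z
        rwa [hz', map_zero, add_zero, hT', map_zero, sub_zero] at this
    simp [← D.S_b, ← D.T.comm_b, hb, hT', smul_smul]

/-- On a cycle the homotopy reads `c x = S T x + b H x`. If `T x = b y`, this exhibits `c x` as `b
(S y + H x)`; conversely `c⁻¹ S z` is a cycle over a fixed cycle `z`. Nothing about `B` is used. -/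
theorem mapHH_toInv_bijective [Nonempty ι] (q : ℕ) : Function.Bijective (D.toInv.mapHH q) := by
  have hc : (Fintype.card ι : ℂ) ≠ 0 := card_ne_zero
  constructor
  · refine subquotMap_injective _ _ _ ?_
    rintro x hx ⟨y, hy⟩
    have hb : M.b q (D.H q x) = (Fintype.card ι : ℂ) • x - D.S q (D.T.f q x) := by
      cases q with
      | zero => rw [D.b_H_zero]
      | succ q =>
        have hx' : M.b q x = 0 := hx
        have := D.b_H q x
        rwa [hx', map_zero, add_zero] at this
    have hy' : D.T.f q x = E.b q y.1 := congrArg Subtype.val hy.symm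
    rw [hy', D.S_b, eq_sub_iff_add_eq, ← map_add] at hb
    refine ⟨(Fintype.card ι : ℂ)⁻¹ • (D.H q x + D.S (q + 1) y.1), ?_⟩
    rw [map_smul, hb, smul_smul, inv_mul_cancel₀ hc, one_smul]
  · refine subquotMap_surjective _ _ _ fun z hz => ?_
    refine ⟨(Fintype.card ι : ℂ)⁻¹ • D.S q z.1, ?_, ?_⟩
    · cases q with
      | zero => trivial
      | succ q =>
        have hz' : E.b q z.1 = 0 := congrArg Subtype.val hz
        change M.b q _ = 0
        rw [map_smul, ← D.S_b, hz', map_zero, smul_zero]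
    · rw [map_smul, toInv_S, smul_smul, inv_mul_cancel₀ hc, one_smul, sub_self]
      exact Submodule.zero_mem _

theorem toInv_section [Nonempty ι] (n : ℕ) (x : D.inv.X n) :
    D.toInv.f n (((Fintype.card ι : ℂ)⁻¹ • (D.S n ∘ₗ D.incl.f n)) x) = x := by
  have := D.toInv_S n x
  rw [LinearMap.smul_apply, map_smul]
  refine (congrArg _ this).trans ?_
  rw [smul_smul, inv_mul_cancel₀ card_ne_zero, one_smul]

/-- The image of `HH` under `T` is the space of invariants. -/
theorem mapHH_spec [Nonempty ι] (q : ℕ) : Function.Injective (D.T.mapHH q) ∧ LinearMap.range (D.T.mapHH q) =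
    ⨅ h, LinearMap.eqLocus ((D.t h).mapHH q) LinearMap.id := by
  have hbij := D.mapHH_toInv_bijective q
  -- The map factors through the homology of the fixed chains: the first factor is bijective by the
  -- homotopy, and the image of the second is found by averaging.
  have e : D.T.mapHH q = D.incl.mapHH q ∘ₗ D.toInv.mapHH q :=
    LinearMap.ext fun x => by
      obtain ⟨x, rfl⟩ := Submodule.Quotient.mk_surjective _ x
      rfl
  obtain ⟨h1, h2⟩ : Function.Injective (D.incl.mapHH q) ∧ LinearMap.range (D.incl.mapHH q) =
      ⨅ h, LinearMap.eqLocus ((D.t h).mapHH q) LinearMap.id :=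
    subquotMap_invariants (D.incl.f q) (D.norm.f q) (fun h => (D.t h).f q) _ _
      (by
        cases q with
        | zero => intro x _; trivial
        | succ q =>
          intro x hx
          have hx' : E.b q x = 0 := hx
          change D.inv.b q (D.norm.f (q + 1) x) = 0
          rw [← D.norm.comm_b, hx', map_zero])
      (by rintro _ ⟨y, rfl⟩; exact ⟨D.norm.f (q + 1) y, (D.norm.comm_b q y).symm⟩) _ _
      (D.norm_incl q) (fun h x => D.t_inv h q x) (D.incl_norm q)
  rw [e, LinearMap.range_comp, LinearMap.range_eq_top.2 hbij.2, Submodule.map_top]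
  exact ⟨h1.comp hbij.1, h2⟩

/-! ### Passage from fixed chains to the quotient by the image of `G - 1` -/

section Coinv

variable (G : Hom E E)

/-- `T`, as a morphism to the quotient. -/
def coinvT : Hom M (E.coinv G) where
  f n := Submodule.mkQ _ ∘ₗ D.T.f n
  comm_b n x := congrArg (Submodule.mkQ _) (D.T.comm_b n x)
  comm_B n x := congrArg (Submodule.mkQ _) (D.T.comm_B n x)

/-- The inclusion of the fixed points, as a morphism to the quotient. -/
def coinvIncl : Hom D.inv (E.coinv G) where
  f n := Submodule.mkQ _ ∘ₗ D.incl.f n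
  comm_b _ _ := rfl
  comm_B _ _ := rfl

/-- The sum of the operators `t` equals `T S`, whose image `G` fixes; as `G` commutes with each `t`,
the norm cannot distinguish `G x` from `x`. This lets the norm descend to the quotient. -/
theorem norm_G (hGT : ∀ n x, G.f n (D.T.f n x) = D.T.f n x)
    (hGt : ∀ h n x, (D.t h).f n (G.f n x) = G.f n ((D.t h).f n x)) (n : ℕ) (x : E.X n) :
    D.norm.f n (G.f n x) = D.norm.f n x := by
  refine Subtype.ext ((D.incl_norm n _).trans (Eq.trans ?_ (D.incl_norm n x).symm))
  simp_rw [hGt, ← map_sum, ← D.T_S, hGT]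

/-- The sum of the operators `t`, on the quotient. -/
def coinvNorm (hGT : ∀ n x, G.f n (D.T.f n x) = D.T.f n x)
    (hGt : ∀ h n x, (D.t h).f n (G.f n x) = G.f n ((D.t h).f n x)) :
    Hom (E.coinv G) D.inv where
  f n := Submodule.liftQ _ (D.norm.f n) (by
    rintro _ ⟨x, rfl⟩
    rw [LinearMap.mem_ker, LinearMap.sub_apply, LinearMap.id_apply, map_sub,
      D.norm_G G hGT hGt, sub_self])
  comm_b n x := by
    obtain ⟨x, rfl⟩ := Submodule.Quotient.mk_surjective _ x
    exact D.norm.comm_b n x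
  comm_B n x := by
    obtain ⟨x, rfl⟩ := Submodule.Quotient.mk_surjective _ x
    exact D.norm.comm_B n x

theorem coinvNorm_coinvIncl (hGT : ∀ n x, G.f n (D.T.f n x) = D.T.f n x)
    (hGt : ∀ h n x, (D.t h).f n (G.f n x) = G.f n ((D.t h).f n x))
    (n : ℕ) (x : D.inv.X n) :
    (D.coinvNorm G hGT hGt).f n ((D.coinvIncl G).f n x) = (Fintype.card ι : ℂ) • x :=
  D.norm_incl n x

theorem coinvIncl_coinvNorm (hGT : ∀ n x, G.f n (D.T.f n x) = D.T.f n x)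
    (hGt : ∀ h n x, (D.t h).f n (G.f n x) = G.f n ((D.t h).f n x))
    (n : ℕ) (x : (E.coinv G).X n) :
    (D.coinvIncl G).f n ((D.coinvNorm G hGT hGt).f n x) =
      ∑ h, (coinvMap (D.t h) (hGt h)).f n x := by
  obtain ⟨x, rfl⟩ := Submodule.Quotient.mk_surjective _ x
  refine (congrArg (Submodule.mkQ _) (D.incl_norm n x)).trans ?_
  rw [map_sum]
  rfl

theorem coinvMap_coinvIncl
    (hGt : ∀ h n x, (D.t h).f n (G.f n x) = G.f n ((D.t h).f n x)) (h : ι) (n : ℕ) (x : D.inv.X n) :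
    (coinvMap (D.t h) (hGt h)).f n ((D.coinvIncl G).f n x) = (D.coinvIncl G).f n x :=
  congrArg (Submodule.mkQ _) (D.t_inv h n x)

/-- The image of `HC` under `T` is the space of invariants. -/
theorem mapHC_spec [Nonempty ι] (hM : M.IsMixed)
    (hGT : ∀ n x, G.f n (D.T.f n x) = D.T.f n x)
    (hGt : ∀ h n x, (D.t h).f n (G.f n x) = G.f n ((D.t h).f n x)) (q : ℕ) : Function.Injective ((D.coinvT G).mapHC q) ∧
    LinearMap.range ((D.coinvT G).mapHC q) =
      ⨅ h, LinearMap.eqLocus ((coinvMap (D.t h) (hGt h)).mapHC q) LinearMap.id := by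
  have hbij := D.contracts.mapHC_bijective hM _ D.toInv_section q
  have e : (D.coinvT G).mapHC q = (D.coinvIncl G).mapHC q ∘ₗ D.toInv.mapHC q :=
    LinearMap.ext fun x => by
      obtain ⟨x, rfl⟩ := Submodule.Quotient.mk_surjective _ x
      rfl
  obtain ⟨h1, h2⟩ : Function.Injective ((D.coinvIncl G).mapHC q) ∧
      LinearMap.range ((D.coinvIncl G).mapHC q) =
      ⨅ h, LinearMap.eqLocus ((coinvMap (D.t h) (hGt h)).mapHC q) LinearMap.id :=
    subquotMap_invariants (D.coinvIncl G).prod (D.coinvNorm G hGT hGt).prod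
      (fun h => (coinvMap (D.t h) (hGt h)).prod) _ _
      (by
        rintro x ⟨hx, hx'⟩
        refine ⟨Hom.prod_mem_cyclicChains _ hx, ?_⟩
        have hx'' : (E.coinv G).cyclicD q x = 0 := hx'
        change D.inv.cyclicD q _ = 0
        rw [← Hom.prod_cyclicD, hx'', map_zero])
      (by
        rintro _ ⟨y, hy, rfl⟩
        exact ⟨_, Hom.prod_mem_cyclicChains _ hy, (Hom.prod_cyclicD _ _ y).symm⟩) _ _
      (fun x => funext fun m => D.coinvNorm_coinvIncl G hGT hGt m (x m))
      (fun h x => funext fun m => D.coinvMap_coinvIncl G hGt h m (x m))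
      (fun x => funext fun m => by
        rw [Finset.sum_apply]
        exact D.coinvIncl_coinvNorm G hGT hGt m (x m))
  rw [e, LinearMap.range_comp, LinearMap.range_eq_top.2 hbij.2, Submodule.map_top]
  exact ⟨h1.comp hbij.1, h2⟩

/-- The image of `HP` under `T` is the space of invariants. -/
theorem mapHP_spec [Nonempty ι] (hM : M.IsMixed)
    (hGT : ∀ n x, G.f n (D.T.f n x) = D.T.f n x)
    (hGt : ∀ h n x, (D.t h).f n (G.f n x) = G.f n ((D.t h).f n x)) (q : ZMod 2) : Function.Injective ((D.coinvT G).mapHP q) ∧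
    LinearMap.range ((D.coinvT G).mapHP q) =
      ⨅ h, LinearMap.eqLocus ((coinvMap (D.t h) (hGt h)).mapHP q) LinearMap.id := by
  have hbij := D.contracts.mapHP_bijective hM _ D.toInv_section q
  have e : (D.coinvT G).mapHP q = (D.coinvIncl G).mapHP q ∘ₗ D.toInv.mapHP q :=
    LinearMap.ext fun x => by
      obtain ⟨x, rfl⟩ := Submodule.Quotient.mk_surjective _ x
      rfl
  obtain ⟨h1, h2⟩ : Function.Injective ((D.coinvIncl G).mapHP q) ∧
      LinearMap.range ((D.coinvIncl G).mapHP q) =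
      ⨅ h, LinearMap.eqLocus ((coinvMap (D.t h) (hGt h)).mapHP q) LinearMap.id :=
    subquotMap_invariants (D.coinvIncl G).prod (D.coinvNorm G hGT hGt).prod
      (fun h => (coinvMap (D.t h) (hGt h)).prod) _ _
      (by
        rintro x ⟨hx, hx'⟩
        refine ⟨Hom.prod_mem_periodicChains _ hx, ?_⟩
        have hx'' : (E.coinv G).tot x = 0 := hx'
        change D.inv.tot _ = 0
        rw [← Hom.prod_tot, hx'', map_zero])
      (by
        rintro _ ⟨y, hy, rfl⟩
        exact ⟨_, Hom.prod_mem_periodicChains _ hy, (Hom.prod_tot _ y).symm⟩) _ _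
      (fun x => funext fun m => D.coinvNorm_coinvIncl G hGT hGt m (x m))
      (fun h x => funext fun m => D.coinvMap_coinvIncl G hGt h m (x m))
      (fun x => funext fun m => by
        rw [Finset.sum_apply]
        exact D.coinvIncl_coinvNorm G hGT hGt m (x m))
  rw [e, LinearMap.range_comp, LinearMap.range_eq_top.2 hbij.2, Submodule.map_top]
  exact ⟨h1.comp hbij.1, h2⟩

end Coinv

end Transfer

end Mixed

/-! ### Tuples indexed by natural numbers -/

section Tuples

/-- `face`, for a tuple `(a_0, …, a_{n+1})` that is given by a sequence. -/
def faceN {A : Type u} [Mul A] (g : A → A) (n i : ℕ) (a : ℕ → A) (m : ℕ) : A :=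
  if i = n + 1 then if m = 0 then a (n + 1) * a 0 else a m
  else if m < i then a m
  else if m = i then a m * (if i = 0 then g (a (m + 1)) else a (m + 1))
  else a (m + 1)

/-- `rot`, for a tuple `(a_0, …, a_n)` that is given by a sequence. -/
def rotN {A : Type u} [One A] (g : A → A) (n k : ℕ) (a : ℕ → A) : ℕ → A
  | 0 => 1
  | p + 1 => if k < p then g (a (p - k)) else if k = p then a 0 else a (p + n + 1 - k)

/-- The tuple `(a_0, …, a_n)` of a sequence. -/
abbrev tup {A : Type u} (n : ℕ) (a : ℕ → A) : Fin (n + 1) → A := fun i => a i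

/-- The extension of a tuple to a sequence. -/
def seqOf {A : Type u} {n : ℕ} (a : Fin (n + 1) → A) (m : ℕ) : A :=
  -- The value beyond the last index is immaterial; taking an entry of the tuple makes the extension
  -- commute with entrywise operations and turns constant tuples into constant sequences.
  if h : m < n + 1 then a ⟨m, h⟩ else a 0

theorem tup_seqOf {A : Type u} {n : ℕ} (a : Fin (n + 1) → A) : tup n (seqOf a) = a := by
  funext i
  simp only [tup, seqOf, i.2, dif_pos]

theorem tup_congr {A : Type u} {n : ℕ} {a a' : ℕ → A} (h : ∀ m ≤ n, a m = a' m) :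
    tup n a = tup n a' := funext fun i => h i (by omega)

theorem seqOf_tup {A : Type u} {n : ℕ} (a : ℕ → A) {m : ℕ} (hm : m ≤ n) :
    seqOf (tup n a) m = a m := by
  rw [seqOf, dif_pos (by omega)]

/-- With entries indexed by natural numbers, the identities between faces, rotations and prisms
become case distinctions in linear arithmetic. -/
theorem face_tup {A : Type u} [Mul A] (g : A → A) (n : ℕ) (i : Fin (n + 2)) (a : ℕ → A) :
    face g i (tup (n + 1) a) = tup n (faceN g n i a) := by
  funext j
  have h0 : ∀ {l : ℕ} (i : Fin (l + 1)), i = 0 ↔ (i : ℕ) = 0 := fun i => Fin.ext_iff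
  simp only [face, faceN, tup, h0, Fin.val_castSucc, Fin.val_succ, Fin.val_last, Fin.val_zero]

theorem rot_tup {A : Type u} [One A] (g : A → A) (n : ℕ) (k : Fin (n + 1)) (a : ℕ → A) :
    rot g k (tup n a) = tup (n + 1) (rotN g n k a) := by
  funext j
  refine Fin.cases ?_ (fun p => ?_) j
  · rfl
  · have hk := k.2
    have hp := p.2
    simp only [rot, Fin.cons_succ, tup, Fin.val_succ, rotN]
    rcases lt_trichotomy k p with h | h | h
    · rw [if_pos h, if_pos (by exact h), Fin.sub_val_of_le h.le]
    · subst h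
      simp
    · have h' : (p : ℕ) < k := h
      -- Here the subtraction modulo `n + 1` wraps around, whence the summand `n + 1` in the index.
      rw [if_neg (by exact h.not_gt), if_neg (by omega), if_neg (by omega), Fin.coe_sub_iff_lt.2 h]
      congr 1
      omega

end Tuples

/-! ### Normalized chains of sequences -/

section NChain

variable {A : Type u} [Ring A] [Algebra ℂ A]

/-- The class of `a_0 ⊗ … ⊗ a_n`. -/
def nchain (n : ℕ) (a : ℕ → A) : Chains A n := chain (tup n a)

theorem nchain_congr {n : ℕ} {a a' : ℕ → A} (h : ∀ m ≤ n, a m = a' m) :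
    nchain n a = nchain n a' := congrArg chain (tup_congr h)

theorem chain_eq_nchain {n : ℕ} (a : Fin (n + 1) → A) : chain a = nchain n (seqOf a) := by
  rw [nchain, tup_seqOf]

theorem nchain_eq_zero {n : ℕ} {a : ℕ → A} {m : ℕ} (h0 : m ≠ 0) (hm : m ≤ n) (ha : a m = 1) :
    nchain n a = 0 :=
  chain_eq_zero (i := ⟨m, by omega⟩) (fun h => h0 (congrArg Fin.val h)) ha

theorem nchain_eq_zero_of_eq_zero {n : ℕ} {a : ℕ → A} {m : ℕ} (hm : m ≤ n) (ha : a m = 0) :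
    nchain n a = 0 := by
  rw [nchain, chain, MultilinearMap.map_coord_zero _ ⟨m, by omega⟩ ha]
  rfl

theorem nchain_hom_ext {n : ℕ} {V : Type v} [AddCommGroup V] [Module ℂ V]
    {F G : Chains A n →ₗ[ℂ] V} (h : ∀ a, F (nchain n a) = G (nchain n a)) : F = G :=
  chains_hom_ext fun a => by rw [chain_eq_nchain, h]

theorem chainsb_nchain (g : A →ₐ[ℂ] A) (n : ℕ) (a : ℕ → A) :
    chainsb g n (nchain (n + 1) a) =
      ∑ i ∈ Finset.range (n + 2), (-1 : ℂ) ^ i • nchain n (faceN g n i a) := by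
  rw [nchain, chainsb_chain, ← Fin.sum_univ_eq_sum_range
    (fun i => (-1 : ℂ) ^ i • nchain n (faceN g n i a))]
  refine Finset.sum_congr rfl fun i _ => ?_
  rw [face_tup, nchain]

theorem chainsB_nchain (g : A →ₐ[ℂ] A) (n : ℕ) (a : ℕ → A) :
    chainsB g n (nchain n a) =
      ∑ k ∈ Finset.range (n + 1), (-1 : ℂ) ^ (n * k) • nchain (n + 1) (rotN g n k a) := by
  rw [nchain, chainsB_chain, ← Fin.sum_univ_eq_sum_range
    (fun k => (-1 : ℂ) ^ (n * k) • nchain (n + 1) (rotN g n k a))]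
  refine Finset.sum_congr rfl fun i _ => ?_
  rw [rot_tup, nchain]

end NChain

/-! ### Alternating double sums -/

section Alternating

variable {V : Type v} [AddCommGroup V] [Module ℂ V]

theorem neg_one_pow_eq_neg {a b : ℕ} (c : ℕ) (h : a = b + 2 * c + 1) :
    (-1 : ℂ) ^ a = -(-1) ^ b := by
  rw [h, pow_succ, pow_add, pow_mul]
  simp

/-- The usual cancellation behind `d² = 0`: the exchange of `(j, i)` with `(i, j - 1)` for `i < j`
is an involution without fixed points that reverses the sign. -/
theorem alternating_sum_eq_zero (N : ℕ) (F : ℕ → ℕ → V)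
    (h : ∀ i j, i < j → j ≤ N → F j i = F i (j - 1)) :
    ∑ j ∈ Finset.range (N + 1), ∑ i ∈ Finset.range N, (-1 : ℂ) ^ (j + i) • F j i = 0 := by
  rw [← Finset.sum_product']
  refine Finset.sum_involution
    (fun p _ => if p.2 < p.1 then (p.2, p.1 - 1) else (p.2 + 1, p.1)) ?_ ?_ ?_ ?_
  · rintro ⟨j, i⟩ hp
    simp only [Finset.mem_product, Finset.mem_range] at hp
    by_cases hij : i < j
    · simp only [hij, if_true]
      rw [h i j hij (by omega), neg_one_pow_eq_neg (a := j + i) (b := i + (j - 1)) 0 (by omega),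
        neg_smul, neg_add_cancel]
    · simp only [hij, if_false]
      rw [h j (i + 1) (by omega) (by omega), Nat.add_sub_cancel,
        neg_one_pow_eq_neg (a := i + 1 + j) (b := j + i) 0 (by omega), neg_smul, add_neg_cancel]
  · rintro ⟨j, i⟩ hp - h'
    clear h
    grind
  · rintro ⟨j, i⟩ hp
    simp only [Finset.mem_product, Finset.mem_range] at hp ⊢
    split_ifs <;> simp <;> omega
  · rintro ⟨j, i⟩ hp
    clear h
    grind

/-- The combinatorics of a prism decomposition. Off the diagonals `j = i` and `j = i + 1` the terms
of `P` are those of `Q` with the opposite sign; on the two diagonals `h3` makes the sum telescope to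
the bottom and the top of the prism. -/
theorem prism_sum (n : ℕ) (P Q : ℕ → ℕ → V)
    (h1 : ∀ i j, j < i → i ≤ n → P j i = Q j (i - 1))
    (h2 : ∀ i j, i + 1 < j → j ≤ n + 1 → P j i = Q (j - 1) i)
    (h3 : ∀ i < n, P (i + 1) i = P (i + 1) (i + 1)) :
    ∑ j ∈ Finset.range (n + 2), ∑ i ∈ Finset.range (n + 1), (-1 : ℂ) ^ (j + i) • P j i +
      ∑ j ∈ Finset.range (n + 1), ∑ i ∈ Finset.range n, (-1 : ℂ) ^ (j + i) • Q j i =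
        P 0 0 - P (n + 1) n := by
  have hQ : ∑ j ∈ Finset.range (n + 1), ∑ i ∈ Finset.range n, (-1 : ℂ) ^ (j + i) • Q j i =
      -∑ p ∈ (Finset.range (n + 2) ×ˢ Finset.range (n + 1)).filter
        (fun p => ¬ (p.1 = p.2 ∨ p.1 = p.2 + 1)), (-1 : ℂ) ^ (p.1 + p.2) • P p.1 p.2 := by
    rw [← Finset.sum_product', ← Finset.sum_neg_distrib]
    refine Finset.sum_nbij' (fun p => if p.1 ≤ p.2 then (p.1, p.2 + 1) else (p.1 + 1, p.2))
      (fun p => if p.1 < p.2 then (p.1, p.2 - 1) else (p.1 - 1, p.2)) ?_ ?_ ?_ ?_ ?_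
    · rintro ⟨j, i⟩ hp
      simp only [Finset.mem_product, Finset.mem_range, Finset.mem_filter] at hp ⊢
      split_ifs <;> simp <;> omega
    · rintro ⟨j, i⟩ hp
      simp only [Finset.mem_product, Finset.mem_range, Finset.mem_filter] at hp ⊢
      split_ifs <;> simp <;> omega
    · rintro ⟨j, i⟩ hp
      simp only [Finset.mem_product, Finset.mem_range] at hp
      by_cases hji : j ≤ i
      · simp [hji, Nat.lt_succ_of_le hji]
      · have : ¬ j + 1 < i := by omega
        simp [hji, this]
    · rintro ⟨j, i⟩ hp
      simp only [Finset.mem_product, Finset.mem_range, Finset.mem_filter] at hp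
      clear h1 h2 h3
      grind
    · rintro ⟨j, i⟩ hp
      simp only [Finset.mem_product, Finset.mem_range] at hp
      by_cases hji : j ≤ i
      · simp only [hji, if_true]
        rw [h1 (i + 1) j (by omega) (by omega), Nat.add_sub_cancel,
          neg_one_pow_eq_neg (a := j + (i + 1)) (b := j + i) 0 (by omega), neg_smul, neg_neg]
      · simp only [hji, if_false]
        rw [h2 i (j + 1) (by omega) (by omega), Nat.add_sub_cancel,
          neg_one_pow_eq_neg (a := j + 1 + i) (b := j + i) 0 (by omega), neg_smul, neg_neg]
  rw [hQ, ← Finset.sum_product', ← Finset.sum_filter_add_sum_filter_not _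
    (fun p : ℕ × ℕ => p.1 = p.2 ∨ p.1 = p.2 + 1), add_neg_cancel_right, Finset.sum_filter,
    Finset.sum_product_right]
  have hrow : ∀ i ∈ Finset.range (n + 1), (∑ j ∈ Finset.range (n + 2),
      if j = i ∨ j = i + 1 then (-1 : ℂ) ^ (j + i) • P j i else 0) = P i i - P (i + 1) i := by
    intro i hi
    have hi' := Finset.mem_range.1 hi
    have e : ∀ j, (if j = i ∨ j = i + 1 then (-1 : ℂ) ^ (j + i) • P j i else 0) =
        (if j = i then P i i else 0) + (if j = i + 1 then -P (i + 1) i else 0) := by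
      intro j
      by_cases h : j = i
      · subst h
        rw [if_pos (Or.inl rfl), if_pos rfl, if_neg (by omega), ← two_mul, pow_mul]
        simp
      · by_cases h' : j = i + 1
        · subst h'
          rw [if_pos (Or.inr rfl), if_neg h, if_pos rfl,
            neg_one_pow_eq_neg (a := i + 1 + i) (b := 0) i (by omega)]
          simp
        · simp [h, h']
    simp only [e, Finset.sum_add_distrib, Finset.sum_ite_eq', Finset.mem_range]
    rw [if_pos (by omega), if_pos (by omega), sub_eq_add_neg]
  refine (Finset.sum_congr rfl hrow).trans ?_
  have key : ∀ l ≤ n, ∑ i ∈ Finset.range (l + 1), (P i i - P (i + 1) i) = P 0 0 - P (l + 1) l := by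
    intro l hl
    induction l with
    | zero => simp
    | succ l ih =>
      rw [Finset.sum_range_succ, ih (by omega), h3 l (by omega)]
      abel
  exact key n le_rfl

end Alternating

/-! ### The relations between `b` and `B` -/

section Relations

theorem faceN_faceN {A : Type u} [Semigroup A] (n i j : ℕ) (hij : i < j) (hj : j ≤ n + 2)
    (a : ℕ → A) (m : ℕ) (hm : m ≤ n) :
    faceN id n i (faceN id (n + 1) j a) m = faceN id n (j - 1) (faceN id (n + 1) i a) m := by
  unfold faceN
  simp only [id]
  grind

/-- The face `j + 1` multiplies the entries that the rotation has brought to the places `j + 1` and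
`j + 2`. For `k ≤ j` these are `a_{j-k}` and `a_{j-k+1}`, so face and rotation commute up to a shift
of the face. -/
theorem faceN_rotN_of_le {A : Type u} [MulOneClass A] (n k j : ℕ) (hj : j ≤ n) (hk : k ≤ j)
    (a : ℕ → A) (m : ℕ) (hm : m ≤ n + 1) :
    faceN id (n + 1) (j + 1) (rotN id (n + 1) k a) m =
      rotN id n k (faceN id n (j - k) a) m := by
  cases m with
  | zero => simp [faceN, rotN]; omega
  | succ m =>
    simp only [faceN, rotN, id]
    grind

/-- Here the multiplied pair lies in the part that was rotated to the front; for `j = k` it is the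
seam `a_{n+1} a_0`, which the last face accounts for. The face has one rotation step fewer to
undergo. -/
theorem faceN_rotN_of_lt {A : Type u} [MulOneClass A] (n k j : ℕ) (hk : k ≤ n) (hj : j ≤ k)
    (a : ℕ → A) (m : ℕ) (hm : m ≤ n + 1) :
    faceN id (n + 1) (j + 1) (rotN id (n + 1) (k + 1) a) m =
      rotN id n k (faceN id n (j + n + 1 - k) a) m := by
  cases m with
  | zero => simp [faceN, rotN]; omega
  | succ m =>
    simp only [faceN, rotN, id]
    rcases lt_trichotomy m j with h | h | h
    · grind
    · grind
    · grind

theorem faceN_zero_rotN {A : Type u} [MulOneClass A] (n k : ℕ) (a : ℕ → A) (m : ℕ) :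
    faceN id n 0 (rotN id n k a) m = rotN id n k a (m + 1) := by
  cases m with
  | zero => simp [faceN, rotN]
  | succ m => simp [faceN]

/-- The `1` in place `0` absorbs the outer faces. The last face moves one more entry to the front,
so it is the zeroth face of the next rotation. -/
theorem faceN_last_rotN {A : Type u} [MulOneClass A] (n k : ℕ) (hk : k ≤ n) (a : ℕ → A) (m : ℕ)
    (hm : m ≤ n) :
    faceN id n (n + 1) (rotN id n k a) m = rotN id n (k + 1) a (m + 1) := by
  cases m with
  | zero => simp only [faceN, rotN, id, if_true, mul_one]; grind
  | succ m => simp only [faceN, rotN, id]; grind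

theorem rotN_self {A : Type u} [One A] (n : ℕ) (a : ℕ → A) (m : ℕ) (hm : m ≤ n) :
    rotN id n (n + 1) a (m + 1) = rotN id n 0 a (m + 1) := by
  simp only [rotN, id]
  grind

variable {A : Type u} [Ring A] [Algebra ℂ A] {g : A →ₐ[ℂ] A}

theorem chainsb_chainsb (hg : (g : A → A) = id) (n : ℕ) (x : Chains A (n + 2)) :
    chainsb g n (chainsb g (n + 1) x) = 0 := by
  refine LinearMap.congr_fun (f := chainsb g n ∘ₗ chainsb g (n + 1)) (g := 0)
    (nchain_hom_ext fun a => ?_) x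
  simp only [LinearMap.comp_apply, LinearMap.zero_apply, chainsb_nchain, map_sum, map_smul, hg,
    Finset.smul_sum, smul_smul, ← pow_add]
  refine alternating_sum_eq_zero (n + 2) (fun j i => nchain n (faceN id n i (faceN id (n + 1) j a)))
    fun i j hij hj => nchain_congr fun m hm => faceN_faceN n i j hij hj a m hm

/-- The first `B` puts `1` in place `0`, and the second moves it to a positive place, where
normalized chains vanish. -/
theorem chainsB_chainsB (n : ℕ) (x : Chains A n) : chainsB g (n + 1) (chainsB g n x) = 0 := by
  refine LinearMap.congr_fun (f := chainsB g (n + 1) ∘ₗ chainsB g n) (g := 0)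
    (nchain_hom_ext fun a => ?_) x
  simp only [LinearMap.comp_apply, LinearMap.zero_apply, chainsB_nchain, map_sum, map_smul]
  refine Finset.sum_eq_zero fun k _ => smul_eq_zero_of_right _ (Finset.sum_eq_zero fun l hl =>
    smul_eq_zero_of_right _ (nchain_eq_zero (m := l + 1) (by omega) ?_ ?_))
  · have := Finset.mem_range.1 hl
    omega
  · simp [rotN]

/-- The sign `(-1)^{n+1}` turns the summands into differences of consecutive values of `(-1)^{nk} F
k`; the ends agree because `n (n + 1)` is even. -/
theorem alternating_telescope {V : Type v} [AddCommGroup V] [Module ℂ V] (n : ℕ) (F : ℕ → V)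
    (hF : F (n + 1) = F 0) :
    ∑ k ∈ Finset.range (n + 1), (-1 : ℂ) ^ (n * k) • (F k + (-1 : ℂ) ^ (n + 1) • F (k + 1)) = 0 := by
  have e : ∀ k, (-1 : ℂ) ^ (n * k) • (F k + (-1 : ℂ) ^ (n + 1) • F (k + 1)) =
      (-1 : ℂ) ^ (n * k) • F k - (-1 : ℂ) ^ (n * (k + 1)) • F (k + 1) := by
    intro k
    rw [smul_add, smul_smul, ← pow_add, sub_eq_add_neg, ← neg_smul,
      neg_one_pow_eq_neg (a := n * k + (n + 1)) (b := n * (k + 1)) 0 (by ring)]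
  simp only [e]
  rw [Finset.sum_range_sub' (fun k => (-1 : ℂ) ^ (n * k) • F k), hF, (Nat.even_mul_succ_self n).neg_one_pow]
  simp

theorem chainsb_chainsB_zero (hg : (g : A → A) = id) (x : Chains A 0) :
    chainsb g 0 (chainsB g 0 x) = 0 := by
  refine LinearMap.congr_fun (f := chainsb g 0 ∘ₗ chainsB g 0) (g := 0)
    (nchain_hom_ext fun a => ?_) x
  rw [LinearMap.comp_apply, LinearMap.zero_apply, chainsB_nchain, Finset.sum_range_one, map_smul,
    chainsb_nchain, Finset.sum_range_succ, Finset.sum_range_one, hg]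
  have : nchain 0 (faceN id 0 0 (rotN id 0 0 a)) = nchain 0 (faceN id 0 1 (rotN id 0 0 a)) :=
    nchain_congr fun m hm => by
      obtain rfl : m = 0 := by omega
      simp [faceN, rotN]
  simp [this]

/-- The outer faces of consecutive rotations telescope around a full turn. The inner faces of
rotations match the rotations of faces bijectively, with opposite signs. -/
theorem chainsb_chainsB (hg : (g : A → A) = id) (n : ℕ) (x : Chains A (n + 1)) :
    chainsb g (n + 1) (chainsB g (n + 1) x) + chainsB g n (chainsb g n x) = 0 := by
  refine LinearMap.congr_fun
    (f := chainsb g (n + 1) ∘ₗ chainsB g (n + 1) + chainsB g n ∘ₗ chainsb g n) (g := 0)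
    (nchain_hom_ext fun a => ?_) x
  simp only [LinearMap.add_apply, LinearMap.comp_apply, LinearMap.zero_apply, chainsB_nchain,
    chainsb_nchain, map_sum, map_smul, hg, Finset.smul_sum]
  have hsplit : ∀ k ∈ Finset.range (n + 2), ∑ j ∈ Finset.range (n + 3),
      (-1 : ℂ) ^ ((n + 1) * k) • (-1 : ℂ) ^ j •
        nchain (n + 1) (faceN id (n + 1) j (rotN id (n + 1) k a)) =
      (-1 : ℂ) ^ ((n + 1) * k) • (nchain (n + 1) (fun m => rotN id (n + 1) k a (m + 1)) +
        (-1 : ℂ) ^ (n + 2) • nchain (n + 1) (fun m => rotN id (n + 1) (k + 1) a (m + 1))) +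
      ∑ j ∈ Finset.range (n + 1), (-1 : ℂ) ^ ((n + 1) * k + (j + 1)) •
        nchain (n + 1) (faceN id (n + 1) (j + 1) (rotN id (n + 1) k a)) := by
    intro k hk
    have hk' := Finset.mem_range.1 hk
    rw [Finset.sum_range_succ, Finset.sum_range_succ',
      nchain_congr (a' := fun m => rotN id (n + 1) k a (m + 1))
        (fun m _ => faceN_zero_rotN (n + 1) k a m),
      nchain_congr (a' := fun m => rotN id (n + 1) (k + 1) a (m + 1))
        (fun m hm => faceN_last_rotN (n + 1) k (by omega) a m hm)]
    simp only [smul_smul, ← pow_add, smul_add, pow_zero, mul_one]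
    abel
  rw [Finset.sum_congr rfl hsplit, Finset.sum_add_distrib,
    alternating_telescope (n + 1) (fun k => nchain (n + 1) (fun m => rotN id (n + 1) k a (m + 1)))
      (nchain_congr fun m hm => rotN_self (n + 1) a m hm), zero_add, ← Finset.sum_product',
    ← Finset.sum_product', ← eq_neg_iff_add_eq_zero, ← Finset.sum_neg_distrib]
  -- A pair (rotation `k`, inner face `j + 1`) goes to the pair (face, rotation) in the other order
  -- of composition; the two cases say whether the multiplied pair lies behind or before the seam.
  refine Finset.sum_nbij'
    (fun p => if p.1 ≤ p.2 then (p.2 - p.1, p.1) else (p.2 + n + 2 - p.1, p.1 - 1))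
    (fun p => if p.1 + p.2 ≤ n then (p.2, p.1 + p.2) else (p.2 + 1, p.1 + p.2 - (n + 1))) ?_ ?_ ?_ ?_ ?_
  · rintro ⟨k, j⟩ hp
    simp only [Finset.mem_product, Finset.mem_range] at hp ⊢
    grind
  · rintro ⟨k, j⟩ hp
    simp only [Finset.mem_product, Finset.mem_range] at hp ⊢
    grind
  · rintro ⟨k, j⟩ hp
    simp only [Finset.mem_product, Finset.mem_range] at hp ⊢
    grind
  · rintro ⟨k, j⟩ hp
    simp only [Finset.mem_product, Finset.mem_range] at hp ⊢
    grind
  · rintro ⟨k, j⟩ hp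
    simp only [Finset.mem_product, Finset.mem_range] at hp ⊢
    by_cases hkj : k ≤ j
    · simp only [hkj, if_true]
      rw [nchain_congr fun m hm => faceN_rotN_of_le n k j (by omega) hkj a m hm, smul_smul, ← pow_add,
        neg_one_pow_eq_neg (a := (n + 1) * k + (j + 1)) (b := j - k + n * k) k
          (by rw [add_mul]; omega), neg_smul]
    · obtain ⟨k, rfl⟩ : ∃ k', k = k' + 1 := ⟨k - 1, by omega⟩
      simp only [hkj, if_false]
      rw [nchain_congr fun m hm => faceN_rotN_of_lt n k j (by omega) (by omega) a m hm, smul_smul,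
        ← pow_add, show j + n + 2 - (k + 1) = j + n + 1 - k by omega, Nat.add_sub_cancel,
        neg_one_pow_eq_neg (a := (n + 1) * (k + 1) + (j + 1)) (b := j + n + 1 - k + n * k) k
          (by rw [add_mul, mul_add]; omega), neg_smul]

/-- The untwisted Hochschild complex is a mixed complex. -/
theorem hochschild_isMixed (hg : (g : A → A) = id) : (hochschild g).IsMixed where
  b_b n x := chainsb_chainsb hg n x
  B_B n x := chainsB_chainsB n x
  b_B_zero x := chainsb_chainsB_zero hg x
  b_B n x := chainsb_chainsB hg n x

end Relations

/-! ### Crossed products, abstractly -/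

/-- An algebra `R` which is the crossed product of `D` by an action of `Γ`: `R` is the direct sum
of the subspaces `ι(D) u(g)`, and `coeff g` is the corresponding coefficient. -/
structure CrossedData (Γ : Type v) [Group Γ] [Fintype Γ] (D : Type u) [Ring D] [Algebra ℂ D]
    (R : Type w) [Ring R] [Algebra ℂ R] where
  act : Γ → D →ₐ[ℂ] D
  act_one : ∀ a, act 1 a = a
  act_mul : ∀ g h a, act (g * h) a = act g (act h a)
  ι : D →ₐ[ℂ] R
  u : Γ →* R
  u_mul_ι : ∀ g a, u g * ι a = ι (act g a) * u g
  coeff : Γ → R →ₗ[ℂ] D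
  coeff_self : ∀ g a, coeff g (ι a * u g) = a
  coeff_of_ne : ∀ g h a, g ≠ h → coeff g (ι a * u h) = 0
  sum_coeff : ∀ x, ∑ g, ι (coeff g x) * u g = x

namespace CrossedData

variable {Γ : Type v} [Group Γ] [Fintype Γ] {D : Type u} [Ring D] [Algebra ℂ D]
  {R : Type w} [Ring R] [Algebra ℂ R] (C : CrossedData Γ D R)

theorem monomial_mul (g h : Γ) (a b : D) :
    C.ι a * C.u g * (C.ι b * C.u h) = C.ι (a * C.act g b) * C.u (g * h) := by
  rw [mul_assoc, ← mul_assoc (C.u g), C.u_mul_ι, map_mul, map_mul, mul_assoc, mul_assoc]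

theorem coeff_mul (p : Γ) (x y : R) :
    C.coeff p (x * y) = ∑ g, C.coeff g x * C.act g (C.coeff (g⁻¹ * p) y) := by
  conv_lhs => rw [← C.sum_coeff x, ← C.sum_coeff y, Finset.sum_mul_sum]
  rw [map_sum]
  refine Finset.sum_congr rfl fun g _ => ?_
  rw [map_sum, Finset.sum_eq_single (g⁻¹ * p)]
  · rw [C.monomial_mul, mul_inv_cancel_left, C.coeff_self]
  · intro h _ hh
    rw [C.monomial_mul]
    refine C.coeff_of_ne _ _ _ fun e => hh ?_
    rw [e, inv_mul_cancel_left]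
  · simp

theorem coeff_one_self : C.coeff 1 1 = 1 := by
  have := C.coeff_self 1 1
  rwa [map_one, map_one, mul_one] at this

theorem coeff_one_of_ne {g : Γ} (hg : g ≠ 1) : C.coeff g 1 = 0 := by
  have := C.coeff_of_ne g 1 1 hg
  rwa [map_one, map_one, mul_one] at this

/-- The matrix coefficients of the homomorphism from `R` to the matrices over `D` indexed
by `Γ`. -/
def mat (k l : Γ) : R →ₗ[ℂ] D := (C.act k).toLinearMap ∘ₗ C.coeff (k⁻¹ * l)

theorem mat_apply (k l : Γ) (x : R) : C.mat k l x = C.act k (C.coeff (k⁻¹ * l) x) := rfl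

/-- Substituting `l = k g` turns the convolution formula for the coefficients of a product into
matrix multiplication. -/
theorem mat_mul (k m : Γ) (x y : R) : C.mat k m (x * y) = ∑ l, C.mat k l x * C.mat l m y := by
  rw [mat_apply, coeff_mul, map_sum]
  refine Fintype.sum_equiv (Equiv.mulLeft k) _ _ fun g => ?_
  simp only [mat_apply, Equiv.coe_mulLeft, map_mul, inv_mul_cancel_left, C.act_mul, mul_inv_rev,
    mul_assoc]

theorem mat_one_self (k : Γ) : C.mat k k 1 = 1 := by
  rw [mat_apply, inv_mul_cancel, coeff_one_self, map_one]

theorem mat_one_of_ne {k l : Γ} (h : k ≠ l) : C.mat k l 1 = 0 := by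
  rw [mat_apply, C.coeff_one_of_ne, map_zero]
  exact fun e => h (inv_mul_eq_one.1 e)

/-- Left translation of both indices by `γ` absorbs the twist in `b_γ` and `B_γ`; translation by
elements of the centralizer gives the invariance of the trace. -/
theorem act_mat (h k l : Γ) (x : R) : C.act h (C.mat k l x) = C.mat (h * k) (h * l) x := by
  rw [mat_apply, mat_apply, ← C.act_mul, mul_inv_rev, mul_assoc, inv_mul_cancel_left]

theorem mat_monomial_of_eq {k l g : Γ} (h : k * g = l) (a : D) :
    C.mat k l (C.ι a * C.u g) = C.act k a := by
  rw [mat_apply, ← h, inv_mul_cancel_left, C.coeff_self]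

theorem mat_monomial_of_ne {k l g : Γ} (h : k * g ≠ l) (a : D) :
    C.mat k l (C.ι a * C.u g) = 0 := by
  rw [mat_apply, C.coeff_of_ne, map_zero]
  exact fun e => h (by rw [← e, mul_inv_cancel_left])

theorem u_mul_u_inv (g : Γ) : C.u g * C.u g⁻¹ = 1 := by rw [← map_mul, mul_inv_cancel, map_one]

theorem u_mul_u_inv_mul (g : Γ) (x : R) : C.u g * (C.u g⁻¹ * x) = x := by
  rw [← mul_assoc, u_mul_u_inv, one_mul]

/-! ### Cyclic sequences of group elements -/

/-- The sequence `k_0, …, k_n, k_0`. -/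
def wrap {α : Type v} (n : ℕ) (k : ℕ → α) (m : ℕ) : α := if m = n + 1 then k 0 else k m

/-- The successor of `k_m` in the twisted cycle `k_0, k_1, …, k_n, k_0`, where the step from `k_0`
leads to `γ k_1`. -/
def nxt (γ : Γ) (n : ℕ) (k : ℕ → Γ) (m : ℕ) : Γ :=
  if m = 0 then γ * wrap n k 1 else wrap n k (m + 1)

/-- The tuple of matrix coefficients of `x_0, …, x_n` along a twisted cycle. -/
def matN (γ : Γ) (n : ℕ) (k : ℕ → Γ) (x : ℕ → R) (m : ℕ) : D := C.mat (k m) (nxt γ n k m) (x m)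

theorem wrap_congr {α : Type v} {n : ℕ} {k k' : ℕ → α} (h : ∀ m ≤ n, k m = k' m) {m : ℕ}
    (hm : m ≤ n + 1) : wrap n k m = wrap n k' m := by
  unfold wrap
  split_ifs with h1
  · exact h 0 (by omega)
  · exact h m (by omega)

theorem nxt_congr {Γ : Type v} [Group Γ] {γ : Γ} {n : ℕ} {k k' : ℕ → Γ} (h : ∀ m ≤ n, k m = k' m) {m : ℕ} (hm : m ≤ n) :
    nxt γ n k m = nxt γ n k' m := by
  unfold nxt
  rw [wrap_congr h (by omega), wrap_congr h (by omega)]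

theorem matN_congr {γ : Γ} {n : ℕ} {k k' : ℕ → Γ} {x x' : ℕ → R} (h : ∀ m ≤ n, k m = k' m)
    (hx : ∀ m ≤ n, x m = x' m) {m : ℕ} (hm : m ≤ n) :
    C.matN γ n k x m = C.matN γ n k' x' m := by
  unfold matN
  rw [nxt_congr h hm, h m hm, hx m hm]

/-- The part of a cycle that remains after the `i`-th face. -/
def kfaceN {α : Type v} (n i : ℕ) (k : ℕ → α) (m : ℕ) : α :=
  if i = n + 1 then if m = 0 then k (n + 1) else k m
  else if m ≤ i then k m else k (m + 1)

/-- The insertion of `c` at the place that the `i`-th face omits. -/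
def insN {α : Type v} (n i : ℕ) (c : α) (k : ℕ → α) (m : ℕ) : α :=
  if i = n + 1 then if m = 0 then c else if m = n + 1 then k 0 else k m
  else if m ≤ i then k m else if m = i + 1 then c else k (m - 1)

theorem kfaceN_insN {α : Type v} {n i : ℕ} (c : α) (k : ℕ → α) {m : ℕ}
    (hm : m ≤ n) : kfaceN n i (insN n i c k) m = k m := by
  unfold kfaceN insN
  grind

/-- A cycle with `n + 2` vertices consists of the cycle left over by the `i`-th face and the vertex
`c` which that face omits. -/
theorem insN_bijective (Γ : Type v) [Fintype Γ] (n i : ℕ) (hi : i ≤ n + 1) : Function.Bijective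
    (fun p : (Fin (n + 1) → Γ) × Γ => tup (n + 1) (insN n i p.2 (seqOf p.1))) := by
  rw [Fintype.bijective_iff_injective_and_card]
  constructor
  · rintro ⟨k, c⟩ ⟨k', c'⟩ h
    have h' : ∀ m ≤ n + 1, insN n i c (seqOf k) m = insN n i c' (seqOf k') m := fun m hm =>
      congrFun h ⟨m, by omega⟩
    have hk : k = k' := by
      rw [← tup_seqOf k, ← tup_seqOf k']
      refine tup_congr fun m hm => ?_
      rw [← kfaceN_insN (i := i) c (seqOf k) hm, ← kfaceN_insN (i := i) c' (seqOf k') hm]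
      unfold kfaceN
      rw [h' (n + 1) le_rfl, h' m (by omega), h' (m + 1) (by omega)]
    have hc : c = c' := by
      by_cases hi' : i = n + 1
      · have := h' 0 (by omega)
        simpa [insN, hi'] using this
      · have := h' (i + 1) (by omega)
        simpa [insN, hi'] using this
    rw [hk, hc]
  · simp [pow_succ]

/-- The tensor `a_0 ⊗ … ⊗ a_n`. -/
def tens {A : Type u} [Ring A] [Algebra ℂ A] (n : ℕ) (a : ℕ → A) :
    PiTensorProduct ℂ (fun _ : Fin (n + 1) => A) := PiTensorProduct.tprod ℂ (tup n a)

theorem sum_tens {Γ : Type v} [Fintype Γ] {A : Type u} [Ring A] [Algebra ℂ A] {n s : ℕ} (hs : s ≤ n) (a : ℕ → A)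
    (y : Γ → ℕ → A) (h : ∀ c, ∀ m ≤ n, m ≠ s → y c m = a m) (hy : ∑ c, y c s = a s) :
    ∑ c, tens n (y c) = tens n a := by
  have e : ∀ c, tup n (y c) = Function.update (tup n a) ⟨s, by omega⟩ (y c s) := by
    intro c
    funext m
    by_cases hm : (m : ℕ) = s
    · have hm' : m = ⟨s, Nat.lt_succ_of_le hs⟩ := Fin.ext hm
      rw [hm']
      simp
    · rw [Function.update_of_ne fun h => hm (congrArg Fin.val h)]
      exact h c m (by omega) hm
  unfold tens
  simp only [e]
  rw [← MultilinearMap.map_update_sum, hy]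
  congr 1
  exact Function.update_eq_self (⟨s, by omega⟩ : Fin (n + 1)) (tup n a)

theorem faceN_matN_insN_of_ne {γ : Γ} {n i : ℕ} (hi : i ≤ n + 1) (c : Γ) (k : ℕ → Γ) (x : ℕ → R)
    {m : ℕ} (hm : m ≤ n) (hs : m ≠ if i = n + 1 then 0 else i) :
    faceN (C.act γ) n i (C.matN γ (n + 1) (insN n i c k) x) m =
      C.matN γ n k (faceN id n i x) m := by
  simp only [faceN, matN, nxt, wrap, insN, id]
  grind

/-- Only the entry `s` in which the face multiplies depends on the omitted vertex `c`, and the sum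
over `c` is the summation in a matrix product. -/
theorem sum_faceN_matN_insN {γ : Γ} {n i : ℕ} (hi : i ≤ n + 1) (k : ℕ → Γ) (x : ℕ → R) (s : ℕ)
    (hs : s = if i = n + 1 then 0 else i) :
    ∑ c, faceN (C.act γ) n i (C.matN γ (n + 1) (insN n i c k) x) s =
      C.matN γ n k (faceN id n i x) s := by
  by_cases hin : i = n + 1
  · subst hin
    rw [if_pos rfl] at hs
    subst hs
    have e : C.matN γ n k (faceN id n (n + 1) x) 0 =
        C.mat (k 0) (γ * wrap n k 1) (x (n + 1) * x 0) := by
      simp [matN, faceN, nxt]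
    rw [e, mat_mul]
    refine Finset.sum_congr rfl fun c _ => ?_
    simp only [faceN, matN, nxt, wrap, insN]
    grind
  · rw [if_neg hin] at hs
    subst hs
    by_cases h0 : s = 0
    · subst h0
      have e : C.matN γ n k (faceN id n 0 x) 0 =
          C.mat (k 0) (γ * wrap n k 1) (x 0 * x 1) := by
        simp [matN, faceN, nxt]
      rw [e, mat_mul]
      -- In the twisted face the action of `γ` on the second factor translates its indices, so the
      -- intermediate index of the matrix product is `γ c` instead of `c`.
      refine Fintype.sum_equiv (Equiv.mulLeft γ) _ _ fun c => ?_
      have e' : faceN (C.act γ) n 0 (C.matN γ (n + 1) (insN n 0 c k) x) 0 =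
        C.matN γ (n + 1) (insN n 0 c k) x 0 * C.act γ (C.matN γ (n + 1) (insN n 0 c k) x 1) := by
        simp [faceN]
      rw [e']
      unfold matN
      rw [act_mat]
      simp only [nxt, wrap, insN, Equiv.coe_mulLeft]
      grind
    · have e : C.matN γ n k (faceN id n s x) s =
          C.mat (k s) (wrap n k (s + 1)) (x s * x (s + 1)) := by
        simp [matN, faceN, nxt, hin, h0]
      rw [e, mat_mul]
      refine Finset.sum_congr rfl fun c _ => ?_
      simp only [faceN, matN, nxt, wrap, insN]
      grind

/-- Summation over the twisted cycles is compatible with the faces. -/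
theorem sum_faceN_matN {γ : Γ} {n i : ℕ} (hi : i ≤ n + 1) {V : Type*} [AddCommGroup V] [Module ℂ V]
    (G : (Fin (n + 1) → Γ) → PiTensorProduct ℂ (fun _ : Fin (n + 1) => D) →ₗ[ℂ] V) (x : ℕ → R) :
    ∑ k : Fin (n + 2) → Γ, G (tup n (kfaceN n i (seqOf k)))
        (tens n (faceN (C.act γ) n i (C.matN γ (n + 1) (seqOf k) x))) =
      ∑ k, G k (tens n (C.matN γ n (seqOf k) (faceN id n i x))) := by
  have hK : ∀ (k : Fin (n + 1) → Γ) (c : Γ), ∀ m ≤ n + 1,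
      seqOf (tup (n + 1) (insN n i c (seqOf k))) m = insN n i c (seqOf k) m := fun k c m hm =>
    seqOf_tup _ hm
  rw [← Fintype.sum_bijective _ (insN_bijective Γ n i hi) _ _ fun _ => rfl,
    Fintype.sum_prod_type]
  refine Finset.sum_congr rfl fun k _ => ?_
  have hs : (if i = n + 1 then 0 else i) ≤ n := by split_ifs <;> omega
  rw [← sum_tens (Γ := Γ) hs (C.matN γ n (seqOf k) (faceN id n i x))
    (fun c => faceN (C.act γ) n i (C.matN γ (n + 1) (insN n i c (seqOf k)) x))
    (fun c m hm hms => C.faceN_matN_insN_of_ne hi c (seqOf k) x hm hms)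
    (C.sum_faceN_matN_insN hi (seqOf k) x _ rfl), map_sum]
  refine Finset.sum_congr rfl fun c _ => ?_
  congr 1
  · congr 1
    rw [← tup_seqOf k]
    refine tup_congr fun m hm => ?_
    rw [tup_seqOf, ← kfaceN_insN (i := i) c (seqOf k) hm]
    unfold kfaceN
    rw [hK k c (n + 1) le_rfl, hK k c m (by omega), hK k c (m + 1) (by omega)]
  · refine congrArg (PiTensorProduct.tprod ℂ) (tup_congr fun m hm => ?_)
    have hm' : ∀ l ≤ n + 1, C.matN γ (n + 1) (seqOf (tup (n + 1) (insN n i c (seqOf k)))) x l =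
        C.matN γ (n + 1) (insN n i c (seqOf k)) x l := fun l hl =>
      C.matN_congr (hK k c) (fun _ _ => rfl) hl
    unfold faceN
    rw [hm' (n + 1) le_rfl, hm' 0 (by omega), hm' m (by omega), hm' (m + 1) (by omega)]

end CrossedData

namespace CrossedData

variable {Γ : Type v} [Group Γ] [Fintype Γ] {D : Type u} [Ring D] [Algebra ℂ D]
  {R : Type w} [Ring R] [Algebra ℂ R] (C : CrossedData Γ D R)

/-! ### Traces over twisted cycles -/

section Trace

variable {n : ℕ} {V : Type*} [AddCommGroup V] [Module ℂ V]

/-- The sum of `G_k` over the coefficients along all twisted cycles `k`, on unnormalized chains. -/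
def tracePre (γ : Γ)
    (G : (Fin (n + 1) → Γ) → PiTensorProduct ℂ (fun _ : Fin (n + 1) => D) →ₗ[ℂ] V) :
    PiTensorProduct ℂ (fun _ : Fin (n + 1) => R) →ₗ[ℂ] V :=
  ∑ k, G k ∘ₗ PiTensorProduct.map fun i : Fin (n + 1) => C.mat (seqOf k i) (nxt γ n (seqOf k) i)

theorem tracePre_tens (γ : Γ)
    (G : (Fin (n + 1) → Γ) → PiTensorProduct ℂ (fun _ : Fin (n + 1) => D) →ₗ[ℂ] V) (x : ℕ → R) :
    C.tracePre γ G (tens n x) = ∑ k, G k (tens n (C.matN γ n (seqOf k) x)) := by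
  simp only [tracePre, LinearMap.sum_apply, LinearMap.comp_apply, tens, PiTensorProduct.map_tprod]
  rfl

/-- `G_k` vanishes on the tensors whose entry at a trivial step of the cycle is `1`. -/
def Normalized (n : ℕ)
    (G : (Fin (n + 1) → Γ) → PiTensorProduct ℂ (fun _ : Fin (n + 1) => D) →ₗ[ℂ] V) : Prop :=
  ∀ (k : Fin (n + 1) → Γ) (a : ℕ → D) (m : ℕ), m ≠ 0 → m ≤ n →
    seqOf k m = wrap n (seqOf k) (m + 1) → a m = 1 → G k (tens n a) = 0

theorem tens_eq_zero {A : Type u} [Ring A] [Algebra ℂ A] {n m : ℕ} (hm : m ≤ n) {a : ℕ → A}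
    (ha : a m = 0) : tens n a = 0 :=
  MultilinearMap.map_coord_zero _ ⟨m, by omega⟩ ha

/-- If `x_i = 1`, its matrix entry vanishes at every nontrivial step and is `1` at a trivial one.
Thus `G` has to vanish only on tensors with a `1` at a trivial step, a condition weak enough for the
prism operators. -/
theorem tracePre_degen (γ : Γ)
    {G : (Fin (n + 1) → Γ) → PiTensorProduct ℂ (fun _ : Fin (n + 1) => D) →ₗ[ℂ] V}
    (hG : Normalized n G) : degen R n ≤ LinearMap.ker (C.tracePre γ G) := by
  refine Submodule.span_le.2 ?_
  rintro _ ⟨a, ⟨i, hi, ha⟩, rfl⟩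
  have hi0 : (i : ℕ) ≠ 0 := fun h => hi (Fin.ext h)
  have ha' : seqOf a i = 1 := by rw [← ha, ← congrFun (tup_seqOf a) i]
  rw [SetLike.mem_coe, LinearMap.mem_ker, ← tup_seqOf a]
  refine (C.tracePre_tens γ G (seqOf a)).trans (Finset.sum_eq_zero fun k _ => ?_)
  by_cases h : seqOf k i = wrap n (seqOf k) (i + 1)
  · refine hG k _ i hi0 (by omega) h ?_
    rw [matN, nxt, if_neg hi0, ← h, ha', mat_one_self]
  · rw [tens_eq_zero (m := i) (by omega), map_zero]
    rw [matN, nxt, if_neg hi0, ha', C.mat_one_of_ne h]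

/-- The sum of `G_k` over the coefficients along all twisted cycles `k`. -/
def trace (γ : Γ)
    (G : (Fin (n + 1) → Γ) → PiTensorProduct ℂ (fun _ : Fin (n + 1) => D) →ₗ[ℂ] V)
    (hG : Normalized n G) : Chains R n →ₗ[ℂ] V :=
  Submodule.liftQ _ (C.tracePre γ G) (C.tracePre_degen γ hG)

theorem trace_nchain (γ : Γ)
    (G : (Fin (n + 1) → Γ) → PiTensorProduct ℂ (fun _ : Fin (n + 1) => D) →ₗ[ℂ] V)
    (hG : Normalized n G) (x : ℕ → R) :
    C.trace γ G hG (nchain n x) = ∑ k, G k (tens n (C.matN γ n (seqOf k) x)) :=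
  C.tracePre_tens γ G x

/-- The composition of a trace with `b`. -/
theorem trace_chainsb (γ : Γ) {g : R →ₐ[ℂ] R} (hg : (g : R → R) = id)
    (G : (Fin (n + 1) → Γ) → PiTensorProduct ℂ (fun _ : Fin (n + 1) => D) →ₗ[ℂ] V)
    (hG : Normalized n G) (x : ℕ → R) :
    C.trace γ G hG (chainsb g n (nchain (n + 1) x)) =
      ∑ k : Fin (n + 2) → Γ, ∑ i ∈ Finset.range (n + 2), (-1 : ℂ) ^ i •
        G (tup n (kfaceN n i (seqOf k)))
          (tens n (faceN (C.act γ) n i (C.matN γ (n + 1) (seqOf k) x))) := by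
  rw [chainsb_nchain, map_sum, Finset.sum_comm, hg]
  refine Finset.sum_congr rfl fun i hi => ?_
  rw [map_smul, trace_nchain, ← C.sum_faceN_matN (by have := Finset.mem_range.1 hi; omega) G x,
    Finset.smul_sum]

end Trace

/-! ### The morphism to the twisted complex -/

theorem normalized_mkQ {Γ : Type v} (n : ℕ) :
    Normalized n fun _ : Fin (n + 1) → Γ => Submodule.mkQ (degen D n) :=
  fun _ _ _ h0 hm _ ha => nchain_eq_zero h0 hm ha

/-- `x_0 ⊗ … ⊗ x_n ↦ ∑_k mat_{k_0, γ k_1}(x_0) ⊗ mat_{k_1, k_2}(x_1) ⊗ … ⊗ mat_{k_n, k_0}(x_n)`. -/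
def toTwisted (γ : Γ) (n : ℕ) : Chains R n →ₗ[ℂ] Chains D n :=
  C.trace γ (fun _ => Submodule.mkQ _) (normalized_mkQ n)

theorem toTwisted_nchain (γ : Γ) (n : ℕ) (x : ℕ → R) :
    C.toTwisted γ n (nchain n x) = ∑ k : Fin (n + 1) → Γ, nchain n (C.matN γ n (seqOf k) x) :=
  C.trace_nchain γ _ _ x

theorem toTwisted_chainsb (γ : Γ) {g : R →ₐ[ℂ] R} (hg : (g : R → R) = id) (n : ℕ)
    (x : Chains R (n + 1)) :
    C.toTwisted γ n (chainsb g n x) = chainsb (C.act γ) n (C.toTwisted γ (n + 1) x) := by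
  refine LinearMap.congr_fun (f := C.toTwisted γ n ∘ₗ chainsb g n)
    (g := chainsb (C.act γ) n ∘ₗ C.toTwisted γ (n + 1)) (nchain_hom_ext fun x => ?_) x
  rw [LinearMap.comp_apply, LinearMap.comp_apply, toTwisted, C.trace_chainsb γ hg,
    toTwisted_nchain, map_sum]
  refine Finset.sum_congr rfl fun k _ => ?_
  rw [chainsb_nchain]
  rfl

/-- The rotation of a twisted cycle. -/
def rotK (γ : Γ) (n r : ℕ) (k : ℕ → Γ) (p : ℕ) : Γ := rotN (fun h => γ * h) n r k (p + 1)

theorem rotK_bijective (γ : Γ) (n r : ℕ) (hr : r ≤ n) :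
    Function.Bijective fun k : Fin (n + 1) → Γ => tup n (rotK γ n r (seqOf k)) := by
  rw [← Finite.injective_iff_bijective]
  intro k k' h
  have h' : ∀ m ≤ n, rotK γ n r (seqOf k) m = rotK γ n r (seqOf k') m := fun m hm =>
    congrFun h ⟨m, by omega⟩
  rw [← tup_seqOf k, ← tup_seqOf k']
  refine tup_congr fun m hm => ?_
  simp only [rotK, rotN] at h'
  by_cases h0 : m = 0
  · subst h0
    simpa using h' r hr
  · by_cases hmr : m + r ≤ n
    · have := h' (m + r) hmr
      rw [if_pos (by omega), if_pos (by omega), Nat.add_sub_cancel] at this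
      exact mul_left_cancel this
    · have := h' (m + r - (n + 1)) (by omega)
      rw [if_neg (by omega), if_neg (by omega), if_neg (by omega), if_neg (by omega),
        show m + r - (n + 1) + n + 1 - r = m by omega] at this
      exact this

/-- The cycle `γ k_0, k_0, k_1, …`. -/
def consK (γ : Γ) (k : ℕ → Γ) : ℕ → Γ
  | 0 => γ * k 0
  | p + 1 => k p

/-- Entries carried past `a_0` by the rotation have their vertices multiplied by `γ`, and by
equivariance of `mat` this is the action of `γ` prescribed by `B_γ`. The extra vertex `γ k_0` makes
the step at the leading `1` trivial. -/
theorem matN_consK (γ : Γ) {n r : ℕ} (hr : r ≤ n) (k : ℕ → Γ) (x : ℕ → R) {m : ℕ}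
    (hm : m ≤ n + 1) :
    C.matN γ (n + 1) (consK γ (rotK γ n r k)) (rotN id n r x) m =
      rotN (C.act γ) n r (C.matN γ n k x) m := by
  cases m with
  | zero =>
    have : C.matN γ (n + 1) (consK γ (rotK γ n r k)) (rotN id n r x) 0 =
      C.mat (γ * rotK γ n r k 0) (γ * rotK γ n r k 0) 1 := by
      simp [matN, nxt, wrap, consK, rotN]
    rw [this, mat_one_self]
    rfl
  | succ p =>
    have e1 : nxt γ (n + 1) (consK γ (rotK γ n r k)) (p + 1) =
        if p = n then γ * rotK γ n r k 0 else rotK γ n r k (p + 1) := by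
      simp [nxt, wrap, consK]
    simp only [matN, e1, rotN, act_mat]
    simp only [consK, rotK, rotN, nxt, wrap, id]
    grind

/-- Since `B` begins with `1`, only cycles with `k_0 = γ k_1` contribute. Their remaining vertices
form an arbitrary cycle with one vertex fewer, and running through the rotations of the cycles of
`x` reaches each of these once. -/
theorem toTwisted_chainsB (γ : Γ) {g : R →ₐ[ℂ] R} (hg : (g : R → R) = id) (n : ℕ)
    (x : Chains R n) :
    C.toTwisted γ (n + 1) (chainsB g n x) = chainsB (C.act γ) n (C.toTwisted γ n x) := by
  refine LinearMap.congr_fun (f := C.toTwisted γ (n + 1) ∘ₗ chainsB g n)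
    (g := chainsB (C.act γ) n ∘ₗ C.toTwisted γ n) (nchain_hom_ext fun x => ?_) x
  rw [LinearMap.comp_apply, LinearMap.comp_apply, chainsB_nchain, toTwisted_nchain, map_sum,
    map_sum, hg]
  simp only [chainsB_nchain]
  rw [Finset.sum_comm]
  refine Finset.sum_congr rfl fun r hr => ?_
  have hr' : r ≤ n := by have := Finset.mem_range.1 hr; omega
  rw [map_smul, ← Finset.smul_sum, toTwisted_nchain]
  congr 1
  rw [← (Fin.consEquiv fun _ : Fin (n + 2) => Γ).sum_comp, Fintype.sum_prod_type, Finset.sum_comm,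
    ← Fintype.sum_bijective _ (rotK_bijective γ n r hr') _ _ fun _ => rfl]
  refine Finset.sum_congr rfl fun k _ => ?_
  set L := rotK γ n r (seqOf k) with hL
  have hl : ∀ c, ∀ p ≤ n, seqOf (Fin.cons c (tup n L) : Fin (n + 2) → Γ) (p + 1) = L p := by
    intro c p hp
    rw [seqOf, dif_pos (by omega)]
    exact Fin.cons_succ (α := fun _ => Γ) c (tup n L) ⟨p, by omega⟩
  have hl0 : ∀ c, seqOf (Fin.cons c (tup n L) : Fin (n + 2) → Γ) 0 = c := fun c => rfl
  -- The entry at the leading `1` forces the initial vertex to be `γ` times the next one; all other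
  -- initial vertices give `0`.
  rw [Finset.sum_eq_single (γ * L 0)]
  · refine nchain_congr fun m hm => ?_
    rw [← C.matN_consK γ hr' (seqOf k) x hm]
    refine C.matN_congr (fun p hp => ?_) (fun _ _ => rfl) hm
    cases p with
    | zero => exact hl0 _
    | succ p => exact hl _ p (by omega)
  · intro c _ hc
    refine nchain_eq_zero_of_eq_zero (m := 0) (Nat.zero_le _) ?_
    change C.mat (seqOf (Fin.cons c (tup n L) : Fin (n + 2) → Γ) 0)
      (γ * seqOf (Fin.cons c (tup n L) : Fin (n + 2) → Γ) 1) 1 = 0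
    rw [hl c 0 (Nat.zero_le _), hl0]
    exact C.mat_one_of_ne hc
  · simp

/-- The image of `toTwisted` is invariant under the centralizer of `γ`. -/
theorem chainsMap_act_toTwisted (γ : Γ) {h : Γ} (hh : h * γ = γ * h) (n : ℕ) (x : Chains R n) :
    chainsMap (C.act h) n (C.toTwisted γ n x) = C.toTwisted γ n x := by
  refine LinearMap.congr_fun (f := chainsMap (C.act h) n ∘ₗ C.toTwisted γ n)
    (g := C.toTwisted γ n) (nchain_hom_ext fun x => ?_) x
  rw [LinearMap.comp_apply, toTwisted_nchain, map_sum]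
  -- Left multiplication of all vertices by `h` permutes the cycles; it respects the twisted step
  -- because `h` commutes with `γ`.
  refine Fintype.sum_equiv (Equiv.piCongrRight fun _ => Equiv.mulLeft h) _ _ fun k => ?_
  refine (chainsMap_chain _ _).trans (nchain_congr (a := fun m => C.act h _) fun m hm => ?_)
  have hk : ∀ m, seqOf ((Equiv.piCongrRight fun _ => Equiv.mulLeft h) k : Fin (n + 1) → Γ) m =
      h * seqOf k m := by
    intro m
    unfold seqOf
    split_ifs <;> rfl
  have hw : ∀ m, wrap n (seqOf ((Equiv.piCongrRight fun _ => Equiv.mulLeft h) k :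
      Fin (n + 1) → Γ)) m = h * wrap n (seqOf k) m := by
    intro m
    unfold wrap
    rw [hk, hk]
    split_ifs <;> rfl
  simp only [matN, act_mat, hk, nxt, hw]
  split_ifs
  · rw [← mul_assoc, hh, mul_assoc]
  · rfl

/-! ### The section -/

/-- The tuple `(a_0 γ, a_1, …, a_n)`. -/
def secN (γ : Γ) (a : ℕ → D) (m : ℕ) : R := if m = 0 then C.ι (a 0) * C.u γ else C.ι (a m)

/-- `a_0 ⊗ … ⊗ a_n ↦ a_0 γ ⊗ a_1 ⊗ … ⊗ a_n`. -/
def ofTwisted (γ : Γ) (n : ℕ) : Chains D n →ₗ[ℂ] Chains R n :=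
  Submodule.mapQ _ _ (PiTensorProduct.map fun i : Fin (n + 1) =>
    if i = 0 then LinearMap.mulRight ℂ (C.u γ) ∘ₗ C.ι.toLinearMap else C.ι.toLinearMap) (by
    refine Submodule.span_le.2 ?_
    rintro _ ⟨a, ⟨i, hi, ha⟩, rfl⟩
    refine Submodule.subset_span ⟨_, ⟨i, hi, ?_⟩, PiTensorProduct.map_tprod _ _⟩
    simp [hi, ha])

theorem ofTwisted_nchain (γ : Γ) (n : ℕ) (a : ℕ → D) :
    C.ofTwisted γ n (nchain n a) = nchain n (C.secN γ a) := by
  refine (Submodule.mapQ_apply _ _ _ _).trans ?_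
  rw [PiTensorProduct.map_tprod]
  refine congrArg chain (funext fun i => ?_)
  by_cases hi : i = 0
  · subst hi
    simp [secN, tup]
  · have : (i : ℕ) ≠ 0 := fun h => hi (Fin.ext h)
    simp [secN, hi, this]

/-- Moving the `γ` behind `a_0` past `a_1` replaces `a_1` by `γ(a_1)`, which is the twist of the
zeroth face; the last face multiplies from the left and meets no `γ`. -/
theorem faceN_secN (γ : Γ) (n i : ℕ) (a : ℕ → D) (m : ℕ) :
    faceN id n i (C.secN γ a) m = C.secN γ (faceN (C.act γ) n i a) m := by
  have h1 : ∀ a b, C.ι a * C.u γ * C.ι b = C.ι (a * C.act γ b) * C.u γ := fun a b => by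
    rw [mul_assoc, C.u_mul_ι, map_mul, mul_assoc]
  have h2 : ∀ a b, C.ι a * (C.ι b * C.u γ) = C.ι (a * b) * C.u γ := fun a b => by
    rw [map_mul, mul_assoc]
  have h3 : ∀ a b, C.ι a * C.ι b = C.ι (a * b) := fun a b => (map_mul _ _ _).symm
  unfold faceN secN
  by_cases hi : i = n + 1
  · by_cases hm : m = 0
    · simp [hi, hm, h2]
    · simp [hi, hm]
  · rcases lt_trichotomy m i with h | h | h
    · have hi0 : 0 < i := by omega
      simp [hi, h, hi0]
    · subst h
      by_cases hm : m = 0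
      · subst hm
        simp [h1]
      · simp only [hi, hm, h3, if_false, if_true, lt_irrefl, Nat.add_eq_zero_iff, false_and, id]
    · have : m ≠ 0 := by omega
      simp [hi, h.not_gt, h.ne', this]

theorem ofTwisted_chainsb (γ : Γ) {g : R →ₐ[ℂ] R} (hg : (g : R → R) = id) (n : ℕ)
    (x : Chains D (n + 1)) :
    C.ofTwisted γ n (chainsb (C.act γ) n x) = chainsb g n (C.ofTwisted γ (n + 1) x) := by
  refine LinearMap.congr_fun (f := C.ofTwisted γ n ∘ₗ chainsb (C.act γ) n)
    (g := chainsb g n ∘ₗ C.ofTwisted γ (n + 1)) (nchain_hom_ext fun x => ?_) x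
  rw [LinearMap.comp_apply, LinearMap.comp_apply, chainsb_nchain, ofTwisted_nchain,
    chainsb_nchain, map_sum, hg]
  refine Finset.sum_congr rfl fun i _ => ?_
  rw [map_smul, ofTwisted_nchain, nchain_congr fun m _ => C.faceN_secN γ n i x m]

/-- The entries `a_m` with `m ≥ 1` have trivial group part, so only cycles with trivial steps
contribute: they are constant, and the step of `a_0 γ` forces the constant `h` to commute with `γ`.
Such a cycle contributes `h(a_0) ⊗ … ⊗ h(a_n)`. -/
theorem toTwisted_ofTwisted (γ : Γ) [Fintype (Subgroup.centralizer {γ})] (n : ℕ)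
    (x : Chains D n) : C.toTwisted γ n (C.ofTwisted γ n x) =
      ∑ h : Subgroup.centralizer {γ}, chainsMap (C.act h) n x := by
  refine (LinearMap.congr_fun (f := C.toTwisted γ n ∘ₗ C.ofTwisted γ n)
    (g := ∑ h : Subgroup.centralizer {γ}, chainsMap (C.act h) n)
    (nchain_hom_ext fun a => ?_) x).trans (LinearMap.sum_apply _ _ _)
  rw [LinearMap.comp_apply, LinearMap.sum_apply, ofTwisted_nchain, toTwisted_nchain]
  symm
  refine Fintype.sum_of_injective (fun (h : Subgroup.centralizer {γ}) (_ : Fin (n + 1)) => (h : Γ))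
    (fun h h' e => Subtype.ext (congrFun e 0)) _ _ ?_ ?_
  · intro k hk
    obtain ⟨m, hm, hm'⟩ : ∃ m ≤ n, seqOf k m * (if m = 0 then γ else 1) ≠ nxt γ n (seqOf k) m := by
      by_contra! hall
      have hstep : ∀ m, m ≠ 0 → m ≤ n → seqOf k m = wrap n (seqOf k) (m + 1) := fun m h0 hm => by
        simpa [h0, nxt] using hall m hm
      -- Equality of the vertices is propagated downwards from the closing vertex `k_0`; the step
      -- from `0` to `1` is the twisted one and cannot be used.
      have hdown : ∀ d < n, seqOf k (n - d) = seqOf k 0 := by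
        intro d hd
        induction d with
        | zero => rw [hstep _ (by omega) (by omega), wrap, if_pos (by omega)]
        | succ d ih =>
          rw [hstep _ (by omega) (by omega), wrap, if_neg (by omega), ← ih (by omega)]
          congr 1
          omega
      have hconst : ∀ m ≤ n, seqOf k m = seqOf k 0 := by
        intro m hm
        by_cases h0 : m = 0
        · rw [h0]
        · rw [← hdown (n - m) (by omega), Nat.sub_sub_self hm]
      have h1 : wrap n (seqOf k) 1 = seqOf k 0 := by
        rw [wrap]
        split_ifs with h
        · rfl
        · exact hconst 1 (by omega)
      have h2 : seqOf k 0 * γ = γ * seqOf k 0 := by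
        have := hall 0 (Nat.zero_le _)
        rwa [if_pos rfl, nxt, if_pos rfl, h1] at this
      refine hk ⟨⟨seqOf k 0, Subgroup.mem_centralizer_singleton_iff.2 h2⟩, ?_⟩
      exact (tup_congr fun m hm => (hconst m hm).symm).trans (tup_seqOf k)
    refine nchain_eq_zero_of_eq_zero hm ?_
    rw [matN, secN]
    split_ifs at hm' ⊢ with h0
    · subst h0
      exact C.mat_monomial_of_ne hm' _
    · have := C.mat_monomial_of_ne hm' (a m)
      rwa [map_one, mul_one] at this
  · intro h
    refine (chainsMap_chain _ _).trans (nchain_congr (a := fun m => C.act h _) fun m hm => ?_)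
    have hs : ∀ m, seqOf (fun _ : Fin (n + 1) => (h : Γ)) m = h := by
      intro m
      unfold seqOf
      split_ifs <;> rfl
    have hh : (h : Γ) * γ = γ * h := (Subgroup.mem_centralizer_singleton_iff.1 h.2)
    rw [matN, secN, hs, nxt]
    simp only [wrap, hs, ite_self]
    split_ifs with h0
    · subst h0
      rw [C.mat_monomial_of_eq hh]
    · have := C.mat_monomial_of_eq (mul_one (h : Γ)) (a m)
      rw [map_one, mul_one] at this
      rw [this]

end CrossedData

namespace CrossedData

variable {Γ : Type v} [Group Γ] [Fintype Γ] {D : Type u} [Ring D] [Algebra ℂ D]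
  {R : Type w} [Ring R] [Algebra ℂ R] (C : CrossedData Γ D R)

/-! ### The homotopy -/

/-- The element `p⁻¹ a q`. -/
def mono (p q : Γ) : D →ₗ[ℂ] R :=
  LinearMap.mulRight ℂ (C.u q) ∘ₗ LinearMap.mulLeft ℂ (C.u p⁻¹) ∘ₗ C.ι.toLinearMap

theorem mono_apply (p q : Γ) (a : D) : C.mono p q a = C.u p⁻¹ * C.ι a * C.u q := rfl

theorem mono_mul_mono (p q r : Γ) (a b : D) :
    C.mono p q a * C.mono q r b = C.mono p r (a * b) := by
  simp only [mono_apply, mul_assoc, C.u_mul_u_inv_mul, map_mul]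

theorem mono_mul_ι (p γ : Γ) (a b : D) :
    C.mono p γ a * C.ι b = C.mono p γ (a * C.act γ b) := by
  rw [mono_apply, mono_apply, mul_assoc, C.u_mul_ι γ, map_mul]
  simp only [mul_assoc]

theorem mono_mul_u (p q r : Γ) (a : D) : C.mono p q a * C.u r = C.mono p (q * r) a := by
  simp only [mono_apply, mul_assoc, map_mul]

theorem u_mul_mono (p q : Γ) (a : D) : C.u p * C.mono p q a = C.ι a * C.u q := by
  simp only [mono_apply, mul_assoc, C.u_mul_u_inv_mul]

theorem mono_self (p : Γ) : C.mono p p 1 = 1 := by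
  rw [mono_apply, map_one, mul_one, ← map_mul, inv_mul_cancel, map_one]

/-- The tuple `(k_0⁻¹ a_0 γ, a_1, …, a_i, k_{i+1}, k_{i+1}⁻¹ a_{i+1} k_{i+2}, …, k_n⁻¹ a_n k_0)`. -/
def prismN (γ : Γ) (n i : ℕ) (k : ℕ → Γ) (a : ℕ → D) (m : ℕ) : R :=
  if m = i + 1 then C.u (wrap n k (i + 1))
  else if m = 0 then C.mono (k 0) γ (a 0)
  else if m ≤ i then C.ι (a m)
  else C.mono (k (m - 1)) (wrap n k m) (a (m - 1))

/-- Such a face multiplies entries on the side before the inserted element, where moving `γ` past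
`a_1` reproduces the twisted face. -/
theorem faceN_prismN_of_lt (γ : Γ) {n i j : ℕ} (hj : j < i) (hi : i ≤ n + 1) (k : ℕ → Γ)
    (a : ℕ → D) (m : ℕ) :
    faceN id (n + 1) j (C.prismN γ (n + 1) i k a) m =
      C.prismN γ n (i - 1) (kfaceN n j k) (faceN (C.act γ) n j a) m := by
  have e2 := C.mono_mul_ι
  have e3 : ∀ a b, C.ι a * C.ι b = C.ι (a * b) := fun a b => (map_mul _ _ _).symm
  obtain ⟨i, rfl⟩ : ∃ l, i = l + 1 := ⟨i - 1, by omega⟩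
  have h1 : j ≠ n + 1 + 1 := by omega
  have h2 : j ≠ n + 1 := by omega
  simp only [faceN, prismN, kfaceN, wrap, id, h1, h2, if_false, Nat.add_sub_cancel]
  rcases lt_trichotomy m j with h | h | h
  · simp only [h, if_true, h.le]
    grind -ring
  · subst h
    simp only [lt_irrefl, if_true, if_false, le_refl]
    grind -ring
  · have h0 : m ≠ 0 := by omega
    simp only [h.not_gt, h.ne', h.not_ge, h0, if_false, Nat.add_right_cancel_iff,
      Nat.add_eq_zero_iff, false_and]
    clear e2 e3
    rcases lt_trichotomy m (i + 1) with h' | h' | h'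
    · simp only [h'.ne, if_false, Nat.le_of_lt_succ h', if_true, Nat.succ_le_of_lt h']
    · simp only [h', if_true]
      grind -ring
    · have h3 : ¬ m ≤ i := by omega
      have h4 : ¬ m + 1 ≤ i + 1 := by omega
      simp only [h'.ne', if_false, h3, h4]
      grind -ring

/-- Behind the inserted element the conjugating factors between neighbours cancel, `a_m` and
`a_{m+1}` being joined by `k_{m+1} k_{m+1}⁻¹`; the last face cancels `k_0` in the same way. -/
theorem faceN_prismN_of_gt (γ : Γ) {n i j : ℕ} (hi : i + 1 < j) (hj : j ≤ n + 2) (k : ℕ → Γ)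
    (a : ℕ → D) {m : ℕ} (hm : m ≤ n + 1) :
    faceN id (n + 1) j (C.prismN γ (n + 1) i k a) m =
      C.prismN γ n i (kfaceN n (j - 1) k) (faceN (C.act γ) n (j - 1) a) m := by
  have e1 := C.mono_mul_mono
  obtain ⟨j, rfl⟩ : ∃ l, j = l + 1 := ⟨j - 1, by omega⟩
  simp only [faceN, prismN, kfaceN, wrap, id, Nat.add_sub_cancel, Nat.add_right_cancel_iff]
  by_cases hn : j = n + 1
  · simp only [hn, if_true]
    by_cases h0 : m = 0
    · simp only [h0, if_true]
      grind -ring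
    · simp only [h0, if_false]
      grind -ring
  · simp only [hn, if_false]
    rcases lt_trichotomy m (j + 1) with h | h | h
    · simp only [h, if_true, Nat.le_of_lt_succ h]
      grind -ring
    · subst h
      simp only [lt_irrefl, if_true, if_false]
      grind -ring
    · simp only [h.not_gt, h.ne', if_false]
      grind -ring

/-- Neighbouring prisms share a face: both `k_{i+1} · k_{i+1}⁻¹ a_{i+1} k_{i+2}` and `a_{i+1} ·
k_{i+2}` equal `a_{i+1} k_{i+2}`. -/
theorem faceN_prismN_succ (γ : Γ) {n i : ℕ} (hi : i < n) (k : ℕ → Γ) (a : ℕ → D) (m : ℕ) :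
    faceN id n (i + 1) (C.prismN γ n i k a) m =
      faceN id n (i + 1) (C.prismN γ n (i + 1) k a) m := by
  have e6 := C.u_mul_mono
  simp only [faceN, prismN, wrap, id]
  grind -ring

/-- The tuple `(k_0⁻¹ a_0 γ k_1, k_1⁻¹ a_1 k_2, …, k_n⁻¹ a_n k_0)`. -/
def cycleN (γ : Γ) (n : ℕ) (k : ℕ → Γ) (a : ℕ → D) (m : ℕ) : R :=
  C.mono (k m) (nxt γ n k m) (a m)

theorem faceN_prismN_zero (γ : Γ) (n : ℕ) (k : ℕ → Γ) (a : ℕ → D) (m : ℕ) :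
    faceN id n 0 (C.prismN γ n 0 k a) m = C.cycleN γ n k a m := by
  have e4 := C.mono_mul_u
  simp only [faceN, prismN, cycleN, nxt, id]
  grind -ring

/-- At the far end `k_0 · k_0⁻¹ a_0 γ = a_0 γ`, and every other entry is unconjugated. -/
theorem faceN_prismN_last (γ : Γ) (n : ℕ) (k : ℕ → Γ) (a : ℕ → D) {m : ℕ} (hm : m ≤ n) :
    faceN id n (n + 1) (C.prismN γ n n k a) m = C.secN γ a m := by
  have e6 := C.u_mul_mono
  simp only [faceN, prismN, secN, wrap]
  grind -ring

end CrossedData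

/-! ### The prism operators on chains and the homotopy formula -/

namespace CrossedData

variable {Γ : Type v} [Group Γ] [Fintype Γ] {D : Type u} [Ring D] [Algebra ℂ D]
  {R : Type w} [Ring R] [Algebra ℂ R] (C : CrossedData Γ D R)

theorem slotLinear_insertNth {A : Type u} [Ring A] [Algebra ℂ A] {n : ℕ} (p : Fin (n + 1)) (c : A) :
    SlotLinear fun a : Fin n → A => (p.insertNth c a : Fin (n + 1) → A) := fun a l =>
  ⟨p.succAbove l, LinearMap.id, fun x => Fin.insertNth_update (α := fun _ => A) p c l x a⟩

/-- `a_0 ⊗ … ⊗ a_n ↦ k_0⁻¹ a_0 γ ⊗ a_1 ⊗ … ⊗ a_i ⊗ k_{i+1} ⊗ k_{i+1}⁻¹ a_{i+1} k_{i+2} ⊗ …`. -/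
def prismLin (γ : Γ) (n : ℕ) (i : Fin (n + 1)) (k : Fin (n + 1) → Γ) :
    PiTensorProduct ℂ (fun _ : Fin (n + 1) => D) →ₗ[ℂ] Chains R (n + 1) :=
  Submodule.mkQ _ ∘ₗ slotMap _ (slotLinear_insertNth i.succ (C.u (wrap n (seqOf k) (i + 1)))) ∘ₗ
    PiTensorProduct.map fun m : Fin (n + 1) =>
      if m = 0 then C.mono (seqOf k 0) γ
      else if m ≤ i then C.ι.toLinearMap
      else C.mono (seqOf k m) (wrap n (seqOf k) (m + 1))

theorem prismLin_tens (γ : Γ) (n : ℕ) (i : Fin (n + 1)) (k : Fin (n + 1) → Γ) (a : ℕ → D) :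
    C.prismLin γ n i k (tens n a) = nchain (n + 1) (C.prismN γ n i (seqOf k) a) := by
  rw [prismLin, LinearMap.comp_apply, LinearMap.comp_apply, tens, PiTensorProduct.map_tprod,
    slotMap_tprod]
  refine congrArg chain (Fin.insertNth_eq_iff.2 ⟨?_, funext fun m => ?_⟩)
  · simp [prismN]
  · have hi := i.2
    by_cases h : m ≤ i
    · have h' : (m : ℕ) ≤ i := h
      have hs : i.succ.succAbove m = m.castSucc :=
        Fin.succAbove_of_castSucc_lt _ _ (Fin.lt_def.2 (by simp; omega))
      rw [Fin.removeNth, hs]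
      by_cases h0 : m = 0
      · subst h0
        simp [prismN, tup]
      · have h0' : (m : ℕ) ≠ 0 := fun e => h0 (Fin.ext e)
        have : (m : ℕ) ≠ i + 1 := by omega
        simp [prismN, tup, h, h', h0, h0', this]
    · have h' : ¬ (m : ℕ) ≤ i := h
      have hs : i.succ.succAbove m = m.succ :=
        Fin.succAbove_of_le_castSucc _ _ (Fin.le_def.2 (by simp; omega))
      have h0' : (m : ℕ) ≠ 0 := by omega
      have h0 : m ≠ 0 := fun e => h0' (by rw [e]; rfl)
      have h1 : (m : ℕ) ≠ i := by omega
      have h2 : ¬ (m : ℕ) + 1 ≤ i := by omega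
      rw [Fin.removeNth, hs]
      simp [prismN, tup, h, h0, h1, h2]

/-- The alternating sum of the prism operators along the cycle `k`. -/
def prismSum (γ : Γ) (n : ℕ) (k : Fin (n + 1) → Γ) :
    PiTensorProduct ℂ (fun _ : Fin (n + 1) => D) →ₗ[ℂ] Chains R (n + 1) :=
  ∑ i : Fin (n + 1), (-1 : ℂ) ^ (i : ℕ) • C.prismLin γ n i k

theorem prismSum_tens (γ : Γ) (n : ℕ) (k : Fin (n + 1) → Γ) (a : ℕ → D) :
    C.prismSum γ n k (tens n a) =
      ∑ i ∈ Finset.range (n + 1), (-1 : ℂ) ^ i • nchain (n + 1) (C.prismN γ n i (seqOf k) a) := by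
  rw [prismSum, LinearMap.sum_apply,
    ← Fin.sum_univ_eq_sum_range (fun i => (-1 : ℂ) ^ i • nchain (n + 1) (C.prismN γ n i (seqOf k) a))]
  refine Finset.sum_congr rfl fun i _ => ?_
  rw [LinearMap.smul_apply, prismLin_tens]

theorem prismN_congr (γ : Γ) {n i : ℕ} (hi : i ≤ n) {k k' : ℕ → Γ} (h : ∀ m ≤ n, k m = k' m)
    (a : ℕ → D) {m : ℕ} (hm : m ≤ n + 1) : C.prismN γ n i k a m = C.prismN γ n i k' a m := by
  unfold prismN
  rw [wrap_congr h (by omega), wrap_congr h hm, h 0 (Nat.zero_le _), h (m - 1) (by omega)]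

/-- A `1` before the inserted element stays `1`; behind it, it becomes `k_m⁻¹ k_{m+1}`, which is `1`
exactly because the step is assumed trivial. -/
theorem normalized_prismSum (γ : Γ) (n : ℕ) : Normalized n (C.prismSum γ n) := by
  intro k a m h0 hm hk ha
  rw [prismSum_tens]
  refine Finset.sum_eq_zero fun i _ => smul_eq_zero_of_right _ ?_
  by_cases hi : m ≤ i
  · refine nchain_eq_zero (m := m) h0 (by omega) ?_
    rw [prismN, if_neg (by omega), if_neg h0, if_pos hi, ha, map_one]
  · refine nchain_eq_zero (m := m + 1) (by omega) (by omega) ?_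
    rw [prismN, if_neg (by omega), if_neg (by omega), if_neg (by omega), Nat.add_sub_cancel, ha, ← hk,
      mono_self]

/-- The homotopy. -/
def homotopy (γ : Γ) (n : ℕ) : Chains R n →ₗ[ℂ] Chains R (n + 1) :=
  C.trace γ (C.prismSum γ n) (C.normalized_prismSum γ n)

theorem homotopy_nchain (γ : Γ) (n : ℕ) (x : ℕ → R) : C.homotopy γ n (nchain n x) =
    ∑ k : Fin (n + 1) → Γ, C.prismSum γ n k (tens n (C.matN γ n (seqOf k) x)) :=
  C.trace_nchain γ _ _ x

theorem chainsb_prismSum (γ : Γ) {g : R →ₐ[ℂ] R} (hg : (g : R → R) = id) (n : ℕ)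
    (k : Fin (n + 1) → Γ) (a : ℕ → D) : chainsb g n (C.prismSum γ n k (tens n a)) =
      ∑ j ∈ Finset.range (n + 2), ∑ i ∈ Finset.range (n + 1),
        (-1 : ℂ) ^ (j + i) • nchain n (faceN id n j (C.prismN γ n i (seqOf k) a)) := by
  rw [prismSum_tens, map_sum, Finset.sum_comm]
  refine Finset.sum_congr rfl fun i _ => ?_
  rw [map_smul, chainsb_nchain, Finset.smul_sum, hg]
  refine Finset.sum_congr rfl fun j _ => ?_
  rw [smul_smul, ← pow_add, add_comm i j]

theorem chainsb_homotopy_zero (γ : Γ) {g : R →ₐ[ℂ] R} (hg : (g : R → R) = id) (x : ℕ → R) :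
    chainsb g 0 (C.homotopy γ 0 (nchain 0 x)) =
      ∑ k : Fin 1 → Γ, nchain 0 (C.cycleN γ 0 (seqOf k) (C.matN γ 0 (seqOf k) x)) -
        C.ofTwisted γ 0 (C.toTwisted γ 0 (nchain 0 x)) := by
  rw [homotopy_nchain, map_sum, toTwisted_nchain, map_sum, ← Finset.sum_sub_distrib]
  refine Finset.sum_congr rfl fun k _ => ?_
  rw [C.chainsb_prismSum γ hg, ofTwisted_nchain]
  have := prism_sum 0
    (fun j i => nchain 0 (faceN id 0 j (C.prismN γ 0 i (seqOf k) (C.matN γ 0 (seqOf k) x))))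
    (fun _ _ => 0) (fun i j _ _ => by omega) (fun i j _ _ => by omega) (fun i hi => by omega)
  simp only [smul_zero, Finset.sum_const_zero, add_zero] at this
  refine this.trans ?_
  rw [nchain_congr fun m _ => C.faceN_prismN_zero γ 0 (seqOf k) _ m,
    nchain_congr fun m hm => C.faceN_prismN_last γ 0 (seqOf k) _ hm]

/-- For each cycle `k` the prism cancellation leaves the fully conjugated cycle at one end and the
section at the other. The formula holds on all chains; the conjugacy class matters only for
evaluating the first sum. -/
theorem chainsb_homotopy (γ : Γ) {g : R →ₐ[ℂ] R} (hg : (g : R → R) = id) (n : ℕ) (x : ℕ → R) :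
    chainsb g (n + 1) (C.homotopy γ (n + 1) (nchain (n + 1) x)) +
        C.homotopy γ n (chainsb g n (nchain (n + 1) x)) =
      ∑ k : Fin (n + 2) → Γ, nchain (n + 1)
          (C.cycleN γ (n + 1) (seqOf k) (C.matN γ (n + 1) (seqOf k) x)) -
        C.ofTwisted γ (n + 1) (C.toTwisted γ (n + 1) (nchain (n + 1) x)) := by
  rw [homotopy_nchain, map_sum, toTwisted_nchain, map_sum, ← Finset.sum_sub_distrib, homotopy,
    C.trace_chainsb γ hg, ← Finset.sum_add_distrib]
  refine Finset.sum_congr rfl fun k _ => ?_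
  set a := C.matN γ (n + 1) (seqOf k) x
  -- A face of a cycle is stored as a tuple and extended again; the prism reads only entries on
  -- which the two sequences agree.
  have hk : ∀ i j, i ≤ n → nchain (n + 1) (C.prismN γ n i (seqOf (tup n (kfaceN n j (seqOf k))))
      (faceN (C.act γ) n j a)) = nchain (n + 1) (C.prismN γ n i (kfaceN n j (seqOf k))
      (faceN (C.act γ) n j a)) := fun i j hi =>
    nchain_congr fun m hm => C.prismN_congr γ hi (fun l hl => seqOf_tup _ hl) _ hm
  rw [C.chainsb_prismSum γ hg, ofTwisted_nchain]
  simp only [prismSum_tens, Finset.smul_sum, smul_smul, ← pow_add]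
  refine (prism_sum (n + 1)
    (fun j i => nchain (n + 1) (faceN id (n + 1) j (C.prismN γ (n + 1) i (seqOf k) a)))
    (fun j i => nchain (n + 1) (C.prismN γ n i (seqOf (tup n (kfaceN n j (seqOf k))))
      (faceN (C.act γ) n j a))) ?_ ?_ ?_).trans ?_
  · intro i j hj hi
    rw [hk _ _ (by omega)]
    exact nchain_congr fun m _ => C.faceN_prismN_of_lt γ hj hi (seqOf k) a m
  · intro i j hi hj
    rw [hk _ _ (by omega)]
    exact nchain_congr fun m hm => C.faceN_prismN_of_gt γ hi hj (seqOf k) a hm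
  · intro i hi
    exact nchain_congr fun m hm => C.faceN_prismN_succ γ hi (seqOf k) a m
  · rw [nchain_congr fun m _ => C.faceN_prismN_zero γ (n + 1) (seqOf k) a m,
      nchain_congr fun m hm => C.faceN_prismN_last γ (n + 1) (seqOf k) a hm]

end CrossedData

theorem chainsMap_nchain {A : Type u} [Ring A] [Algebra ℂ A] {A' : Type v} [Ring A'] [Algebra ℂ A']
    (f : A →ₐ[ℂ] A') (n : ℕ) (a : ℕ → A) :
    chainsMap f n (nchain n a) = nchain n fun m => f (a m) := chainsMap_chain f _

namespace CrossedData

variable {Γ : Type v} [Group Γ] [Fintype Γ] {D : Type u} [Ring D] [Algebra ℂ D]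
  {R : Type w} [Ring R] [Algebra ℂ R] (C : CrossedData Γ D R)

/-! ### The component of a conjugacy class -/

section PartialProducts

variable {Γ : Type v} [Group Γ]

/-- The product `g_0 g_1 ⋯ g_{m-1}`. -/
def partialProd (g : ℕ → Γ) (m : ℕ) : Γ := (List.ofFn fun i : Fin m => g i).prod

theorem partialProd_zero (g : ℕ → Γ) : partialProd g 0 = 1 := rfl

theorem partialProd_succ (g : ℕ → Γ) (m : ℕ) :
    partialProd g (m + 1) = partialProd g m * g m := by
  rw [partialProd, List.ofFn_succ', List.concat_eq_append, List.prod_append, List.prod_singleton]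
  rfl

theorem partialProd_one (g : ℕ → Γ) : partialProd g 1 = g 0 := by
  rw [partialProd_succ, partialProd_zero, one_mul]

end PartialProducts

/-- The span of the tensors `a_0 g_0 ⊗ … ⊗ a_n g_n` with `g_0 ⋯ g_n` conjugate to `γ`. -/
def comp (γ : Γ) (n : ℕ) : Submodule ℂ (Chains R n) :=
  Submodule.span ℂ {c | ∃ (g : Fin (n + 1) → Γ) (x : Fin (n + 1) → R),
    (∀ i, ∃ a, x i = C.ι a * C.u (g i)) ∧ IsConj γ (List.ofFn g).prod ∧ c = chain x}

theorem nchain_mem_comp {γ : Γ} {n : ℕ} (g : ℕ → Γ) (x : ℕ → R)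
    (hx : ∀ m, ∃ a, x m = C.ι a * C.u (g m)) (hg : IsConj γ (partialProd g (n + 1))) :
    nchain n x ∈ C.comp γ n :=
  Submodule.subset_span ⟨tup n g, tup n x, fun i => hx i, hg, rfl⟩

theorem mem_comp_of_forall_nchain {γ : Γ} {n m : ℕ} {A : Type*} [Ring A] [Algebra ℂ A]
    (F : Chains A m →ₗ[ℂ] Chains R n)
    (h : ∀ x, F (nchain m x) ∈ C.comp γ n) (x : Chains A m) : F x ∈ C.comp γ n := by
  have : (Submodule.mkQ (C.comp γ n)) ∘ₗ F = 0 := nchain_hom_ext fun a => by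
    rw [LinearMap.comp_apply, LinearMap.zero_apply, Submodule.mkQ_apply,
      Submodule.Quotient.mk_eq_zero]
    exact h a
  have := LinearMap.congr_fun this x
  rwa [LinearMap.comp_apply, LinearMap.zero_apply, Submodule.mkQ_apply,
    Submodule.Quotient.mk_eq_zero] at this

theorem ι_eq_monomial (a : D) : C.ι a = C.ι a * C.u 1 := by rw [map_one, mul_one]

theorem u_eq_monomial (g : Γ) : C.u g = C.ι 1 * C.u g := by rw [map_one, one_mul]

theorem mono_eq_monomial (p q : Γ) (a : D) :
    C.mono p q a = C.ι (C.act p⁻¹ a) * C.u (p⁻¹ * q) := by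
  rw [mono_apply, C.u_mul_ι, map_mul, mul_assoc]

theorem ofTwisted_mem (γ : Γ) (n : ℕ) (x : Chains D n) : C.ofTwisted γ n x ∈ C.comp γ n := by
  refine C.mem_comp_of_forall_nchain (C.ofTwisted γ n) (fun a => ?_) x
  rw [ofTwisted_nchain]
  refine C.nchain_mem_comp (fun m => if m = 0 then γ else 1) _ (fun m => ?_) ?_
  · by_cases h : m = 0
    · exact ⟨a 0, by simp [secN, h]⟩
    · exact ⟨a m, by simp [secN, h]⟩
  · have : ∀ m, partialProd (fun m => if m = 0 then γ else 1) (m + 1) = γ := by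
      intro m
      induction m with
      | zero => rw [partialProd_one, if_pos rfl]
      | succ m ih => rw [partialProd_succ, ih, if_neg (by omega), mul_one]
    rw [this]

/-- The group parts of a prism tensor multiply to `k_0⁻¹ γ k_0`, whatever the prism and the cycle,
so the homotopy lands in the component of `γ` even for chains outside it. -/
theorem homotopy_mem (γ : Γ) (n : ℕ) (x : Chains R n) : C.homotopy γ n x ∈ C.comp γ (n + 1) := by
  refine C.mem_comp_of_forall_nchain (C.homotopy γ n) (fun x => ?_) x
  rw [homotopy_nchain]
  refine Submodule.sum_mem _ fun k _ => ?_
  rw [prismSum_tens]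
  refine Submodule.sum_mem _ fun i hi => Submodule.smul_mem _ _ ?_
  have hi' : i ≤ n := by have := Finset.mem_range.1 hi; omega
  set l := seqOf k
  set g : ℕ → Γ := fun m => if m = i + 1 then wrap n l (i + 1) else if m = 0 then (l 0)⁻¹ * γ
    else if m ≤ i then 1 else (l (m - 1))⁻¹ * wrap n l m with hg
  refine C.nchain_mem_comp g _ (fun m => ?_) ?_
  · simp only [hg, prismN]
    split_ifs
    · exact ⟨_, C.u_eq_monomial _⟩
    · exact ⟨_, C.mono_eq_monomial _ _ _⟩
    · exact ⟨_, C.ι_eq_monomial _⟩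
    · exact ⟨_, C.mono_eq_monomial _ _ _⟩
  -- The partial products stay at `k_0⁻¹ γ` up to place `i`; from the inserted element on they
  -- telescope to `k_0⁻¹ γ k_m`.
  · have key : ∀ m ≤ n + 1, partialProd g (m + 1) =
        if m ≤ i then (l 0)⁻¹ * γ else (l 0)⁻¹ * γ * wrap n l m := by
      intro m hm
      induction m with
      | zero =>
        rw [partialProd_one, if_pos (Nat.zero_le _)]
        simp [hg]
      | succ m ih =>
        rw [partialProd_succ, ih (by omega)]
        rcases lt_trichotomy m i with h | h | h
        · rw [if_pos h.le, if_pos (by omega)]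
          simp only [hg]
          rw [if_neg (by omega), if_neg (by omega), if_pos (by omega), mul_one]
        · subst h
          rw [if_pos le_rfl, if_neg (by omega)]
          simp only [hg, if_true]
        · rw [if_neg (by omega), if_neg (by omega)]
          simp only [hg]
          rw [if_neg (by omega), if_neg (by omega), if_neg (by omega), Nat.add_sub_cancel]
          have : wrap n l m = l m := if_neg (by omega)
          rw [this, mul_assoc _ (l m), mul_inv_cancel_left]
    rw [key (n + 1) le_rfl, if_neg (by omega)]
    have : wrap n l (n + 1) = l 0 := if_pos rfl
    rw [this]
    exact isConj_iff.2 ⟨(l 0)⁻¹, by rw [inv_inv]⟩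

/-- Conjugation undoes the matrix entry: `k⁻¹ · k(a) · k g = a g`. -/
theorem cycleN_matN_of_eq {γ : Γ} {n : ℕ} {k : ℕ → Γ} {x : ℕ → R} {m : ℕ} {g : Γ} {a : D}
    (hx : x m = C.ι a * C.u g) (h : k m * g = nxt γ n k m) :
    C.cycleN γ n k (C.matN γ n k x) m = x m := by
  rw [cycleN, matN, hx, C.mat_monomial_of_eq h, mono_eq_monomial, ← C.act_mul, inv_mul_cancel,
    C.act_one, ← h, inv_mul_cancel_left]

theorem cycleN_matN_of_ne {γ : Γ} {n : ℕ} {k : ℕ → Γ} {x : ℕ → R} {m : ℕ} {g : Γ} {a : D}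
    (hx : x m = C.ι a * C.u g) (h : k m * g ≠ nxt γ n k m) :
    C.cycleN γ n k (C.matN γ n k x) m = 0 := by
  rw [cycleN, matN, hx, C.mat_monomial_of_ne h, map_zero]

/-- The number of twisted cycles along which a monomial tensor does not vanish. -/
theorem sum_cycleN_matN (γ : Γ) [Fintype (Subgroup.centralizer {γ})] (n : ℕ) (g : ℕ → Γ)
    (x : ℕ → R) (hx : ∀ m ≤ n, ∃ a, x m = C.ι a * C.u (g m))
    (hg : IsConj γ (partialProd g (n + 1))) :
    ∑ k : Fin (n + 1) → Γ, nchain n (C.cycleN γ n (seqOf k) (C.matN γ n (seqOf k) x)) =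
      (Fintype.card (Subgroup.centralizer {γ}) : ℂ) • nchain n x := by
  obtain ⟨c, hc⟩ := isConj_iff.1 hg
  have hc' : γ * c⁻¹ = c⁻¹ * partialProd g (n + 1) := by rw [← hc]; group
  -- A contributing cycle is determined by `k_0`, with `k_m = γ⁻¹ k_0 g_0 ⋯ g_{m-1}` for `m ≥ 1`. It
  -- closes up when `γ k_0 = k_0 g_0 ⋯ g_n`; as `g_0 ⋯ g_n = c γ c⁻¹`, this says that `z = k_0 c`
  -- centralizes `γ`.
  set K : Subgroup.centralizer {γ} → ℕ → Γ := fun z m =>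
    if m = 0 then z * c⁻¹ else γ⁻¹ * (z * c⁻¹) * partialProd g m with hK
  have hz : ∀ z : Subgroup.centralizer {γ}, (z : Γ) * γ = γ * z := fun z =>
    Subgroup.mem_centralizer_singleton_iff.1 z.2
  have hKlast : ∀ z, K z 0 = γ⁻¹ * (z * c⁻¹) * partialProd g (n + 1) := by
    intro z
    simp only [hK, if_true]
    rw [mul_assoc, mul_assoc, ← hc', ← mul_assoc (z : Γ), hz]
    group
  have hKw : ∀ z m, m ≠ 0 → wrap n (K z) m = γ⁻¹ * (z * c⁻¹) * partialProd g m := by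
    intro z m hm
    unfold wrap
    split_ifs with h
    · rw [h, hKlast]
    · simp [hK, hm]
  have hKn : ∀ z, ∀ m ≤ n, K z m * g m = nxt γ n (K z) m := by
    intro z m hm
    unfold nxt
    split_ifs with h0
    · subst h0
      rw [hKw z 1 one_ne_zero, partialProd_one]
      simp [hK, mul_assoc]
    · rw [hKw z _ (by omega), partialProd_succ]
      simp [hK, h0, mul_assoc]
  have hcard : (Fintype.card (Subgroup.centralizer {γ}) : ℂ) • nchain n x =
      ∑ _z : Subgroup.centralizer {γ}, nchain n x := by
    rw [Finset.sum_const, Finset.card_univ, Nat.cast_smul_eq_nsmul]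
  rw [hcard]
  symm
  refine Fintype.sum_of_injective (fun z => tup n (K z)) ?_ _ _ ?_ ?_
  · intro z z' h
    have : K z 0 = K z' 0 := congrFun h 0
    simp only [hK, if_true] at this
    exact Subtype.ext (mul_right_cancel this)
  · intro k hk
    -- A cycle not of this form fails at some step, where the matrix entry of the monomial is `0`.
    obtain ⟨m, hm, hm'⟩ : ∃ m ≤ n, seqOf k m * g m ≠ nxt γ n (seqOf k) m := by
      by_contra! hall
      have hw : ∀ m ≤ n, wrap n (seqOf k) (m + 1) = γ⁻¹ * seqOf k 0 * partialProd g (m + 1) := by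
        intro m hm
        induction m with
        | zero =>
          have := hall 0 hm
          rw [nxt, if_pos rfl] at this
          rw [partialProd_one, mul_assoc, this, inv_mul_cancel_left]
        | succ m ih =>
          have := hall (m + 1) hm
          rw [nxt, if_neg (by omega)] at this
          have ih := ih (by omega)
          rw [wrap, if_neg (by omega)] at ih
          rw [← this, ih, partialProd_succ g (m + 1), mul_assoc]
      have h0 : γ * seqOf k 0 = seqOf k 0 * partialProd g (n + 1) := by
        have := hw n le_rfl
        rw [wrap, if_pos rfl, mul_assoc, eq_inv_mul_iff_mul_eq] at this
        exact this
      have hcen : seqOf k 0 * c * γ = γ * (seqOf k 0 * c) := by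
        rw [← mul_assoc, h0, ← hc]
        group
      refine hk ⟨⟨seqOf k 0 * c, Subgroup.mem_centralizer_singleton_iff.2 hcen⟩, ?_⟩
      refine (tup_congr fun m hm => ?_).trans (tup_seqOf k)
      simp only [hK, mul_inv_cancel_right]
      split_ifs with h
      · rw [h]
      · obtain ⟨m, rfl⟩ : ∃ l, m = l + 1 := ⟨m - 1, by omega⟩
        rw [← hw m (by omega), wrap, if_neg (by omega)]
    obtain ⟨a, ha⟩ := hx m hm
    exact nchain_eq_zero_of_eq_zero hm (C.cycleN_matN_of_ne ha hm')
  · intro z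
    refine nchain_congr fun m hm => ?_
    obtain ⟨a, ha⟩ := hx m hm
    refine (C.cycleN_matN_of_eq ha ?_).symm
    rw [seqOf_tup _ hm, nxt_congr (fun l hl => seqOf_tup (K z) hl) hm, hKn z m hm]

theorem chainsb_homotopy_zero_of_mem (γ : Γ) [Fintype (Subgroup.centralizer {γ})] {g : R →ₐ[ℂ] R}
    (hg : (g : R → R) = id) {x : Chains R 0} (hx : x ∈ C.comp γ 0) :
    chainsb g 0 (C.homotopy γ 0 x) = (Fintype.card (Subgroup.centralizer {γ}) : ℂ) • x -
      C.ofTwisted γ 0 (C.toTwisted γ 0 x) := by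
  refine LinearMap.eqOn_span' (f := chainsb g 0 ∘ₗ C.homotopy γ 0)
    (g := (Fintype.card (Subgroup.centralizer {γ}) : ℂ) • LinearMap.id -
      C.ofTwisted γ 0 ∘ₗ C.toTwisted γ 0) ?_ hx
  rintro _ ⟨h, y, hy, hh, rfl⟩
  simp only [LinearMap.comp_apply, LinearMap.sub_apply, LinearMap.smul_apply, LinearMap.id_apply]
  rw [chain_eq_nchain, C.chainsb_homotopy_zero γ hg, C.sum_cycleN_matN γ 0 (seqOf h)]
  · intro m hm
    rw [seqOf, seqOf, dif_pos (by omega), dif_pos (by omega)]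
    exact hy _
  · rwa [← tup_seqOf h] at hh

/-- On the monomials that span the component, the count of cycles turns the first end of the prisms
into multiplication by the order of the centralizer. -/
theorem chainsb_homotopy_of_mem (γ : Γ) [Fintype (Subgroup.centralizer {γ})] {g : R →ₐ[ℂ] R}
    (hg : (g : R → R) = id) (n : ℕ) {x : Chains R (n + 1)} (hx : x ∈ C.comp γ (n + 1)) :
    chainsb g (n + 1) (C.homotopy γ (n + 1) x) + C.homotopy γ n (chainsb g n x) =
      (Fintype.card (Subgroup.centralizer {γ}) : ℂ) • x -
        C.ofTwisted γ (n + 1) (C.toTwisted γ (n + 1) x) := by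
  refine LinearMap.eqOn_span' (f := chainsb g (n + 1) ∘ₗ C.homotopy γ (n + 1) +
      C.homotopy γ n ∘ₗ chainsb g n)
    (g := (Fintype.card (Subgroup.centralizer {γ}) : ℂ) • LinearMap.id -
      C.ofTwisted γ (n + 1) ∘ₗ C.toTwisted γ (n + 1)) ?_ hx
  rintro _ ⟨h, y, hy, hh, rfl⟩
  simp only [LinearMap.comp_apply, LinearMap.add_apply, LinearMap.sub_apply, LinearMap.smul_apply,
    LinearMap.id_apply]
  rw [chain_eq_nchain, C.chainsb_homotopy γ hg, C.sum_cycleN_matN γ (n + 1) (seqOf h)]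
  · intro m hm
    rw [seqOf, seqOf, dif_pos (by omega), dif_pos (by omega)]
    exact hy _
  · rwa [← tup_seqOf h] at hh

/-! ### Naturality -/

/-- Homomorphisms of crossed products. -/
structure Hom {D' : Type*} [Ring D'] [Algebra ℂ D'] {R' : Type*} [Ring R'] [Algebra ℂ R']
    (C : CrossedData Γ D R) (C' : CrossedData Γ D' R') where
  f : D →ₐ[ℂ] D'
  F : R →ₐ[ℂ] R'
  map_act : ∀ g a, f (C.act g a) = C'.act g (f a)
  map_ι : ∀ a, F (C.ι a) = C'.ι (f a)
  map_u : ∀ g, F (C.u g) = C'.u g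

namespace Hom

variable {D' : Type*} [Ring D'] [Algebra ℂ D'] {R' : Type*} [Ring R'] [Algebra ℂ R']
  {C : CrossedData Γ D R} {C' : CrossedData Γ D' R'} (φ : Hom C C')

theorem map_coeff (g : Γ) (x : R) : φ.f (C.coeff g x) = C'.coeff g (φ.F x) := by
  conv_rhs => rw [← C.sum_coeff x]
  simp only [map_sum, map_mul, φ.map_ι, φ.map_u]
  rw [Finset.sum_eq_single g]
  · rw [C'.coeff_self]
  · exact fun h _ hh => C'.coeff_of_ne _ _ _ hh.symm
  · simp

theorem map_mat (k l : Γ) (x : R) : φ.f (C.mat k l x) = C'.mat k l (φ.F x) := by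
  rw [mat_apply, mat_apply, φ.map_act, φ.map_coeff]

theorem map_mono (p q : Γ) (a : D) : φ.F (C.mono p q a) = C'.mono p q (φ.f a) := by
  rw [mono_apply, mono_apply, map_mul, map_mul, φ.map_ι, φ.map_u, φ.map_u]

theorem map_matN (γ : Γ) (n : ℕ) (k : ℕ → Γ) (x : ℕ → R) (m : ℕ) :
    φ.f (C.matN γ n k x m) = C'.matN γ n k (fun m => φ.F (x m)) m := φ.map_mat _ _ _

/-- Naturality has two uses: for the projections between the levels it yields the map on
completions, and for the maps induced by an equivariant homomorphism it yields the naturality of the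
isomorphisms. -/
theorem map_toTwisted (γ : Γ) (n : ℕ) (x : Chains R n) :
    chainsMap φ.f n (C.toTwisted γ n x) = C'.toTwisted γ n (chainsMap φ.F n x) := by
  refine LinearMap.congr_fun (f := chainsMap φ.f n ∘ₗ C.toTwisted γ n)
    (g := C'.toTwisted γ n ∘ₗ chainsMap φ.F n) (nchain_hom_ext fun x => ?_) x
  rw [LinearMap.comp_apply, LinearMap.comp_apply, toTwisted_nchain, map_sum, chainsMap_nchain,
    toTwisted_nchain]
  refine Finset.sum_congr rfl fun k _ => ?_
  rw [chainsMap_nchain]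
  exact nchain_congr fun m _ => φ.map_matN γ n _ x m

theorem map_ofTwisted (γ : Γ) (n : ℕ) (x : Chains D n) :
    chainsMap φ.F n (C.ofTwisted γ n x) = C'.ofTwisted γ n (chainsMap φ.f n x) := by
  refine LinearMap.congr_fun (f := chainsMap φ.F n ∘ₗ C.ofTwisted γ n)
    (g := C'.ofTwisted γ n ∘ₗ chainsMap φ.f n) (nchain_hom_ext fun x => ?_) x
  rw [LinearMap.comp_apply, LinearMap.comp_apply, ofTwisted_nchain, chainsMap_nchain,
    chainsMap_nchain, ofTwisted_nchain]
  refine nchain_congr fun m _ => ?_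
  unfold secN
  split_ifs
  · rw [map_mul, φ.map_ι, φ.map_u]
  · rw [φ.map_ι]

theorem map_homotopy (γ : Γ) (n : ℕ) (x : Chains R n) :
    chainsMap φ.F (n + 1) (C.homotopy γ n x) = C'.homotopy γ n (chainsMap φ.F n x) := by
  refine LinearMap.congr_fun (f := chainsMap φ.F (n + 1) ∘ₗ C.homotopy γ n)
    (g := C'.homotopy γ n ∘ₗ chainsMap φ.F n) (nchain_hom_ext fun x => ?_) x
  rw [LinearMap.comp_apply, LinearMap.comp_apply, homotopy_nchain, map_sum, chainsMap_nchain,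
    homotopy_nchain]
  refine Finset.sum_congr rfl fun k _ => ?_
  rw [prismSum_tens, prismSum_tens, map_sum]
  refine Finset.sum_congr rfl fun i _ => ?_
  rw [map_smul, chainsMap_nchain]
  congr 1
  refine nchain_congr fun m _ => ?_
  unfold prismN
  split_ifs
  · rw [φ.map_u]
  · rw [φ.map_mono, φ.map_matN]
  · rw [φ.map_ι, φ.map_matN]
  · rw [φ.map_mono, φ.map_matN]

end Hom

end CrossedData

/-! ### Linear maps between inverse limits -/

namespace Mixed

/-- The linear map of inverse limits induced by linear maps compatible with the projections. -/
def limLin {L : ℕ → Mixed.{u}} {p : ∀ j, Hom (L (j + 1)) (L j)} {L' : ℕ → Mixed.{v}}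
    {p' : ∀ j, Hom (L' (j + 1)) (L' j)} {n m : ℕ} (F : ∀ j, (L j).X n →ₗ[ℂ] (L' j).X m)
    (hF : ∀ j x, F j ((p j).f n x) = (p' j).f m (F (j + 1) x)) :
    (lim L p).X n →ₗ[ℂ] (lim L' p').X m where
  toFun x := ⟨fun j => F j (x.1 j), fun j => (hF j (x.1 (j + 1))).symm.trans (congrArg _ (x.2 j))⟩
  map_add' x y := Subtype.ext (funext fun j => map_add (F j) (x.1 j) (y.1 j))
  map_smul' c x := Subtype.ext (funext fun j => map_smul (F j) c (x.1 j))

/-- The projection of an inverse limit to its `j`-th term. -/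
def limProj (L : ℕ → Mixed.{u}) (p : ∀ j, Hom (L (j + 1)) (L j)) (n j : ℕ) :
    (lim L p).X n →ₗ[ℂ] (L j).X n where
  toFun x := x.1 j
  map_add' _ _ := rfl
  map_smul' _ _ := rfl

end Mixed

namespace GAlg

variable {Γ : Type v} [Group Γ]

/-! ### The quotients of a crossed product by powers of the ideal -/

/-- Coefficients of a product are sums of terms `a · g(b)`, and `g` preserves `I`; so each further
factor from `I ⋊ Γ` contributes a factor from `I`. Together with the inclusion of `I` in `I ⋊ Γ`
this identifies the quotients with crossed products. -/
theorem coeff_mem_pow (P : GAlg.{u} Γ) (j : ℕ) :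
    ∀ x ∈ P.crossedIdeal ^ j, ∀ g, x.coeff g ∈ P.I ^ j := by
  classical
  have hsmul : ∀ (j : ℕ) (g : Γ), ∀ a ∈ P.I ^ j, g • a ∈ P.I ^ j := fun j g a ha =>
    le_comap_pow (MulSemiringAction.toAlgHom ℂ P.A g) (P.smul_mem g) j ha
  induction j with
  | zero => intro x _ g; simp [Submodule.pow_zero, Ideal.one_eq_top]
  | succ j ih =>
    intro x hx
    rw [Submodule.pow_succ] at hx
    refine Submodule.mul_induction_on hx (fun y hy z hz g => ?_) (fun y z hy hz g => ?_)
    · rw [SkewMonoidAlgebra.coeff_mul]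
      refine Submodule.sum_mem _ fun h _ => Submodule.sum_mem _ fun k _ => ?_
      dsimp only
      split_ifs
      · rw [Submodule.pow_succ]
        exact Ideal.mul_mem_mul (ih y hy h) (P.smul_mem h _ (hz k))
      · exact Submodule.zero_mem _
    · rw [SkewMonoidAlgebra.coeff_add]
      exact Ideal.add_mem _ (hy g) (hz g)

/-- The inclusion of `A` in `A ⋊ Γ`. -/
def inclAlgHom (P : GAlg.{u} Γ) : P.A →ₐ[ℂ] SkewMonoidAlgebra P.A Γ :=
  { (SkewMonoidAlgebra.singleOneRingHom : P.A →+* SkewMonoidAlgebra P.A Γ) with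
    commutes' := fun _ => rfl }

theorem inclAlgHom_apply (P : GAlg.{u} Γ) (a : P.A) :
    P.inclAlgHom a = SkewMonoidAlgebra.single 1 a := rfl

theorem inclAlgHom_mem (P : GAlg.{u} Γ) (a : P.A) (ha : a ∈ P.I) :
    P.inclAlgHom a ∈ P.crossedIdeal := by
  classical
  intro g
  rw [inclAlgHom_apply, SkewMonoidAlgebra.coeff_single_apply]
  split_ifs
  · exact ha
  · exact P.I.zero_mem

/-- The coefficient of `g`, as a linear map between the quotients. -/
def levelCoeff (P : GAlg.{u} Γ) (j : ℕ) (g : Γ) :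
    (P.crossed.R ⧸ P.crossed.I ^ j) →ₗ[ℂ] (P.A ⧸ P.I ^ j) where
  toFun := QuotientAddGroup.map (P.crossedIdeal ^ j).toAddSubgroup (P.I ^ j).toAddSubgroup
    { toFun := fun x : SkewMonoidAlgebra P.A Γ => x.coeff g
      map_zero' := by simp
      map_add' := fun x y => by simp }
    fun x hx => P.coeff_mem_pow j x hx g
  map_add' := map_add _
  map_smul' c x := by
    obtain ⟨y, rfl⟩ := Ideal.Quotient.mk_surjective x
    exact congrArg (Ideal.Quotient.mk (P.I ^ j))
      (DFunLike.congr_fun (SkewMonoidAlgebra.coeff_smul c y) g)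

theorem single_mul_single_one (P : GAlg.{u} Γ) (a : P.A) (g : Γ) :
    (SkewMonoidAlgebra.single 1 a * SkewMonoidAlgebra.single g 1 : SkewMonoidAlgebra P.A Γ) =
      SkewMonoidAlgebra.single g a := by
  simp [SkewMonoidAlgebra.single_mul_single]

theorem sum_single_coeff {Γ : Type v} {k : Type*} [AddCommMonoid k] [Fintype Γ] (x : SkewMonoidAlgebra k Γ) :
    ∑ g, SkewMonoidAlgebra.single g (x.coeff g) = x := by
  classical
  conv_rhs => rw [← SkewMonoidAlgebra.sum_single x, SkewMonoidAlgebra.sum_def']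
  refine (Finset.sum_subset (Finset.subset_univ _) fun g _ hg => ?_).symm
  have : x.coeff g = 0 := by simpa using hg
  rw [this, SkewMonoidAlgebra.single_zero]

/-- The quotient `(A ⋊ Γ) / (I ⋊ Γ)^j` is the crossed product of `A / I^j` by `Γ`. -/
def levelData [Fintype Γ] (P : GAlg.{u} Γ) (j : ℕ) :
    CrossedData Γ (P.A ⧸ P.I ^ j) (P.crossed.R ⧸ P.crossed.I ^ j) where
  act g := (P.twisted g).twist.level j
  act_one a := by
    obtain ⟨y, rfl⟩ := Ideal.Quotient.mk_surjective a
    exact congrArg (Ideal.Quotient.mk (P.I ^ j)) (one_smul Γ (y : P.A))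
  act_mul g h a := by
    obtain ⟨y, rfl⟩ := Ideal.Quotient.mk_surjective a
    exact congrArg (Ideal.Quotient.mk (P.I ^ j)) (mul_smul g h (y : P.A))
  ι := Ideal.quotientMapₐ (P.crossed.I ^ j) P.inclAlgHom
    (le_comap_pow P.inclAlgHom P.inclAlgHom_mem j)
  u := (Ideal.Quotient.mk (P.crossed.I ^ j)).toMonoidHom.comp (SkewMonoidAlgebra.of P.A Γ)
  u_mul_ι g a := by
    obtain ⟨y, rfl⟩ := Ideal.Quotient.mk_surjective a
    refine congrArg (Ideal.Quotient.mk (P.crossed.I ^ j))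
      (show (SkewMonoidAlgebra.single g 1 * SkewMonoidAlgebra.single 1 y :
        SkewMonoidAlgebra P.A Γ) = SkewMonoidAlgebra.single 1 (g • y) * SkewMonoidAlgebra.single g 1
        from ?_)
    simp [SkewMonoidAlgebra.single_mul_single]
  coeff := P.levelCoeff j
  coeff_self g a := by
    classical
    obtain ⟨y, rfl⟩ := Ideal.Quotient.mk_surjective a
    refine congrArg (Ideal.Quotient.mk (P.I ^ j))
      (show (SkewMonoidAlgebra.single 1 y * SkewMonoidAlgebra.single g 1 :
        SkewMonoidAlgebra P.A Γ).coeff g = y from ?_)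
    rw [single_mul_single_one, SkewMonoidAlgebra.coeff_single_apply, if_pos rfl]
  coeff_of_ne g h a hgh := by
    classical
    obtain ⟨y, rfl⟩ := Ideal.Quotient.mk_surjective a
    refine (congrArg (Ideal.Quotient.mk (P.I ^ j))
      (show (SkewMonoidAlgebra.single 1 y * SkewMonoidAlgebra.single h 1 :
        SkewMonoidAlgebra P.A Γ).coeff g = 0 from ?_)).trans (map_zero _)
    rw [single_mul_single_one, SkewMonoidAlgebra.coeff_single_apply, if_neg hgh.symm]
  sum_coeff x := by
    obtain ⟨y, rfl⟩ := Ideal.Quotient.mk_surjective x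
    conv_rhs => rw [← sum_single_coeff y]
    rw [map_sum]
    refine Finset.sum_congr rfl fun g _ => ?_
    exact congrArg (Ideal.Quotient.mk (P.crossed.I ^ j)) (P.single_mul_single_one (y.coeff g) g)

/-- At every level the twist of the crossed product is the identity, so the untwisted relations
apply. -/
theorem component_isMixed (P : GAlg.{u} Γ) (γ : Γ) : (P.component γ).IsMixed where
  b_b n x := Subtype.ext (Subtype.ext (funext fun j =>
    (hochschild_isMixed (P.twist_level j)).b_b n (x.1.1 j)))
  B_B n x := Subtype.ext (Subtype.ext (funext fun j =>
    (hochschild_isMixed (P.twist_level j)).B_B n (x.1.1 j)))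
  b_B_zero x := Subtype.ext (Subtype.ext (funext fun j =>
    (hochschild_isMixed (P.twist_level j)).b_B_zero (x.1.1 j)))
  b_B n x := Subtype.ext (Subtype.ext (funext fun j =>
    (hochschild_isMixed (P.twist_level j)).b_B n (x.1.1 j)))

variable [Fintype Γ]

theorem levelData_ι_mul_u (P : GAlg.{u} Γ) (j : ℕ) (a : P.A) (g : Γ) :
    (P.levelData j).ι (Ideal.Quotient.mk (P.I ^ j) a) * (P.levelData j).u g =
      Ideal.Quotient.mk (P.crossed.I ^ j) (SkewMonoidAlgebra.single g a) :=
  congrArg (Ideal.Quotient.mk (P.crossed.I ^ j)) (P.single_mul_single_one a g)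

theorem homog_iff (P : GAlg.{u} Γ) (j : ℕ) (g : Γ) (x : P.crossed.R ⧸ P.crossed.I ^ j) :
    P.Homog j g x ↔ ∃ a, x = (P.levelData j).ι a * (P.levelData j).u g := by
  constructor
  · rintro ⟨a, rfl⟩
    exact ⟨_, (P.levelData_ι_mul_u j a g).symm⟩
  · rintro ⟨a, rfl⟩
    obtain ⟨a, rfl⟩ := Ideal.Quotient.mk_surjective a
    exact ⟨a, P.levelData_ι_mul_u j a g⟩

theorem levelComponent_eq (P : GAlg.{u} Γ) (γ : Γ) (j q : ℕ) :
    P.levelComponent γ j q = (P.levelData j).comp γ q := by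
  simp only [levelComponent, CrossedData.comp, homog_iff]

/-- The projections between the quotients are homomorphisms of crossed products. -/
def levelProj (P : GAlg.{u} Γ) (j : ℕ) : CrossedData.Hom (P.levelData (j + 1)) (P.levelData j) where
  f := powProj P.I j
  F := powProj P.crossed.I j
  map_act g a := by
    obtain ⟨y, rfl⟩ := Ideal.Quotient.mk_surjective a
    rfl
  map_ι a := by
    obtain ⟨y, rfl⟩ := Ideal.Quotient.mk_surjective a
    rfl
  map_u _ := rfl

/-- An equivariant homomorphism induces homomorphisms of the quotients. -/
def levelMap {P : GAlg.{u} Γ} {Q : GAlg.{w} Γ} (F : Hom P Q) (γ : Γ) (j : ℕ) :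
    CrossedData.Hom (P.levelData j) (Q.levelData j) where
  f := (twistedMap F γ).level j
  F := (crossedMap F).level j
  map_act g a := by
    obtain ⟨y, rfl⟩ := Ideal.Quotient.mk_surjective a
    exact congrArg (Ideal.Quotient.mk (Q.I ^ j)) (F.smul g y)
  map_ι a := by
    obtain ⟨y, rfl⟩ := Ideal.Quotient.mk_surjective a
    exact congrArg (Ideal.Quotient.mk (Q.crossed.I ^ j)) (crossedAlgHom_single F 1 y)
  map_u g := by
    refine (congrArg (Ideal.Quotient.mk (Q.crossed.I ^ j)) (crossedAlgHom_single F g 1)).trans ?_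
    rw [map_one]
    rfl

/-! ### The transfer for the completions -/

/-- The morphism to the twisted complex at the level of `A / I^j`. -/
def levelTwisted (P : GAlg.{u} Γ) (γ : Γ) (j : ℕ) :
    Mixed.Hom (hochschild (P.crossed.twist.level j)) (hochschild ((P.twisted γ).twist.level j)) where
  f n := (P.levelData j).toTwisted γ n
  comm_b n x := (P.levelData j).toTwisted_chainsb γ (P.twist_level j) n x
  comm_B n x := (P.levelData j).toTwisted_chainsB γ (P.twist_level j) n x

/-- The morphism from the topological Hochschild complex of `Â ⋊ Γ` to the `γ`-twisted one
of `Â`. -/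
def topTwisted (P : GAlg.{u} Γ) (γ : Γ) :
    Mixed.Hom P.crossed.topHochschild (P.twisted γ).topHochschild :=
  Mixed.limMap (P.levelTwisted γ) fun j n x => ((P.levelProj j).map_toTwisted γ n x).symm

/-- The maps `a_0 ⊗ … ⊗ a_n ↦ a_0 γ ⊗ a_1 ⊗ … ⊗ a_n`. -/
def topOfTwisted (P : GAlg.{u} Γ) (γ : Γ) (n : ℕ) :
    (P.twisted γ).topHochschild.X n →ₗ[ℂ] P.crossed.topHochschild.X n :=
  Mixed.limLin (fun j => (P.levelData j).ofTwisted γ n)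
    fun j x => ((P.levelProj j).map_ofTwisted γ n x).symm

/-- The homotopy on the topological Hochschild complex of `Â ⋊ Γ`. -/
def topHomotopyAux (P : GAlg.{u} Γ) (γ : Γ) (n : ℕ) :
    P.crossed.topHochschild.X n →ₗ[ℂ] P.crossed.topHochschild.X (n + 1) :=
  Mixed.limLin (fun j => (P.levelData j).homotopy γ n)
    fun j x => ((P.levelProj j).map_homotopy γ n x).symm

/-- The maps `topOfTwisted`, with values in the component of `γ`. -/
def topSection (P : GAlg.{u} Γ) (γ : Γ) (n : ℕ) :
    (P.twisted γ).topHochschild.X n →ₗ[ℂ] (P.component γ).X n where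
  toFun x := ⟨P.topOfTwisted γ n x, fun j _ => by
    have h := (P.levelData j).ofTwisted_mem γ n (x.1 j)
    rw [← levelComponent_eq] at h
    exact h⟩
  map_add' x y := Subtype.ext (map_add (P.topOfTwisted γ n) x y)
  map_smul' c x := Subtype.ext (map_smul (P.topOfTwisted γ n) c x)

/-- The homotopy on the component of `γ`. -/
def topHomotopy (P : GAlg.{u} Γ) (γ : Γ) (n : ℕ) :
    (P.component γ).X n →ₗ[ℂ] (P.component γ).X (n + 1) where
  toFun x := ⟨P.topHomotopyAux γ n x.1, fun j _ => by
    have h := (P.levelData j).homotopy_mem γ n (x.1.1 j)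
    rw [← levelComponent_eq] at h
    exact h⟩
  map_add' x y := Subtype.ext (map_add (P.topHomotopyAux γ n) x.1 y.1)
  map_smul' c x := Subtype.ext (map_smul (P.topHomotopyAux γ n) c x.1)

theorem mem_levelData_comp (P : GAlg.{u} Γ) (γ : Γ) {n : ℕ} (x : (P.component γ).X n) (j : ℕ) :
    x.1.1 j ∈ (P.levelData j).comp γ n := by
  rw [← levelComponent_eq]
  exact x.2 j trivial

/-- The comparison of the component of `γ` with the `γ`-twisted complex. -/
def transfer (P : GAlg.{u} Γ) (γ : Γ) [Fintype (Subgroup.centralizer {γ})] :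
    Mixed.Transfer (P.component γ) (P.twisted γ).topHochschild (Subgroup.centralizer {γ}) where
  T :=
    { f := fun n => (P.topTwisted γ).f n ∘ₗ Submodule.subtype _
      comm_b := fun n x => (P.topTwisted γ).comm_b n x.1
      comm_B := fun n x => (P.topTwisted γ).comm_B n x.1 }
  t h := AdicAlg.topMap (P.centralizerMap γ h)
  S := P.topSection γ
  H := P.topHomotopy γ
  -- The remaining relations are identities between compatible families of linear maps, so they may
  -- be checked at each level `j`.
  S_b n x := Subtype.ext (Subtype.ext (funext fun j =>
    (P.levelData j).ofTwisted_chainsb γ (P.twist_level j) n (x.1 j)))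
  T_S n x := Subtype.ext (funext fun j =>
    ((P.levelData j).toTwisted_ofTwisted γ n (x.1 j)).trans
      (map_sum (Mixed.limProj _ _ n j)
        (fun h => (AdicAlg.topMap (P.centralizerMap γ h)).f n x) _).symm)
  t_T h n x := Subtype.ext (funext fun j =>
    (P.levelData j).chainsMap_act_toTwisted γ (Subgroup.mem_centralizer_singleton_iff.1 h.2) n
      (x.1.1 j))
  b_H_zero x := Subtype.ext (Subtype.ext (funext fun j =>
    (P.levelData j).chainsb_homotopy_zero_of_mem γ (P.twist_level j) (P.mem_levelData_comp γ x j)))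
  b_H n x := Subtype.ext (Subtype.ext (funext fun j =>
    (P.levelData j).chainsb_homotopy_of_mem γ (P.twist_level j) n (P.mem_levelData_comp γ x j)))

end GAlg

namespace Mixed

/-! ### Commutative squares of morphisms -/

section Square

variable {M N : Mixed.{u}} {M' N' : Mixed.{v}} {F : Hom M N} {G : Hom N N'} {F' : Hom M M'} {G' : Hom M' N'}

theorem mapHH_square (h : ∀ n x, G.f n (F.f n x) = G'.f n (F'.f n x)) (q : ℕ) (x : M.HH q) :
    G.mapHH q (F.mapHH q x) = G'.mapHH q (F'.mapHH q x) := by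
  obtain ⟨x, rfl⟩ := Submodule.Quotient.mk_surjective _ x
  exact congrArg (Submodule.Quotient.mk (p := Submodule.submoduleOf _ (N'.hhCycles q)))
    (Subtype.ext (h q x.1))

theorem mapHC_square (h : ∀ n x, G.f n (F.f n x) = G'.f n (F'.f n x)) (q : ℕ) (x : M.HC q) :
    G.mapHC q (F.mapHC q x) = G'.mapHC q (F'.mapHC q x) := by
  obtain ⟨x, rfl⟩ := Submodule.Quotient.mk_surjective _ x
  exact congrArg (Submodule.Quotient.mk
    (p := Submodule.submoduleOf _ (N'.cyclicChains q ⊓ LinearMap.ker (N'.cyclicD q))))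
    (Subtype.ext (funext fun m => h m (x.1 m)))

theorem mapHP_square (h : ∀ n x, G.f n (F.f n x) = G'.f n (F'.f n x)) (q : ZMod 2) (x : M.HP q) :
    G.mapHP q (F.mapHP q x) = G'.mapHP q (F'.mapHP q x) := by
  obtain ⟨x, rfl⟩ := Submodule.Quotient.mk_surjective _ x
  exact congrArg (Submodule.Quotient.mk
    (p := Submodule.submoduleOf _ (N'.periodicChains q ⊓ LinearMap.ker N'.tot)))
    (Subtype.ext (funext fun m => h m (x.1 m)))

end Square

end Mixed

namespace GAlg

variable {Γ : Type v} [Group Γ]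

/-! ### The comparison isomorphisms -/

theorem topMap_centralizerMap_twist (P : GAlg.{u} Γ) (γ : Γ) (h : Subgroup.centralizer {γ})
    (n : ℕ) (x : (P.twisted γ).topHochschild.X n) :
    (AdicAlg.topMap (P.centralizerMap γ h)).f n ((AdicAlg.topMap (P.twisted γ).twist).f n x) =
      (AdicAlg.topMap (P.twisted γ).twist).f n
        ((AdicAlg.topMap (P.centralizerMap γ h)).f n x) := by
  refine Subtype.ext (funext fun j => ?_)
  refine LinearMap.congr_fun
    (f := chainsMap ((P.centralizerMap γ h).level j) n ∘ₗ
      chainsMap ((P.twisted γ).twist.level j) n)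
    (g := chainsMap ((P.twisted γ).twist.level j) n ∘ₗ
      chainsMap ((P.centralizerMap γ h).level j) n)
    (chains_hom_ext fun a => ?_) (x.1 j)
  simp only [LinearMap.comp_apply, chainsMap_chain]
  congr 1
  funext i
  obtain ⟨y, hy⟩ := Ideal.Quotient.mk_surjective (a i)
  rw [← hy]
  exact congrArg (Ideal.Quotient.mk (P.I ^ j)) ((P.centralizerMap γ h).comm y)

variable [Fintype Γ]

section Comparison

variable (P : GAlg.{u} Γ) {Q : GAlg.{u} Γ} (γ : Γ) [Fintype (Subgroup.centralizer {γ})]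

/-- The element `γ` belongs to its own centralizer, so it fixes the image of the transfer. -/
theorem transfer_twist (n : ℕ) (x : (P.component γ).X n) :
    (AdicAlg.topMap (P.twisted γ).twist).f n ((P.transfer γ).T.f n x) = (P.transfer γ).T.f n x :=
  Subtype.ext (funext fun j => (P.levelData j).chainsMap_act_toTwisted γ rfl n (x.1.1 j))

/-- The comparison of the component of `γ` with the cyclic object of the `γ`-twisted complex. -/
def cyclicTransfer : Mixed.Hom (P.component γ) (P.twisted γ).topCyclic :=
  (P.transfer γ).coinvT (AdicAlg.topMap (P.twisted γ).twist)

theorem transfer_natural (F : Hom P Q) (n : ℕ) (x : (P.component γ).X n) :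
    (Q.transfer γ).T.f n ((componentMap F γ).f n x) =
      (AdicAlg.topMap (twistedMap F γ)).f n ((P.transfer γ).T.f n x) :=
  Subtype.ext (funext fun j => ((levelMap F γ j).map_toTwisted γ n (x.1.1 j)).symm)

theorem cyclicTransfer_natural (F : Hom P Q) (n : ℕ) (x : (P.component γ).X n) :
    (Q.cyclicTransfer γ).f n ((componentMap F γ).f n x) =
      (AdicAlg.topCyclicMap (twistedMap F γ)).f n ((P.cyclicTransfer γ).f n x) :=
  congrArg (Submodule.mkQ (LinearMap.range
    ((AdicAlg.topMap (Q.twisted γ).twist).f n - LinearMap.id))) (P.transfer_natural γ F n x)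

/-- The isomorphism onto the invariant classes in Hochschild homology. -/
def equivHH (q : ℕ) : (P.component γ).HH q ≃ₗ[ℂ] P.invHH γ q :=
  (LinearEquiv.ofInjective _ ((P.transfer γ).mapHH_spec q).1).trans
    (LinearEquiv.ofEq _ _ ((P.transfer γ).mapHH_spec q).2)

theorem equivHH_coe (q : ℕ) (x : (P.component γ).HH q) :
    (P.equivHH γ q x).1 = (P.transfer γ).T.mapHH q x := rfl

theorem equivHH_natural (F : Hom P Q) (q : ℕ) (x : (P.component γ).HH q) :
    (Q.equivHH γ q ((componentMap F γ).mapHH q x)).1 =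
      (AdicAlg.topMap (twistedMap F γ)).mapHH q (P.equivHH γ q x).1 := by
  rw [equivHH_coe, equivHH_coe]
  exact Mixed.mapHH_square (P.transfer_natural γ F) q x

theorem mapHC_cyclicTransfer (q : ℕ) : Function.Injective ((P.cyclicTransfer γ).mapHC q) ∧
    LinearMap.range ((P.cyclicTransfer γ).mapHC q) = P.invHC γ q :=
  (P.transfer γ).mapHC_spec (AdicAlg.topMap (P.twisted γ).twist) (P.component_isMixed γ)
    (P.transfer_twist γ) (P.topMap_centralizerMap_twist γ) q

theorem mapHP_cyclicTransfer (q : ZMod 2) : Function.Injective ((P.cyclicTransfer γ).mapHP q) ∧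
    LinearMap.range ((P.cyclicTransfer γ).mapHP q) = P.invHP γ q :=
  (P.transfer γ).mapHP_spec (AdicAlg.topMap (P.twisted γ).twist) (P.component_isMixed γ)
    (P.transfer_twist γ) (P.topMap_centralizerMap_twist γ) q

/-- The isomorphism onto the invariant classes in cyclic homology. -/
def equivHC (q : ℕ) : (P.component γ).HC q ≃ₗ[ℂ] P.invHC γ q :=
  (LinearEquiv.ofInjective _ (P.mapHC_cyclicTransfer γ q).1).trans
    (LinearEquiv.ofEq _ _ (P.mapHC_cyclicTransfer γ q).2)

theorem equivHC_coe (q : ℕ) (x : (P.component γ).HC q) :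
    (P.equivHC γ q x).1 = (P.cyclicTransfer γ).mapHC q x := rfl

theorem equivHC_natural (F : Hom P Q) (q : ℕ) (x : (P.component γ).HC q) :
    (Q.equivHC γ q ((componentMap F γ).mapHC q x)).1 =
      (AdicAlg.topCyclicMap (twistedMap F γ)).mapHC q (P.equivHC γ q x).1 := by
  rw [equivHC_coe, equivHC_coe]
  exact Mixed.mapHC_square (P.cyclicTransfer_natural γ F) q x

/-- The isomorphism onto the invariant classes in periodic cyclic homology. -/
def equivHP (q : ZMod 2) : (P.component γ).HP q ≃ₗ[ℂ] P.invHP γ q :=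
  (LinearEquiv.ofInjective _ (P.mapHP_cyclicTransfer γ q).1).trans
    (LinearEquiv.ofEq _ _ (P.mapHP_cyclicTransfer γ q).2)

theorem equivHP_coe (q : ZMod 2) (x : (P.component γ).HP q) :
    (P.equivHP γ q x).1 = (P.cyclicTransfer γ).mapHP q x := rfl

theorem equivHP_natural (F : Hom P Q) (q : ZMod 2) (x : (P.component γ).HP q) :
    (Q.equivHP γ q ((componentMap F γ).mapHP q x)).1 =
      (AdicAlg.topCyclicMap (twistedMap F γ)).mapHP q (P.equivHP γ q x).1 := by
  rw [equivHP_coe, equivHP_coe]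
  exact Mixed.mapHP_square (P.cyclicTransfer_natural γ F) q x

end Comparison

/-! ### The completion of a crossed product -/

/-- The inclusion of the completion of `A` in the completion of `A ⋊ Γ`. -/
def completionIncl (P : GAlg.{u} Γ) : completion P.I →ₐ[ℂ] completion P.crossedIdeal where
  toFun x := ⟨fun j => (P.levelData j).ι (x.1 j), fun j =>
    ((P.levelProj j).map_ι (x.1 (j + 1))).trans (congrArg _ (x.2 j))⟩
  map_one' := Subtype.ext (funext fun j => map_one (P.levelData j).ι)
  map_mul' x y := Subtype.ext (funext fun j => map_mul (P.levelData j).ι (x.1 j) (y.1 j))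
  map_zero' := Subtype.ext (funext fun j => map_zero (P.levelData j).ι)
  map_add' x y := Subtype.ext (funext fun j => map_add (P.levelData j).ι (x.1 j) (y.1 j))
  commutes' c := Subtype.ext (funext fun j => (P.levelData j).ι.commutes c)

/-- The elements of the group, in the completion of `A ⋊ Γ`. -/
def completionOf (P : GAlg.{u} Γ) : Γ →* completion P.crossedIdeal where
  toFun g := ⟨fun j => (P.levelData j).u g, fun j => (P.levelProj j).map_u g⟩
  map_one' := Subtype.ext (funext fun j => map_one (P.levelData j).u)
  map_mul' g h := Subtype.ext (funext fun j => map_mul (P.levelData j).u g h)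

/-- The coefficient of `g`, from the completion of `A ⋊ Γ` to the completion of `A`. -/
def completionCoeff (P : GAlg.{u} Γ) (g : Γ) (y : completion P.crossedIdeal) : completion P.I :=
  ⟨fun j => (P.levelData j).coeff g (y.1 j), fun j =>
    ((P.levelProj j).map_coeff g (y.1 (j + 1))).trans (congrArg _ (y.2 j))⟩

/-- The natural homomorphism from the crossed product of the completion of `A` by `Γ` to the
completion of `A ⋊ Γ`. -/
def completionHom (P : GAlg.{u} Γ) :
    SkewMonoidAlgebra (completion P.I) Γ →ₐ[ℂ] completion P.crossedIdeal :=
  SkewMonoidAlgebra.liftNCAlgHom P.completionIncl P.completionOf fun {x} {g} =>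
    Subtype.ext (funext fun j => ((P.levelData j).u_mul_ι g (x.1 j)).symm)

theorem completionHom_single (P : GAlg.{u} Γ) (g : Γ) (x : completion P.I) :
    P.completionHom (SkewMonoidAlgebra.single g x) = P.completionIncl x * P.completionOf g :=
  SkewMonoidAlgebra.liftNC_single _ _ _ _

theorem completionHom_apply (P : GAlg.{u} Γ) (x : SkewMonoidAlgebra (completion P.I) Γ) (j : ℕ) :
    (P.completionHom x).1 j =
      ∑ g, (P.levelData j).ι ((x.coeff g).1 j) * (P.levelData j).u g := by
  conv_lhs => rw [← sum_single_coeff x, map_sum]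
  have h := map_sum ((Pi.evalRingHom _ j).comp (completion P.crossedIdeal).val.toRingHom)
    (fun g => P.completionHom (SkewMonoidAlgebra.single g (x.coeff g))) Finset.univ
  refine h.trans (Finset.sum_congr rfl fun g _ => ?_)
  rw [completionHom_single]
  rfl

theorem completionCoeff_completionHom (P : GAlg.{u} Γ) (g : Γ)
    (x : SkewMonoidAlgebra (completion P.I) Γ) :
    P.completionCoeff g (P.completionHom x) = x.coeff g := by
  refine Subtype.ext (funext fun j => ?_)
  change (P.levelData j).coeff g ((P.completionHom x).1 j) = _
  rw [completionHom_apply, map_sum, Finset.sum_eq_single g]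
  · rw [(P.levelData j).coeff_self]
  · exact fun h _ hh => (P.levelData j).coeff_of_ne _ _ _ hh.symm
  · simp

/-- The coefficients determine an element and may be prescribed freely: the inverse sends `y` to the
finite sum of its coefficients in the completion of `A` times the group elements. -/
theorem completionHom_bijective (P : GAlg.{u} Γ) : Function.Bijective P.completionHom := by
  constructor
  · intro x y h
    ext g : 1
    rw [← completionCoeff_completionHom, ← completionCoeff_completionHom, h]
  · intro y
    refine ⟨∑ g, SkewMonoidAlgebra.single g (P.completionCoeff g y), ?_⟩
    rw [map_sum]
    refine Subtype.ext (funext fun j => ?_)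
    have h := map_sum ((Pi.evalRingHom _ j).comp (completion P.crossedIdeal).val.toRingHom)
      (fun g => P.completionHom (SkewMonoidAlgebra.single g (P.completionCoeff g y))) Finset.univ
    refine (h.trans (Finset.sum_congr rfl fun g _ => ?_)).trans
      ((P.levelData j).sum_coeff (y.1 j))
    rw [completionHom_single]
    rfl

theorem completionHom_single_apply (P : GAlg.{u} Γ) (g : Γ) (x : completion P.I) (j : ℕ) (a : P.A)
    (h : Ideal.Quotient.mk (P.I ^ j) a = x.1 j) :
    (P.completionHom (SkewMonoidAlgebra.single g x)).1 j =
      Ideal.Quotient.mk (P.crossedIdeal ^ j) (SkewMonoidAlgebra.single g a) := by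
  rw [completionHom_single, ← P.levelData_ι_mul_u, h]
  rfl

end GAlg

end CrossedHomology

end

theorem mainTheorem11 {Γ : Type v} [Group Γ] [Finite Γ] :
    (∀ P : CrossedHomology.GAlg.{u, v} Γ,
      ∃ Φ : SkewMonoidAlgebra (CrossedHomology.completion P.I) Γ ≃ₐ[ℂ]
          CrossedHomology.completion P.crossedIdeal,
        ∀ (g : Γ) (x : CrossedHomology.completion P.I) (j : ℕ) (a : P.A),
          Ideal.Quotient.mk (P.I ^ j) a = x.1 j →
          (Φ (SkewMonoidAlgebra.single g x)).1 j =
            Ideal.Quotient.mk (P.crossedIdeal ^ j) (SkewMonoidAlgebra.single g a)) ∧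
    ∀ γ : Γ,
      (∃ φ : ∀ (P : CrossedHomology.GAlg.{u, v} Γ) (q : ℕ),
          (P.component γ).HH q ≃ₗ[ℂ] P.invHH γ q,
        ∀ (P Q : CrossedHomology.GAlg.{u, v} Γ) (F : P.Hom Q) (q : ℕ)
            (x : (P.component γ).HH q),
          (φ Q q ((CrossedHomology.GAlg.componentMap F γ).mapHH q x)).1 =
            (CrossedHomology.AdicAlg.topMap
              (CrossedHomology.GAlg.twistedMap F γ)).mapHH q (φ P q x).1) ∧
      (∃ φ : ∀ (P : CrossedHomology.GAlg.{u, v} Γ) (q : ℕ),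
          (P.component γ).HC q ≃ₗ[ℂ] P.invHC γ q,
        ∀ (P Q : CrossedHomology.GAlg.{u, v} Γ) (F : P.Hom Q) (q : ℕ)
            (x : (P.component γ).HC q),
          (φ Q q ((CrossedHomology.GAlg.componentMap F γ).mapHC q x)).1 =
            (CrossedHomology.AdicAlg.topCyclicMap
              (CrossedHomology.GAlg.twistedMap F γ)).mapHC q (φ P q x).1) ∧
      (∃ φ : ∀ (P : CrossedHomology.GAlg.{u, v} Γ) (q : ZMod 2),
          (P.component γ).HP q ≃ₗ[ℂ] P.invHP γ q,
        ∀ (P Q : CrossedHomology.GAlg.{u, v} Γ) (F : P.Hom Q) (q : ZMod 2)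
            (x : (P.component γ).HP q),
          (φ Q q ((CrossedHomology.GAlg.componentMap F γ).mapHP q x)).1 =
            (CrossedHomology.AdicAlg.topCyclicMap
              (CrossedHomology.GAlg.twistedMap F γ)).mapHP q (φ P q x).1) := by
  classical
  have := Fintype.ofFinite Γ
  refine ⟨fun P => ⟨AlgEquiv.ofBijective P.completionHom P.completionHom_bijective,
    fun g x j a h => P.completionHom_single_apply g x j a h⟩, fun γ => ?_⟩
  have := Fintype.ofFinite (Subgroup.centralizer {γ})
  exact ⟨⟨fun P q => P.equivHH γ q, fun P _ F q x => P.equivHH_natural γ F q x⟩,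
    ⟨fun P q => P.equivHC γ q, fun P _ F q x => P.equivHC_natural γ F q x⟩,
    ⟨fun P q => P.equivHP γ q, fun P _ F q x => P.equivHP_natural γ F q x⟩⟩
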